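/- **Setting.** Let $\mathcal X\subseteq\mathcal O\subseteq\mathbb R^d$ with $\mathcal X$ compact and convex and $\mathcal O$ open and convex. Norms are Euclidean norms and the matrix norms they induce. Consider $$\min_{x\in\mathcal X} f(x),\qquad f(x)=\mathbb E_{\varepsilon\sim\mathbb P_\varepsilon}\big[\varphi(x,c(x)+Q(x)\varepsilon)\big],$$ and write $\xi(x)=c(x)+Q(x)\varepsilon$. *Assumption 1.* $\varphi:\mathcal O\times\mathbb R^\ell\to\mathbb R$ is convex and $L_\varphi$-Lipschitz; $\mathbb E[\varepsilon]=0$ and $\mathrm{Cov}(\varepsilon)=I_\ell$; $c:\mathcal O\to\mathbb R^\ell$ is $C^1$ with $L_c$-Lipschitz Jacobian; for $x\in\mathcal O$ the matrix $Q(x)\in\mathbb R^{\ell\times\ell}$ with rows $q_1(x)^\top,\dots,q_\ell(x)^\top$ is symmetric positive definite, and each $q_j:\mathcal O\to\mathbb R^\ell$ is $C^1$ with $L_q$-Lipschitz Jacobian. *Oracles and estimators.* Under the static oracle, all data pairs are drawn from one joint law of $(X,\xi)$ such that $X\in\mathcal X$ a.s. and, given $X$, $\xi$ is distributed as $\xi(X)$.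 Under the adaptive oracle at a reference point $z$, a data set $S=\{(X_i,\xi_i)\}_{i\le n}$ has i.i.d. pairs with $X_i$ drawn from a law on $\mathcal X$ depending on $(z,n)$ and, given $X_i$, $\xi_i$ distributed as $\xi(X_i)$; a second data set $W=\{(Y_i,\eta_i)\}_{i\le m}$ has $Y_i=z$ and $\eta_i$ i.i.d. distributed as $\xi(z)$. Under the static oracle $S$ and $W$ consist of $n$ and $m$ i.i.d. pairs; in both cases $S$ and $W$ are independent. The estimators $\hat c_n,\widehat\nabla c_n,\hat q_{j,n},\widehat\nabla q_{j,n}$ are measurable functions of $S$ and of the point of evaluation, and $\widehat Q_n$, the matrix with rows $\hat q_{j,n}^\top$, is a.s. invertible. *Assumption 2.* There is $B>0$ with $\|\varepsilon\|\le B$ a.s. and, for all $n\ge1$ and $z\in\mathcal X$, $\|\hat c_n(z)\|\le B$ a.s. *Assumption 3.* There are $r\in(0,1]$ and $C>0$ such that for all $n\ge1$, $z\in\mathcal X$ and $j$ the quantities $\mathbb E\|\hat c_n(z)-c(z)\|^2$, $\mathbb E\|\widehat\nabla c_n(z)-\nabla c(z)\|^2$, $\mathbb E\|\widehat Q_n(z)-Q(z)\|^2$,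 $\mathbb E\|\widehat\nabla q_{j,n}(z)-\nabla q_j(z)\|^2$ and $\mathbb E\|\widehat Q_n(z)^{-1}-Q(z)^{-1}\|^2$ are at most $Cn^{-r}$ (where $S$ is simulated at the reference point $z$). *Surrogates.* Let $\varepsilon_i=Q(Y_i)^{-1}(\eta_i-c(Y_i))$ and $\hat\varepsilon_i=\widehat Q_n(Y_i)^{-1}(\eta_i-\hat c_n(Y_i))$. For $e\in\mathbb R^\ell$ let $G(z,e)$ and $\widehat G_n(z,e)$ be the matrices with rows $e^\top\nabla q_j(z)$ and $e^\top\widehat\nabla q_{j,n}(z)$. Put $$\widetilde F_\alpha(x;z)=\frac1m\sum_{i=1}^m\varphi\big(x,\,c(z)+\nabla c(z)(x-z)+Q(z)\varepsilon_i+G(z,\varepsilon_i)(x-z)\big)+\frac\alpha2\|x-z\|^2,$$ and let $\widehat F_\alpha(x;z)$ be the same expression with $\hat c_n,\widehat\nabla c_n,\widehat Q_n,\widehat G_n,\hat\varepsilon_i$ in place of $c,\nabla c,Q,G,\varepsilon_i$. *ALS algorithm.* Let $z^0\in\mathcal X$, $n_t,m_t\ge1$, $\alpha_t>0$. For $t=0,\dots,T$: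 simulate $S^t$ and $W^t$, of sizes $n_t$ and $m_t$, from the oracle at the reference point $z^t$ (conditionally on the past, they have the law described above), and let $z^{t+1}$ be the minimizer over $\mathcal X$ of $\widehat F_{\alpha_t}(\,\cdot\,;z^t)$ built from $S^t,W^t$. The output is $z^{t^*}$, where $t^*\in\{0,\dots,T\}$ is random, independent of the iterates, with law $(p_t)_{t=0}^T$. *Constants.* $\tau=L_\varphi(L_c+\ell L_q)$, $\Delta_0=\max_{x,y\in\mathcal X}(f(x)-f(y))$ and $$L=L_\varphi\Big(1+\max_{x\in\mathcal X}\Big(\|\nabla c(x)\|+\sqrt\ell\,\sqrt{\textstyle\sum_{j=1}^\ell\|\nabla q_j(x)\|^2}\Big)\Big).$$ For $\rho_t>\tau$, let $\hat z^t=\mathrm{prox}_{f/\rho_t}(z^t)=\arg\min_{y\in\mathcal X}\{f(y)+\frac{\rho_t}2\|y-z^t\|^2\}$. **Theorem.** Let Assumptions 1–3 hold. There is a constant $\widetilde C>0$ such that $$\sup_{z\in\mathcal X}\mathbb E\Big[\sup_{x\in\mathcal X}\big|\widehat F_\alpha(x;z)-\widetilde F_\alpha(x;z)\big|\Big]\le\widetilde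 C\,n^{-r/2}\qquad\text{for all } n,m\ge1,\ \alpha>0,$$ and for every such $\widetilde C$ the following holds. Let $\bar t\ge0$ be an integer such that for all $t\ge\bar t$ $$\rho_t>\tau,\qquad \alpha_t\ge\rho_t+\tau,\qquad \rho_{t+1}(\rho_t-\tau)>\alpha_t(\rho_{t+1}-\rho_t).$$ For $T\ge\bar t$ put $$P_t=\frac{\rho_{t+1}(\rho_t-\tau)}{\alpha_t}-(\rho_{t+1}-\rho_t),\qquad \Delta(T)=2\Delta_0+\sum_{t=\bar t}^T\frac{4\rho_{t+1}L^2}{m_t\alpha_t^2}+\sum_{t=\bar t}^T\frac{4\rho_{t+1}\widetilde C}{n_t^{r/2}\alpha_t},$$ and let $p_t=0$ for $t<\bar t$ and $p_t=P_t/\sum_{s=\bar t}^TP_s$ for $\bar t\le t\le T$. Then the output of the ALS algorithm satisfies $$\mathbb E\big[\|z^{t^*}-\hat z^{t^*}\|^2\big]\le\frac{\Delta(T)}{\sum_{t=\bar t}^TP_t},\qquad \mathbb E\big[\rho_{t^*}^2\big]\,\mathbb E\big[\|z^{t^*}-\hat z^{t^*}\|^2\big]\le\frac{\big(\sum_{t=\bar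 t}^T\rho_t^2P_t\big)\,\Delta(T)}{\big(\sum_{t=\bar t}^TP_t\big)^2}.$$ -/

import Mathlib

open MeasureTheory ProbabilityTheory

noncomputable section

namespace ALS

/-- Real Euclidean space of dimension `k`. -/
abbrev Vec (k : ℕ) : Type := EuclideanSpace ℝ (Fin k)

/-- A minimizer of `g` over `X` (the minimizer, whenever it is unique). -/
def argminOn {k : ℕ} (X : Set (Vec k)) (g : Vec k → ℝ) : Vec k :=
  Classical.epsilon fun y => y ∈ X ∧ IsMinOn g X y

/-- Proximal operator of `lam * f` over the feasible set `X`. -/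
def prox {k : ℕ} (X : Set (Vec k)) (f : Vec k → ℝ) (lam : ℝ) (x : Vec k) : Vec k :=
  argminOn X fun y => f y + 1 / (2 * lam) * ‖y - x‖ ^ 2

/-- The square matrix with rows `v 0, …, v (ℓ - 1)`. -/
def rowMat {ℓ : ℕ} (v : Fin ℓ → Vec ℓ) : Matrix (Fin ℓ) (Fin ℓ) ℝ :=
  Matrix.of fun j k => v j k

/-- A square matrix as an operator on Euclidean space; its norm is the matrix norm induced by the
Euclidean norm. -/
def op {ℓ : ℕ} (A : Matrix (Fin ℓ) (Fin ℓ) ℝ) : Vec ℓ →L[ℝ] Vec ℓ :=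
  Matrix.toEuclideanCLM (n := Fin ℓ) (𝕜 := ℝ) A

/-- The vector `G v`, where `G` is the matrix whose `j`-th row is `eᵀ D j`. -/
def gradNoise {d ℓ : ℕ} (D : Fin ℓ → Vec d →L[ℝ] Vec ℓ) (e : Vec ℓ) (v : Vec d) : Vec ℓ :=
  WithLp.toLp 2 fun j => inner ℝ e (D j v)

/-- The residual `Q⁻¹ (η - c)`, where `Q` has rows `q`. -/
def recoverNoise {ℓ : ℕ} (c : Vec ℓ) (q : Fin ℓ → Vec ℓ) (η : Vec ℓ) : Vec ℓ :=
  op (rowMat q)⁻¹ (η - c)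

/-- The surrogate at the reference point `z`,
`x ↦ φ (x, c + Dc (x - z) + Q e + G(e) (x - z)) + α / 2 * ‖x - z‖ ^ 2`,
built from values `c`, `q` and derivatives `Dc`, `Dq` at `z`. -/
def surrogate {d ℓ : ℕ} (φ : Vec d → Vec ℓ → ℝ) (c : Vec ℓ) (Dc : Vec d →L[ℝ] Vec ℓ)
    (q : Fin ℓ → Vec ℓ) (Dq : Fin ℓ → Vec d →L[ℝ] Vec ℓ) (α : ℝ) (z : Vec d) (e : Vec ℓ)
    (x : Vec d) : ℝ :=
  φ x (c + Dc (x - z) + op (rowMat q) e + gradNoise Dq e (x - z)) + α / 2 * ‖x - z‖ ^ 2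

/-! ### The stochastic program with decision-dependent uncertainty -/

/-- Data of the program `min_{x ∈ feas} E[φ (x, c x + Q x ε)]`, `ε ∼ noise`; the matrix `Q x` has
the rows `q j x`. -/
structure Problem (d ℓ : ℕ) where
  dom : Set (Vec d)
  feas : Set (Vec d)
  φ : Vec d → Vec ℓ → ℝ
  c : Vec d → Vec ℓ
  q : Fin ℓ → Vec d → Vec ℓ
  noise : Measure (Vec ℓ)
  Lφ : ℝ
  Lc : ℝ
  Lq : ℝ

namespace Problem

variable {d ℓ : ℕ} (P : Problem d ℓ)

/-- The matrix `Q x`. -/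
def Q (x : Vec d) : Matrix (Fin ℓ) (Fin ℓ) ℝ := rowMat fun j => P.q j x

/-- The regression model `ξ(x) = c(x) + Q(x) ε`, as a function of the noise. -/
def response (x : Vec d) (e : Vec ℓ) : Vec ℓ := P.c x + op (P.Q x) e

/-- The objective function. -/
def f (x : Vec d) : ℝ := ∫ e, P.φ x (P.response x e) ∂P.noise

/-- The weak convexity modulus of the objective. -/
def τ : ℝ := P.Lφ * (P.Lc + ℓ * P.Lq)

/-- The Lipschitz modulus of the conceptual surrogates. -/
def L : ℝ :=
  P.Lφ * (1 + sSup ((fun x => ‖fderiv ℝ P.c x‖ +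
    √(ℓ : ℝ) * √(∑ j, ‖fderiv ℝ (P.q j) x‖ ^ 2)) '' P.feas))

/-- `max_{x, y ∈ feas} (f x - f y)`. -/
def Δ₀ : ℝ := sSup ((fun p : Vec d × Vec d => P.f p.1 - P.f p.2) '' (P.feas ×ˢ P.feas))

/-- The standing assumptions on the program. -/
structure Regular : Prop where
  isOpen_dom : IsOpen P.dom
  isCompact_feas : IsCompact P.feas
  convex_feas : Convex ℝ P.feas
  feas_subset : P.feas ⊆ P.dom
  Lφ_nonneg : 0 ≤ P.Lφ
  Lc_nonneg : 0 ≤ P.Lc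
  Lq_nonneg : 0 ≤ P.Lq
  convex_cost : ConvexOn ℝ (P.dom ×ˢ Set.univ) fun p : Vec d × Vec ℓ => P.φ p.1 p.2
  lipschitz_cost : ∀ x ∈ P.dom, ∀ y ∈ P.dom, ∀ ξ η : Vec ℓ,
    |P.φ x ξ - P.φ y η| ≤ P.Lφ * √(‖x - y‖ ^ 2 + ‖ξ - η‖ ^ 2)
  prob_noise : IsProbabilityMeasure P.noise
  memLp_noise : MemLp (fun e : Vec ℓ => e) 2 P.noise
  mean_noise : ∫ e, e ∂P.noise = 0
  cov_noise : ∀ i j : Fin ℓ,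
    covariance (fun e : Vec ℓ => e i) (fun e : Vec ℓ => e j) P.noise = if i = j then 1 else 0
  contDiff_c : ContDiffOn ℝ 1 P.c P.dom
  lipschitz_c : ∀ x ∈ P.dom, ∀ y ∈ P.dom,
    ‖fderiv ℝ P.c x - fderiv ℝ P.c y‖ ≤ P.Lc * ‖x - y‖
  posDef_Q : ∀ x ∈ P.dom, (P.Q x).PosDef
  contDiff_q : ∀ j, ContDiffOn ℝ 1 (P.q j) P.dom
  lipschitz_q : ∀ j, ∀ x ∈ P.dom, ∀ y ∈ P.dom,
    ‖fderiv ℝ (P.q j) x - fderiv ℝ (P.q j) y‖ ≤ P.Lq * ‖x - y‖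

/-- Joint law of a pair `(X, ξ)`, where `X ∼ ν` and, given `X`, `ξ` is distributed as `ξ(X)`. -/
def pairLaw (ν : Measure (Vec d)) : Measure (Vec d × Vec ℓ) :=
  (ν.prod P.noise).map fun p => (p.1, P.response p.1 p.2)

/-- The conceptual mini-batch surrogate at `z`, with the realized noise
`ε_i = Q(Y_i)⁻¹ (η_i - c(Y_i))` recovered from the pairs `W i = (Y_i, η_i)`. -/
def batchSurrogate {m : ℕ} (W : Fin m → Vec d × Vec ℓ) (α : ℝ) (z x : Vec d) : ℝ :=
  (∑ i, surrogate P.φ (P.c z) (fderiv ℝ P.c z) (fun j => P.q j z) (fun j => fderiv ℝ (P.q j) z)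
    α z (recoverNoise (P.c (W i).1) (fun j => P.q j (W i).1) (W i).2) x) / m

end Problem

/-! ### Simulation oracles and estimators -/

/-- A simulation oracle: either a fixed marginal law of the predictor (static), or a marginal law
`M n z` that depends on the sample size `n` and the reference point `z` (adaptive). -/
inductive SimOracle (d : ℕ) where
  | static (ν : Measure (Vec d))
  | adaptive (M : ℕ → Kernel (Vec d) (Vec d))

namespace SimOracle

variable {d : ℕ}

/-- Law of the predictors in the data set used for estimation. -/
def designLaw : SimOracle d → ℕ → Vec d → Measure (Vec d)
  | static ν, _, _ => ν
  | adaptive M, n, z => M n z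

/-- Law of the points at which the data for the residuals are simulated: the same fixed law for the
static oracle, the reference point itself for the adaptive one. -/
def residualLaw : SimOracle d → Vec d → Measure (Vec d)
  | static ν, _ => ν
  | adaptive _, z => Measure.dirac z

/-- The predictor laws are probability laws on `X`. -/
def Valid (X : Set (Vec d)) : SimOracle d → Prop
  | static ν => IsProbabilityMeasure ν ∧ ∀ᵐ x ∂ν, x ∈ X
  | adaptive M => (∀ n, IsMarkovKernel (M n)) ∧ ∀ n, ∀ z ∈ X, ∀ᵐ x ∂(M n z), x ∈ X

end SimOracle

/-- Statistical estimators of `c`, its Jacobian, the rows `q j` and their Jacobians: measurable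
functions of a data set of size `n` and of the point of evaluation. -/
structure Estimators (d ℓ : ℕ) where
  c : (n : ℕ) → (Fin n → Vec d × Vec ℓ) → Vec d → Vec ℓ
  Dc : (n : ℕ) → (Fin n → Vec d × Vec ℓ) → Vec d → (Vec d →L[ℝ] Vec ℓ)
  q : Fin ℓ → (n : ℕ) → (Fin n → Vec d × Vec ℓ) → Vec d → Vec ℓ
  Dq : Fin ℓ → (n : ℕ) → (Fin n → Vec d × Vec ℓ) → Vec d → (Vec d →L[ℝ] Vec ℓ)
  measurable_c : ∀ n, Measurable fun p : (Fin n → Vec d × Vec ℓ) × Vec d => c n p.1 p.2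
  measurable_Dc : ∀ n, Measurable fun p : (Fin n → Vec d × Vec ℓ) × Vec d => Dc n p.1 p.2
  measurable_q : ∀ j n, Measurable fun p : (Fin n → Vec d × Vec ℓ) × Vec d => q j n p.1 p.2
  measurable_Dq : ∀ j n, Measurable fun p : (Fin n → Vec d × Vec ℓ) × Vec d => Dq j n p.1 p.2

namespace Estimators

variable {d ℓ : ℕ} (est : Estimators d ℓ)

/-- The estimator of `Q(z)`. -/
def Q (n : ℕ) (S : Fin n → Vec d × Vec ℓ) (z : Vec d) : Matrix (Fin ℓ) (Fin ℓ) ℝ :=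
  rowMat fun j => est.q j n S z

/-- The learning-based mini-batch surrogate at `z`, with the empirical residuals
`Q̂(Y_i)⁻¹ (η_i - ĉ(Y_i))` of the pairs `W i = (Y_i, η_i)`. -/
def batchSurrogate (φ : Vec d → Vec ℓ → ℝ) {n m : ℕ} (S : Fin n → Vec d × Vec ℓ)
    (W : Fin m → Vec d × Vec ℓ) (α : ℝ) (z x : Vec d) : ℝ :=
  (∑ i, surrogate φ (est.c n S z) (est.Dc n S z) (fun j => est.q j n S z)
    (fun j => est.Dq j n S z) α z
    (recoverNoise (est.c n S (W i).1) (fun j => est.q j n S (W i).1) (W i).2) x) / m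

end Estimators

namespace Problem

variable {d ℓ : ℕ} (P : Problem d ℓ) (O : SimOracle d) (est : Estimators d ℓ)

/-- Law of a data set `S` of size `n` simulated at the reference point `z`. -/
def dataLaw (n : ℕ) (z : Vec d) : Measure (Fin n → Vec d × Vec ℓ) :=
  Measure.pi fun _ => P.pairLaw (O.designLaw n z)

/-- Law of the samples `(S, W)` simulated in one iteration at the reference point `z`. -/
def batchLaw (n m : ℕ) (z : Vec d) :
    Measure ((Fin n → Vec d × Vec ℓ) × (Fin m → Vec d × Vec ℓ)) :=
  (P.dataLaw O n z).prod (Measure.pi fun _ => P.pairLaw (O.residualLaw z))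

/-- The estimators of `Q` are almost surely invertible. -/
def EstInvertible : Prop :=
  ∀ n : ℕ, 0 < n → ∀ z ∈ P.feas, ∀ᵐ S ∂(P.dataLaw O n z), IsUnit (est.Q n S z)

/-- The noise and the estimators of `c` are almost surely bounded. -/
def EssBounded : Prop :=
  ∃ B : ℝ, 0 < B ∧ (∀ᵐ e ∂P.noise, ‖e‖ ≤ B) ∧
    ∀ n : ℕ, 0 < n → ∀ z ∈ P.feas, ∀ᵐ S ∂(P.dataLaw O n z), ‖est.c n S z‖ ≤ B

/-- The mean squared estimation errors are at most `C * n ^ (-r)`, uniformly on the feasible set. -/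
def EstRates (r : ℝ) : Prop :=
  0 < r ∧ r ≤ 1 ∧ ∃ C : ℝ, 0 < C ∧ ∀ n : ℕ, 0 < n → ∀ z ∈ P.feas,
    (∫⁻ S, ‖est.c n S z - P.c z‖ₑ ^ 2 ∂(P.dataLaw O n z) ≤ ENNReal.ofReal (C * (n : ℝ) ^ (-r))) ∧
    (∫⁻ S, ‖est.Dc n S z - fderiv ℝ P.c z‖ₑ ^ 2 ∂(P.dataLaw O n z)
      ≤ ENNReal.ofReal (C * (n : ℝ) ^ (-r))) ∧
    (∫⁻ S, ‖op (est.Q n S z - P.Q z)‖ₑ ^ 2 ∂(P.dataLaw O n z)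
      ≤ ENNReal.ofReal (C * (n : ℝ) ^ (-r))) ∧
    (∀ j, ∫⁻ S, ‖est.Dq j n S z - fderiv ℝ (P.q j) z‖ₑ ^ 2 ∂(P.dataLaw O n z)
      ≤ ENNReal.ofReal (C * (n : ℝ) ^ (-r))) ∧
    (∫⁻ S, ‖op ((est.Q n S z)⁻¹ - (P.Q z)⁻¹)‖ₑ ^ 2 ∂(P.dataLaw O n z)
      ≤ ENNReal.ofReal (C * (n : ℝ) ^ (-r)))

/-- `K` is a constant of the estimation error: for all sample sizes,
`sup_z E[sup_x |F̂ (x; z) - F̃ (x; z)|] ≤ K * n ^ (-r / 2)`, where `F̂` and `F̃` are the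
learning-based and the conceptual mini-batch surrogates of the same samples. -/
def IsEstConst (r K : ℝ) : Prop :=
  0 < K ∧ ∀ n m : ℕ, 0 < n → 0 < m → ∀ α : ℝ, 0 < α → ∀ z ∈ P.feas,
    ∫⁻ b, ⨆ x ∈ P.feas,
        ENNReal.ofReal |est.batchSurrogate P.φ b.1 b.2 α z x - P.batchSurrogate b.2 α z x|
      ∂(P.batchLaw O n m z) ≤ ENNReal.ofReal (K * (n : ℝ) ^ (-r / 2))

/-- `z 0, …, z (T + 1)` are the iterates of the ALS algorithm started at `z0`, with sample sizes
`n t`, `m t`, proximal parameters `α t` and simulated data sets `S t`, `W t`, for the iterations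
`t = 0, …, T`. The `σ`-algebra `ℱ t` contains the information of the samples before iteration `t`;
given `ℱ t`, the samples of iteration `t` have the law prescribed by the oracle at `z t`. -/
structure IsALSRun {Ω : Type*} [mΩ : MeasurableSpace Ω] (μ : Measure Ω) (ℱ : Filtration ℕ mΩ)
    (z0 : Vec d) (T : ℕ) (n m : ℕ → ℕ) (α : ℕ → ℝ)
    (S : (t : ℕ) → Ω → Fin (n t) → Vec d × Vec ℓ) (W : (t : ℕ) → Ω → Fin (m t) → Vec d × Vec ℓ)
    (z : ℕ → Ω → Vec d) : Prop where
  measurable_S : ∀ t ≤ T, Measurable[ℱ (t + 1)] (S t)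
  measurable_W : ∀ t ≤ T, Measurable[ℱ (t + 1)] (W t)
  measurable_z : ∀ t ≤ T + 1, Measurable[ℱ t] (z t)
  law : ∀ t ≤ T, ∀ A : Set Ω, MeasurableSet[ℱ t] A →
    ∀ D : Set ((Fin (n t) → Vec d × Vec ℓ) × (Fin (m t) → Vec d × Vec ℓ)), MeasurableSet D →
      μ (A ∩ (fun ω => (S t ω, W t ω)) ⁻¹' D)
        = ∫⁻ ω in A, P.batchLaw O (n t) (m t) (z t ω) D ∂μ
  init : ∀ ω, z 0 ω = z0
  step : ∀ t ≤ T, ∀ ω, z (t + 1) ω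
    = argminOn P.feas fun x => est.batchSurrogate P.φ (S t ω) (W t ω) (α t) (z t ω) x

/-- The Polyak weight `P_t`. -/
def weight (ρ α : ℕ → ℝ) (t : ℕ) : ℝ :=
  ρ (t + 1) * (ρ t - P.τ) / α t - (ρ (t + 1) - ρ t)

/-- The Polyak probabilities: `p_t ∝ P_t` for `tbar ≤ t ≤ T`, and `p_t = 0` otherwise. -/
def polyakProb (ρ α : ℕ → ℝ) (tbar T t : ℕ) : ℝ :=
  if tbar ≤ t ∧ t ≤ T then P.weight ρ α t / ∑ s ∈ Finset.Icc tbar T, P.weight ρ α s else 0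

/-- The error budget `Δ(T)`. -/
def budget (r K : ℝ) (ρ α : ℕ → ℝ) (n m : ℕ → ℕ) (tbar T : ℕ) : ℝ :=
  2 * P.Δ₀ + ∑ t ∈ Finset.Icc tbar T, 4 * ρ (t + 1) * P.L ^ 2 / (m t * α t ^ 2)
    + ∑ t ∈ Finset.Icc tbar T, 4 * ρ (t + 1) * K / ((n t : ℝ) ^ (r / 2) * α t)

end Problem

end ALS

end

/-! The proof is a descent argument for the Moreau envelope `e_ρ(z) = min_y f(y) + ρ/2 ‖y - z‖²`,
and its engine is an estimate of the distance from the new iterate to the old proximal point.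

*Weak convexity.* For fixed noise, the linearized response is affine in `x`, so joint convexity of
`φ` makes the linearized cost convex. Taylor's formula together with `E‖ε‖ ≤ √ℓ` shows that its mean
over the noise, the model at `z`, differs from `f` by at most `τ/2 ‖x - z‖²`
(`Regular.abs_f_sub_meanCost_le`). Hence `f + τ/2 ‖· - w‖²` is convex, and for `ρ > τ` the proximal
point is unique and depends measurably on `z`.

*One iteration.* Let `y` be the proximal point of `z` and `z'` the next iterate. Quadratic growth of
`F̂` at its minimizer gives `α/2 ‖y - z'‖² ≤ F̂(y) - F̂(z') ≤ 2 sup |F̂ - F̃| + F̃(y) - min F̃`. The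
first term is controlled in expectation by the estimation constant. For the second, `E F̃(y)` is the
regularized model at `y`. Replacing one of the `m` samples moves the minimizer of `F̃` by
`O(1/(mα))`, so `E min F̃` is at most `2L²/(mα)` below the minimum of the regularized model
(`Regular.le_integral_regAvg_regArgmin`), and that minimum is at least `e_ρ(z)` because `α - τ ≥ ρ`.
Together (`Regular.integral_step_le`): `α/2 E‖y - z'‖² ≤ 2K n^(-r/2) + 2L²/(mα) + (τ + α - ρ)/2 E‖y
- z‖²`.

*Descent.* Using `y` as a competitor in the envelope at `z'` and multiplying by `2ρ_{t+1}/α_t`, the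
weight `P_t` appears as the coefficient of `E‖y - z‖²` (`IsALSRun.envelope_decrease`). The sum
telescopes, and the envelopes differ by at most `Δ₀`. The law of `t*` is proportional to `P_t` and
independent of the iterates, which turns the weighted sum into the expectation.

*Estimation error.* Every error term is bounded by `s + s⁻¹ · (squared errors)` with `s = n^(-r/2)`;
mean squared errors of order `n^(-r)` then give order `s` (`Regular.exists_isEstConst`). -/

noncomputable section

namespace ALS

/-! ### Minimizers of strongly convex functions on compact sets -/

/-- Quadratic growth of `g + a / 2 * ‖· - z‖ ^ 2` at a minimizer, for convex `g`. -/
lemma quadratic_growth {E : Type*} [NormedAddCommGroup E] [InnerProductSpace ℝ E] {X : Set E}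
    {g : E → ℝ} {a : ℝ} {z x y : E} (hg : ConvexOn ℝ X g) (hx : x ∈ X) (hy : y ∈ X)
    (hmin : IsMinOn (fun u => g u + a / 2 * ‖u - z‖ ^ 2) X x) :
    g x + a / 2 * ‖x - z‖ ^ 2 + a / 2 * ‖y - x‖ ^ 2 ≤ g y + a / 2 * ‖y - z‖ ^ 2 := by
  -- Compare `x` with `(1 - s) • x + s • y`, divide by `s`, and let `s → 0` below. The identity for
  -- the quadratic term is exact, so the sign of `a` plays no role.
  have key : ∀ s ∈ Set.Ioo (0 : ℝ) 1,
      a / 2 * (1 - s) * ‖y - x‖ ^ 2 ≤ (g y + a / 2 * ‖y - z‖ ^ 2) - (g x + a / 2 * ‖x - z‖ ^ 2) := by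
    intro s hs
    have h1 := hg.2 hx hy (by linarith [hs.2] : 0 ≤ 1 - s) hs.1.le (by ring)
    have hmem := hg.1 hx hy (by linarith [hs.2] : 0 ≤ 1 - s) hs.1.le (by ring)
    have h2 := hmin hmem
    simp only [Set.mem_ofPred_eq, smul_eq_mul] at h1 h2
    have h3 : ‖(1 - s) • x + s • y - z‖ ^ 2
        = (1 - s) * ‖x - z‖ ^ 2 + s * ‖y - z‖ ^ 2 - s * (1 - s) * ‖y - x‖ ^ 2 := by
      have e1 : (1 - s) • x + s • y - z = (1 - s) • (x - z) + s • (y - z) := by module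
      have e2 : y - x = (y - z) - (x - z) := by abel
      rw [e1, e2, norm_add_sq_real, norm_sub_sq_real (y - z), norm_smul, norm_smul, inner_smul_left,
        inner_smul_right, mul_pow, mul_pow, Real.norm_eq_abs, Real.norm_eq_abs, sq_abs, sq_abs,
        real_inner_comm]
      simp only [conj_trivial]
      ring
    rw [h3] at h2
    have h4 : s * (a / 2 * (1 - s) * ‖y - x‖ ^ 2)
        ≤ s * ((g y + a / 2 * ‖y - z‖ ^ 2) - (g x + a / 2 * ‖x - z‖ ^ 2)) := by nlinarith
    exact le_of_mul_le_mul_left h4 hs.1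
  have hlim : Filter.Tendsto (fun s : ℝ => a / 2 * (1 - s) * ‖y - x‖ ^ 2)
      (nhdsWithin 0 (Set.Ioi 0)) (nhds (a / 2 * (1 - 0) * ‖y - x‖ ^ 2)) := by
    apply Filter.Tendsto.mono_left _ nhdsWithin_le_nhds
    apply Continuous.tendsto
    fun_prop
  have h5 := le_of_tendsto hlim (Filter.eventually_of_mem
    (Ioo_mem_nhdsGT (show (0 : ℝ) < 1 by norm_num)) key)
  linarith

/-- If `g + τ / 2 * ‖· - z‖ ^ 2` is dominated from below, with equality at `z`, by a function that
is convex on `X`, for every `z ∈ X`, then `g + τ / 2 * ‖· - w‖ ^ 2` is convex on `X`. -/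
lemma convexOn_of_convex_minorants {E : Type*} [NormedAddCommGroup E] [InnerProductSpace ℝ E]
    {X : Set E} (hX : Convex ℝ X) {g : E → ℝ} {τ : ℝ} {m : E → E → ℝ}
    (hm : ∀ z ∈ X, ConvexOn ℝ X (m z)) (hmz : ∀ z ∈ X, m z z = g z)
    (hle : ∀ z ∈ X, ∀ x ∈ X, m z x ≤ g x + τ / 2 * ‖x - z‖ ^ 2) (w : E) :
    ConvexOn ℝ X fun x => g x + τ / 2 * ‖x - w‖ ^ 2 := by
  refine ⟨hX, fun x hx y hy a b ha hb hab => ?_⟩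
  have hz := hX hx hy ha hb hab
  -- The minorant is taken at the convex combination itself, where it touches `g`.
  set z := a • x + b • y with hzdef
  have h1 := (hm z hz).2 hx hy ha hb hab
  rw [← hzdef, hmz z hz] at h1
  have h2 := mul_le_mul_of_nonneg_left (hle z hz x hx) ha
  have h3 := mul_le_mul_of_nonneg_left (hle z hz y hy) hb
  simp only [smul_eq_mul] at h1 ⊢
  -- Variance decomposition: `z` is the barycenter of `x` and `y`, so the quadratic excess over the
  -- minorant is exactly the convexity defect of `‖· - w‖ ^ 2`.
  have h4 : a * ‖x - z‖ ^ 2 + b * ‖y - z‖ ^ 2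
      = a * ‖x - w‖ ^ 2 + b * ‖y - w‖ ^ 2 - ‖z - w‖ ^ 2 := by
    have e0 : z - w = a • (x - w) + b • (y - w) := by
      rw [hzdef, smul_sub, smul_sub]
      have : w = a • w + b • w := by rw [← add_smul, hab, one_smul]
      nth_rw 1 [this]
      abel
    have e1 : x - z = (x - w) - (z - w) := by abel
    have e2 : y - z = (y - w) - (z - w) := by abel
    have e3 : inner ℝ (x - w) (z - w) * a + inner ℝ (y - w) (z - w) * b = ‖z - w‖ ^ 2 := by
      rw [← real_inner_self_eq_norm_sq]
      conv_rhs => rw [e0, inner_add_left, inner_smul_left, inner_smul_left, ← e0]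
      simp only [conj_trivial]
      ring
    rw [e1, e2, norm_sub_sq_real (x - w), norm_sub_sq_real (y - w)]
    linear_combination (-2) * e3 + (‖z - w‖ ^ 2) * hab
  linear_combination h1 + h2 + h3 + τ / 2 * h4

/-- Minimizers, if unique, depend measurably on parameters. -/
lemma measurable_argmin {Ω E : Type*} [MeasurableSpace Ω] [PseudoMetricSpace E]
    [SecondCountableTopology E] [MeasurableSpace E] [BorelSpace E] {X : Set E} (hX : IsCompact X)
    {g : Ω → E → ℝ} (hg : ∀ x ∈ X, Measurable fun ω => g ω x) (hc : ∀ ω, ContinuousOn (g ω) X)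
    {x : Ω → E} (hx : ∀ ω, x ω ∈ X) (hmin : ∀ ω, IsMinOn (g ω) X (x ω))
    (huniq : ∀ ω, ∀ y ∈ X, IsMinOn (g ω) X y → y = x ω) : Measurable x := by
  refine measurable_of_isClosed fun C hC => ?_
  by_cases hne : (X ∩ C).Nonempty
  swap
  · convert MeasurableSet.empty
    ext ω
    simp only [Set.mem_preimage, Set.mem_empty_iff_false, iff_false]
    exact fun h => hne ⟨x ω, hx ω, h⟩
  have : Nonempty (X ∩ C : Set E) := hne.to_subtype
  have : Nonempty X := (hne.mono Set.inter_subset_left).to_subtype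
  let d := TopologicalSpace.denseSeq (X ∩ C : Set E)
  let e := TopologicalSpace.denseSeq X
  -- By uniqueness the minimizer lies in `C` iff the minimum over `X ∩ C` equals the minimum over
  -- `X`. Along dense sequences this is a countable condition on values of `g`; compactness of `X ∩
  -- C` provides the point attaining the minimum in the converse direction.
  have hset : x ⁻¹' C = ⋂ k : ℕ, ⋃ i : ℕ, ⋂ j : ℕ,
      {ω | g ω (d i) ≤ g ω (e j) + 1 / ((k : ℝ) + 1)} := by
    ext ω
    simp only [Set.mem_preimage, Set.mem_iInter, Set.mem_iUnion, Set.mem_ofPred_eq]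
    constructor
    · intro h k
      have hcont : Continuous fun y : (X ∩ C : Set E) => g ω y :=
        ((hc ω).mono Set.inter_subset_left).domRestrict
      have hopen : IsOpen {y : (X ∩ C : Set E) | g ω y < g ω (x ω) + 1 / ((k : ℝ) + 1)} :=
        isOpen_lt hcont continuous_const
      obtain ⟨i, hi⟩ := (TopologicalSpace.denseRange_denseSeq (X ∩ C : Set E)).exists_mem_open hopen
        ⟨⟨x ω, hx ω, h⟩, by
          simp only [Set.mem_ofPred_eq]
          have : 0 < 1 / ((k : ℝ) + 1) := by positivity
          linarith⟩
      refine ⟨i, fun j => ?_⟩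
      have h1 : g ω (x ω) ≤ g ω (e j) := hmin ω (e j).2
      have h2 : g ω (d i) < g ω (x ω) + 1 / ((k : ℝ) + 1) := hi
      linarith
    · intro h
      obtain ⟨y, hy, hymin⟩ := (hX.inter_right hC).exists_isMinOn hne
        ((hc ω).mono Set.inter_subset_left)
      have hle : ∀ j, g ω y ≤ g ω (e j) := by
        intro j
        refine le_of_forall_pos_le_add fun δ hδ => ?_
        obtain ⟨k, hk⟩ := exists_nat_one_div_lt hδ
        obtain ⟨i, hi⟩ := h k
        have h1 : g ω y ≤ g ω (d i) := hymin (d i).2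
        linarith [hi j]
      have hle' : ∀ u : X, g ω y ≤ g ω u := by
        have hcont : Continuous fun u : X => g ω u := (hc ω).domRestrict
        have hcl : IsClosed {u : X | g ω y ≤ g ω u} := isClosed_le continuous_const hcont
        have hd := (TopologicalSpace.denseRange_denseSeq X).closure_range
        intro u
        have hu : u ∈ closure (Set.range e) := by
          rw [hd]
          trivial
        exact closure_minimal (by rintro _ ⟨j, rfl⟩; exact hle j) hcl hu
      have := huniq ω y hy.1 fun u hu => hle' ⟨u, hu⟩
      exact this ▸ hy.2
  rw [hset]
  exact MeasurableSet.iInter fun k => MeasurableSet.iUnion fun i => MeasurableSet.iInter fun j =>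
    measurableSet_le (hg _ (d i).2.1) ((hg _ (e j).2).add_const _)

lemma argminOn_spec {k : ℕ} {X : Set (Vec k)} (hX : IsCompact X) (hne : X.Nonempty)
    {g : Vec k → ℝ} (hg : ContinuousOn g X) :
    argminOn X g ∈ X ∧ IsMinOn g X (argminOn X g) :=
  Classical.epsilon_spec (p := fun y => y ∈ X ∧ IsMinOn g X y) (hX.exists_isMinOn hne hg)

/-- The supremum of a family of continuous functions over a set is attained along a dense sequence:
there is a countable family of points of `X` whose values control all values. -/
lemma le_iSup_denseSeq {E : Type*} [PseudoMetricSpace E] [SecondCountableTopology E] {X : Set E}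
    [Nonempty X] {h : E → ℝ} (hh : ContinuousOn h X) {x : E} (hx : x ∈ X) :
    ENNReal.ofReal (h x) ≤ ⨆ i : ℕ, ENNReal.ofReal (h (TopologicalSpace.denseSeq X i)) := by
  have hcont : Continuous fun u : X => ENNReal.ofReal (h u) :=
    ENNReal.continuous_ofReal.comp hh.domRestrict
  have hcl : IsClosed {u : X | ENNReal.ofReal (h u)
      ≤ ⨆ i : ℕ, ENNReal.ofReal (h (TopologicalSpace.denseSeq X i))} :=
    isClosed_le hcont continuous_const
  have hu : (⟨x, hx⟩ : X) ∈ closure (Set.range (TopologicalSpace.denseSeq X)) := by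
    rw [(TopologicalSpace.denseRange_denseSeq X).closure_range]
    trivial
  exact closure_minimal (by
    rintro _ ⟨j, rfl⟩
    exact le_iSup (fun i : ℕ => ENNReal.ofReal (h (TopologicalSpace.denseSeq X i))) j) hcl hu

/-! ### First order Taylor expansion -/

/-- Along the segment the remainder has derivative of norm at most `K * ‖x - z‖ ^ 2 * t`, whose
primitive supplies the factor `1 / 2`. -/
lemma norm_taylor_le {E F : Type*} [NormedAddCommGroup E] [NormedSpace ℝ E]
    [NormedAddCommGroup F] [NormedSpace ℝ F] {U : Set E} (hU : IsOpen U) (hUc : Convex ℝ U)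
    {g : E → F} (hg : ContDiffOn ℝ 1 g U) {K : ℝ}
    (hK : ∀ x ∈ U, ∀ y ∈ U, ‖fderiv ℝ g x - fderiv ℝ g y‖ ≤ K * ‖x - y‖) {x z : E} (hx : x ∈ U)
    (hz : z ∈ U) : ‖g x - g z - fderiv ℝ g z (x - z)‖ ≤ K / 2 * ‖x - z‖ ^ 2 := by
  have hmem : ∀ t ∈ Set.Icc (0 : ℝ) 1, z + t • (x - z) ∈ U := fun t ht =>
    hUc.add_smul_sub_mem hz hx ht
  have hder : ∀ t ∈ Set.Icc (0 : ℝ) 1,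
      HasDerivAt (fun t : ℝ => g (z + t • (x - z)) - g z - t • fderiv ℝ g z (x - z))
        ((fderiv ℝ g (z + t • (x - z)) - fderiv ℝ g z) (x - z)) t := by
    intro t ht
    have h1 : HasFDerivAt g (fderiv ℝ g (z + t • (x - z))) (z + t • (x - z)) :=
      ((hg.differentiableOn (by norm_num)).differentiableAt (hU.mem_nhds (hmem t ht))).hasFDerivAt
    have h2 : HasDerivAt (fun t : ℝ => z + t • (x - z)) (x - z) t := by
      simpa using ((hasDerivAt_id t).smul_const (x - z)).const_add z
    have h3 := h1.comp_hasDerivAt t h2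
    have h4 : HasDerivAt (fun t : ℝ => t • fderiv ℝ g z (x - z)) (fderiv ℝ g z (x - z)) t := by
      simpa using (hasDerivAt_id t).smul_const (fderiv ℝ g z (x - z))
    exact (h3.sub_const (g z)).fun_sub h4
  have hB : ∀ t : ℝ, HasDerivAt (fun t : ℝ => K / 2 * ‖x - z‖ ^ 2 * t ^ 2)
      (K * ‖x - z‖ ^ 2 * t) t := by
    intro t
    have := ((hasDerivAt_pow 2 t).const_mul (K / 2 * ‖x - z‖ ^ 2))
    refine this.congr_deriv ?_
    push_cast
    ring
  have := image_norm_le_of_norm_deriv_right_le_deriv_boundary (a := 0) (b := 1)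
    (f := fun t : ℝ => g (z + t • (x - z)) - g z - t • fderiv ℝ g z (x - z))
    (fun t ht => (hder t ht).continuousAt.continuousWithinAt)
    (fun t ht => (hder t (Set.Ico_subset_Icc_self ht)).hasDerivWithinAt)
    (B := fun t => K / 2 * ‖x - z‖ ^ 2 * t ^ 2) (by simp) hB
    (by
      intro t ht
      have ht' := Set.Ico_subset_Icc_self ht
      refine (ContinuousLinearMap.le_opNorm _ _).trans ?_
      have h1 := hK _ (hmem t ht') _ hz
      rw [add_sub_cancel_left, norm_smul, Real.norm_of_nonneg ht.1] at h1
      calc _ ≤ K * (t * ‖x - z‖) * ‖x - z‖ := by gcongr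
        _ = _ := by ring)
    (Set.right_mem_Icc.2 zero_le_one)
  simpa using this

variable {d ℓ : ℕ}

/-! ### Matrices as operators -/

lemma op_apply (A : Matrix (Fin ℓ) (Fin ℓ) ℝ) (e : Vec ℓ) (j : Fin ℓ) :
    op A e j = ∑ k, A j k * e k := by
  simp [op, Matrix.mulVec, dotProduct, Matrix.ofLp_toEuclideanCLM]

lemma op_rowMat_apply (q : Fin ℓ → Vec ℓ) (e : Vec ℓ) (j : Fin ℓ) :
    op (rowMat q) e j = inner ℝ e (q j) := by
  rw [op_apply, PiLp.inner_apply]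
  simp [rowMat]

lemma op_sub (A B : Matrix (Fin ℓ) (Fin ℓ) ℝ) : op (A - B) = op A - op B := by
  simp [op]

lemma op_mul_apply (A B : Matrix (Fin ℓ) (Fin ℓ) ℝ) (e : Vec ℓ) : op (A * B) e = op A (op B e) := by
  simp [op]

lemma op_one_apply (e : Vec ℓ) : op (1 : Matrix (Fin ℓ) (Fin ℓ) ℝ) e = e := by
  simp [op]

lemma continuous_op : Continuous (op : Matrix (Fin ℓ) (Fin ℓ) ℝ → Vec ℓ →L[ℝ] Vec ℓ) := by
  let f : Matrix (Fin ℓ) (Fin ℓ) ℝ →ₗ[ℝ] (Vec ℓ →L[ℝ] Vec ℓ) :=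
    { toFun := op
      map_add' := fun A B => by simp [op]
      map_smul' := fun a A => by simp [op] }
  exact f.continuous_of_finiteDimensional

/-- Passage from coordinatewise to Euclidean bounds. The choice `b = 1` is the source of the factor
`√ℓ`; `b j = ‖D j‖` is used for the noise Jacobians. -/
lemma norm_toLp_le {w : Fin ℓ → ℝ} {b : Fin ℓ → ℝ} {R : ℝ} (hR : 0 ≤ R)
    (h : ∀ j, |w j| ≤ R * b j) :
    ‖(WithLp.toLp 2 w : Vec ℓ)‖ ≤ R * √(∑ j, b j ^ 2) := by
  rw [EuclideanSpace.norm_eq]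
  apply Real.sqrt_le_iff.2
  refine ⟨by positivity, ?_⟩
  rw [mul_pow, Real.sq_sqrt (Finset.sum_nonneg fun j _ => sq_nonneg _), Finset.mul_sum]
  refine Finset.sum_le_sum fun j _ => ?_
  rw [← mul_pow]
  exact pow_le_pow_left₀ (abs_nonneg _) (h j) 2

lemma norm_gradNoise_le (D : Fin ℓ → Vec d →L[ℝ] Vec ℓ) (e : Vec ℓ) (v : Vec d) :
    ‖gradNoise D e v‖ ≤ ‖e‖ * ‖v‖ * √(∑ j, ‖D j‖ ^ 2) := by
  refine norm_toLp_le (by positivity) fun j => ?_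
  calc |inner ℝ e (D j v)| ≤ ‖e‖ * ‖D j v‖ := abs_real_inner_le_norm _ _
    _ ≤ ‖e‖ * (‖D j‖ * ‖v‖) := by gcongr; exact (D j).le_opNorm v
    _ = _ := by ring

lemma gradNoise_sub_right (D : Fin ℓ → Vec d →L[ℝ] Vec ℓ) (e : Vec ℓ) (v w : Vec d) :
    gradNoise D e (v - w) = gradNoise D e v - gradNoise D e w := by
  ext j
  simp [gradNoise, inner_sub_right]

lemma gradNoise_add_right (D : Fin ℓ → Vec d →L[ℝ] Vec ℓ) (e : Vec ℓ) (v w : Vec d) :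
    gradNoise D e (v + w) = gradNoise D e v + gradNoise D e w := by
  ext j
  simp [gradNoise, inner_add_right]

lemma gradNoise_smul_right (D : Fin ℓ → Vec d →L[ℝ] Vec ℓ) (e : Vec ℓ) (a : ℝ) (v : Vec d) :
    gradNoise D e (a • v) = a • gradNoise D e v := by
  ext j
  simp [gradNoise, inner_smul_right]

lemma gradNoise_zero_right (D : Fin ℓ → Vec d →L[ℝ] Vec ℓ) (e : Vec ℓ) :
    gradNoise D e 0 = 0 := by
  ext j
  simp [gradNoise]

lemma gradNoise_sub_mid (D : Fin ℓ → Vec d →L[ℝ] Vec ℓ) (e e' : Vec ℓ) (v : Vec d) :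
    gradNoise D (e - e') v = gradNoise D e v - gradNoise D e' v := by
  ext j
  simp [gradNoise, inner_sub_left]

lemma gradNoise_sub_left (D D' : Fin ℓ → Vec d →L[ℝ] Vec ℓ) (e : Vec ℓ) (v : Vec d) :
    gradNoise (fun j => D j - D' j) e v = gradNoise D e v - gradNoise D' e v := by
  ext j
  simp [gradNoise, inner_sub_right]

/-! ### The linearized response -/

/-- The argument `c + Dc (x - z) + Q e + G(e) (x - z)` of the cost in the surrogate. -/
def linResp (c : Vec ℓ) (Dc : Vec d →L[ℝ] Vec ℓ) (q : Fin ℓ → Vec ℓ)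
    (Dq : Fin ℓ → Vec d →L[ℝ] Vec ℓ) (z : Vec d) (e : Vec ℓ) (x : Vec d) : Vec ℓ :=
  c + Dc (x - z) + op (rowMat q) e + gradNoise Dq e (x - z)

/-- The linearized response is affine in `x`; this is what lets joint convexity of the cost pass to
the surrogates. -/
lemma linResp_comb (c : Vec ℓ) (Dc : Vec d →L[ℝ] Vec ℓ) (q : Fin ℓ → Vec ℓ)
    (Dq : Fin ℓ → Vec d →L[ℝ] Vec ℓ) (z : Vec d) (e : Vec ℓ) (x y : Vec d) {a b : ℝ}
    (hab : a + b = 1) :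
    linResp c Dc q Dq z e (a • x + b • y)
      = a • linResp c Dc q Dq z e x + b • linResp c Dc q Dq z e y := by
  obtain rfl : b = 1 - a := by linarith
  have h : a • x + (1 - a) • y - z = a • (x - z) + (1 - a) • (y - z) := by module
  simp only [linResp]
  rw [h, map_add, map_smul, map_smul, gradNoise_add_right, gradNoise_smul_right,
    gradNoise_smul_right]
  module

lemma norm_linResp_sub_le (c : Vec ℓ) (Dc : Vec d →L[ℝ] Vec ℓ) (q : Fin ℓ → Vec ℓ)
    (Dq : Fin ℓ → Vec d →L[ℝ] Vec ℓ) (z : Vec d) (e : Vec ℓ) (x y : Vec d) :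
    ‖linResp c Dc q Dq z e x - linResp c Dc q Dq z e y‖
      ≤ (‖Dc‖ + √(∑ j, ‖Dq j‖ ^ 2) * ‖e‖) * ‖x - y‖ := by
  have h : linResp c Dc q Dq z e x - linResp c Dc q Dq z e y
      = Dc (x - y) + gradNoise Dq e (x - y) := by
    have h1 : x - y = (x - z) - (y - z) := by abel
    rw [h1, map_sub, gradNoise_sub_right]
    simp only [linResp]
    abel
  rw [h]
  calc _ ≤ ‖Dc (x - y)‖ + ‖gradNoise Dq e (x - y)‖ := norm_add_le _ _
    _ ≤ ‖Dc‖ * ‖x - y‖ + ‖e‖ * ‖x - y‖ * √(∑ j, ‖Dq j‖ ^ 2) :=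
      add_le_add (Dc.le_opNorm _) (norm_gradNoise_le _ _ _)
    _ = _ := by ring

lemma continuous_rowMat : Continuous (rowMat : (Fin ℓ → Vec ℓ) → Matrix (Fin ℓ) (Fin ℓ) ℝ) := by
  refine continuous_matrix fun i j => ?_
  simp only [rowMat, Matrix.of_apply]
  fun_prop

lemma continuous_linResp (c : Vec ℓ) (Dc : Vec d →L[ℝ] Vec ℓ) (q : Fin ℓ → Vec ℓ)
    (Dq : Fin ℓ → Vec d →L[ℝ] Vec ℓ) (z x : Vec d) :
    Continuous fun e => linResp c Dc q Dq z e x := by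
  have h : Continuous fun e => gradNoise Dq e (x - z) :=
    (PiLp.continuous_toLp 2 _).comp (continuous_pi fun j => by fun_prop)
  unfold linResp
  fun_prop

lemma measurable_clm_apply {A E F : Type*} [MeasurableSpace A] [NormedAddCommGroup E]
    [NormedSpace ℝ E] [FiniteDimensional ℝ E] [MeasurableSpace E] [BorelSpace E]
    [NormedAddCommGroup F] [NormedSpace ℝ F] [FiniteDimensional ℝ F] [MeasurableSpace F]
    [BorelSpace F] {D : A → E →L[ℝ] F} {v : A → E} (hD : Measurable D) (hv : Measurable v) :
    Measurable fun a => D a (v a) := by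
  have := FiniteDimensional.proper ℝ E
  have := FiniteDimensional.proper ℝ F
  exact (isBoundedBilinearMap_apply (𝕜 := ℝ)).continuous.measurable.comp (hD.prodMk hv)

lemma measurable_linResp {A : Type*} [MeasurableSpace A] {x : Vec d} {c : A → Vec ℓ}
    {Dc : A → Vec d →L[ℝ] Vec ℓ} {q : Fin ℓ → A → Vec ℓ} {Dq : Fin ℓ → A → Vec d →L[ℝ] Vec ℓ}
    {z : A → Vec d} {e : A → Vec ℓ} (hc : Measurable c) (hDc : Measurable Dc)
    (hq : ∀ j, Measurable (q j)) (hDq : ∀ j, Measurable (Dq j)) (hz : Measurable z)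
    (he : Measurable e) :
    Measurable fun a =>
      linResp (c a) (Dc a) (fun j => q j a) (fun j => Dq j a) (z a) (e a) x := by
  have hv : Measurable fun a => x - z a := hz.const_sub x
  have h1 : Measurable fun a => op (rowMat fun j => q j a) (e a) := by
    have h : (fun a => op (rowMat fun j => q j a) (e a))
        = fun a => WithLp.toLp 2 fun j => inner ℝ (e a) (q j a) := by
      ext a j
      exact op_rowMat_apply _ _ _
    rw [h]
    exact (PiLp.continuous_toLp 2 _).measurable.comp
      (measurable_pi_lambda _ fun j => he.inner (hq j))
  have h2 : Measurable fun a => gradNoise (fun j => Dq j a) (e a) (x - z a) :=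
    (PiLp.continuous_toLp 2 _).measurable.comp
      (measurable_pi_lambda _ fun j => he.inner (measurable_clm_apply (hDq j) hv))
  exact ((hc.add (measurable_clm_apply hDc hv)).add h1).add h2

namespace Problem

variable {P : Problem d ℓ}

/-! ### The cost function -/

/-- Convexity of `P.dom` is contained in `convex_cost`, whose domain is `P.dom ×ˢ Set.univ`. -/
lemma Regular.convex_dom (hP : P.Regular) : Convex ℝ P.dom := by
  have h := hP.convex_cost.1
  intro x hx y hy a b ha hb hab
  have := h (x := (x, 0)) ⟨hx, trivial⟩ (y := (y, 0)) ⟨hy, trivial⟩ ha hb hab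
  exact this.1

lemma Regular.cost_sub_le (hP : P.Regular) {x y : Vec d} (hx : x ∈ P.dom) (hy : y ∈ P.dom)
    (ξ η : Vec ℓ) : |P.φ x ξ - P.φ y η| ≤ P.Lφ * (‖x - y‖ + ‖ξ - η‖) := by
  refine (hP.lipschitz_cost x hx y hy ξ η).trans
    (mul_le_mul_of_nonneg_left ?_ hP.Lφ_nonneg)
  exact Real.sqrt_le_iff.2 ⟨by positivity, by nlinarith [norm_nonneg (x - y), norm_nonneg (ξ - η)]⟩

lemma Regular.cost_sub_le_right (hP : P.Regular) {x : Vec d} (hx : x ∈ P.dom) (ξ η : Vec ℓ) :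
    |P.φ x ξ - P.φ x η| ≤ P.Lφ * ‖ξ - η‖ := by
  simpa using hP.cost_sub_le hx hx ξ η

lemma Regular.continuous_cost_right (hP : P.Regular) {x : Vec d} (hx : x ∈ P.dom) :
    Continuous (P.φ x) := by
  refine (LipschitzWith.of_dist_le_mul (K := ⟨P.Lφ, hP.Lφ_nonneg⟩) fun ξ η => ?_).continuous
  rw [Real.dist_eq, dist_eq_norm]
  exact hP.cost_sub_le_right hx ξ η

lemma Regular.convexOn_cost_linResp (hP : P.Regular) (c : Vec ℓ) (Dc : Vec d →L[ℝ] Vec ℓ)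
    (q : Fin ℓ → Vec ℓ) (Dq : Fin ℓ → Vec d →L[ℝ] Vec ℓ) (z : Vec d) (e : Vec ℓ) :
    ConvexOn ℝ P.dom fun x => P.φ x (linResp c Dc q Dq z e x) := by
  refine ⟨hP.convex_dom, fun x hx y hy a b ha hb hab => ?_⟩
  have := hP.convex_cost.2 (x := (x, linResp c Dc q Dq z e x)) ⟨hx, trivial⟩
    (y := (y, linResp c Dc q Dq z e y)) ⟨hy, trivial⟩ ha hb hab
  simp only [linResp_comb c Dc q Dq z e x y hab]
  exact this

lemma Regular.cost_linResp_sub_le (hP : P.Regular) (c : Vec ℓ) (Dc : Vec d →L[ℝ] Vec ℓ)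
    (q : Fin ℓ → Vec ℓ) (Dq : Fin ℓ → Vec d →L[ℝ] Vec ℓ) (z : Vec d) (e : Vec ℓ) {x y : Vec d}
    (hx : x ∈ P.dom) (hy : y ∈ P.dom) :
    |P.φ x (linResp c Dc q Dq z e x) - P.φ y (linResp c Dc q Dq z e y)|
      ≤ P.Lφ * (1 + ‖Dc‖ + √(∑ j, ‖Dq j‖ ^ 2) * ‖e‖) * ‖x - y‖ := by
  refine (hP.cost_sub_le hx hy _ _).trans ?_
  rw [mul_assoc]
  refine mul_le_mul_of_nonneg_left ?_ hP.Lφ_nonneg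
  linarith [norm_linResp_sub_le c Dc q Dq z e x y]

lemma Regular.continuousOn_cost_linResp (hP : P.Regular) (c : Vec ℓ) (Dc : Vec d →L[ℝ] Vec ℓ)
    (q : Fin ℓ → Vec ℓ) (Dq : Fin ℓ → Vec d →L[ℝ] Vec ℓ) (z : Vec d) (e : Vec ℓ) :
    ContinuousOn (fun x => P.φ x (linResp c Dc q Dq z e x)) P.dom := by
  have h0 := hP.Lφ_nonneg
  have : LipschitzOnWith ⟨P.Lφ * (1 + ‖Dc‖ + √(∑ j, ‖Dq j‖ ^ 2) * ‖e‖), by positivity⟩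
      (fun x => P.φ x (linResp c Dc q Dq z e x)) P.dom := by
    refine LipschitzOnWith.of_dist_le_mul fun x hx y hy => ?_
    rw [Real.dist_eq, dist_eq_norm]
    exact hP.cost_linResp_sub_le c Dc q Dq z e hx hy
  exact this.continuousOn

lemma Regular.continuousOn_c (hP : P.Regular) : ContinuousOn P.c P.dom := hP.contDiff_c.continuousOn

lemma Regular.continuousOn_q (hP : P.Regular) (j : Fin ℓ) : ContinuousOn (P.q j) P.dom :=
  (hP.contDiff_q j).continuousOn

lemma continuousOn_of_norm_sub_le {E F : Type*} [NormedAddCommGroup E] [NormedAddCommGroup F]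
    {U : Set E} {g : E → F} {K : ℝ} (h0 : 0 ≤ K)
    (hK : ∀ x ∈ U, ∀ y ∈ U, ‖g x - g y‖ ≤ K * ‖x - y‖) : ContinuousOn g U := by
  refine (LipschitzOnWith.of_dist_le_mul (K := ⟨K, h0⟩) fun x hx y hy => ?_).continuousOn
  rw [dist_eq_norm, dist_eq_norm]
  exact hK x hx y hy

lemma Regular.continuousOn_fderiv_c (hP : P.Regular) : ContinuousOn (fderiv ℝ P.c) P.dom :=
  continuousOn_of_norm_sub_le hP.Lc_nonneg hP.lipschitz_c

lemma Regular.continuousOn_fderiv_q (hP : P.Regular) (j : Fin ℓ) :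
    ContinuousOn (fderiv ℝ (P.q j)) P.dom :=
  continuousOn_of_norm_sub_le hP.Lq_nonneg (hP.lipschitz_q j)

/-! ### Moments of the noise -/

lemma Regular.integrable_noise (hP : P.Regular) : Integrable (fun e : Vec ℓ => e) P.noise := by
  have := hP.prob_noise
  exact hP.memLp_noise.integrable (by norm_num)

lemma Regular.integrable_norm_noise (hP : P.Regular) : Integrable (fun e : Vec ℓ => ‖e‖) P.noise :=
  hP.integrable_noise.norm

lemma Regular.integrable_sq_noise (hP : P.Regular) :
    Integrable (fun e : Vec ℓ => ‖e‖ ^ 2) P.noise := hP.memLp_noise.integrable_norm_pow (by norm_num)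

/-- The second moment of a centered vector is the trace of its covariance, here the identity. -/
lemma Regular.integral_sq_noise (hP : P.Regular) : ∫ e, ‖e‖ ^ 2 ∂P.noise = ℓ := by
  have := hP.prob_noise
  have hmean : ∀ i : Fin ℓ, ∫ e : Vec ℓ, e i ∂P.noise = 0 := by
    intro i
    have := (EuclideanSpace.proj (𝕜 := ℝ) i).integral_comp_comm hP.integrable_noise
    rw [hP.mean_noise, map_zero] at this
    simpa using this
  have hL : ∀ i : Fin ℓ, MemLp (fun e : Vec ℓ => e i) 2 P.noise := fun i =>
    hP.memLp_noise.continuousLinearMap_comp (EuclideanSpace.proj (𝕜 := ℝ) i)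
  have hone : ∀ i : Fin ℓ, ∫ e : Vec ℓ, e i ^ 2 ∂P.noise = 1 := by
    intro i
    have := hP.cov_noise i i
    simp only [covariance, hmean, sub_zero, if_true] at this
    simpa [sq] using this
  simp_rw [EuclideanSpace.real_norm_sq_eq]
  rw [integral_finsetSum _ fun i _ => (hL i).integrable_sq]
  simp [hone]

/-- Jensen's inequality, in the form of nonnegativity of the variance of `‖e‖`. -/
lemma Regular.integral_norm_noise_le (hP : P.Regular) : ∫ e, ‖e‖ ∂P.noise ≤ √(ℓ : ℝ) := by
  have := hP.prob_noise
  apply Real.le_sqrt_of_sq_le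
  have h1 := variance_nonneg (fun e : Vec ℓ => ‖e‖) P.noise
  rw [variance_eq_sub hP.memLp_noise.norm] at h1
  have h2 := hP.integral_sq_noise
  simp only [Pi.pow_apply] at h1
  linarith

/-! ### Conceptual surrogates -/

variable (P) in
/-- The linearized cost at the reference point `z` for the noise `e`. -/
def linCost (z : Vec d) (e : Vec ℓ) (x : Vec d) : ℝ :=
  P.φ x (linResp (P.c z) (fderiv ℝ P.c z) (fun j => P.q j z) (fun j => fderiv ℝ (P.q j) z) z e x)

variable (P) in
/-- The expected linearized cost at the reference point `z`. -/
def meanCost (z x : Vec d) : ℝ := ∫ e, P.linCost z e x ∂P.noise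

variable (P) in
/-- Lipschitz modulus of the linearized cost at the reference point `z` for the noise `e`. -/
def noiseLip (z : Vec d) (e : Vec ℓ) : ℝ :=
  P.Lφ * (1 + ‖fderiv ℝ P.c z‖ + √(∑ j, ‖fderiv ℝ (P.q j) z‖ ^ 2) * ‖e‖)

lemma Regular.noiseLip_nonneg (hP : P.Regular) (z : Vec d) (e : Vec ℓ) : 0 ≤ P.noiseLip z e := by
  have := hP.Lφ_nonneg
  unfold noiseLip
  positivity

lemma Regular.linCost_sub_le (hP : P.Regular) (z : Vec d) (e : Vec ℓ) {x y : Vec d}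
    (hx : x ∈ P.dom) (hy : y ∈ P.dom) :
    |P.linCost z e x - P.linCost z e y| ≤ P.noiseLip z e * ‖x - y‖ :=
  hP.cost_linResp_sub_le _ _ _ _ z e hx hy

lemma Regular.convexOn_linCost (hP : P.Regular) (z : Vec d) (e : Vec ℓ) :
    ConvexOn ℝ P.dom (P.linCost z e) := hP.convexOn_cost_linResp _ _ _ _ z e

lemma Regular.continuousOn_linCost (hP : P.Regular) (z : Vec d) (e : Vec ℓ) :
    ContinuousOn (P.linCost z e) P.dom := hP.continuousOn_cost_linResp _ _ _ _ z e

lemma Regular.continuous_linCost_noise (hP : P.Regular) (z : Vec d) {x : Vec d} (hx : x ∈ P.dom) :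
    Continuous fun e => P.linCost z e x :=
  (hP.continuous_cost_right hx).comp (continuous_linResp _ _ _ _ z x)

lemma linResp_self (c : Vec ℓ) (Dc : Vec d →L[ℝ] Vec ℓ) (q : Fin ℓ → Vec ℓ)
    (Dq : Fin ℓ → Vec d →L[ℝ] Vec ℓ) (z : Vec d) (e : Vec ℓ) :
    linResp c Dc q Dq z e z = c + op (rowMat q) e := by
  simp [linResp, gradNoise_zero_right]

lemma linCost_self (z : Vec d) (e : Vec ℓ) : P.linCost z e z = P.φ z (P.response z e) := by
  simp [linCost, linResp_self, response, Q]

lemma Regular.integrable_response (hP : P.Regular) {x : Vec d} (hx : x ∈ P.dom) :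
    Integrable (fun e => P.φ x (P.response x e)) P.noise := by
  have := hP.prob_noise
  have h0 := hP.Lφ_nonneg
  have hcont : Continuous fun e => P.φ x (P.response x e) :=
    (hP.continuous_cost_right hx).comp (by unfold response; fun_prop)
  refine Integrable.mono' (g := fun e => |P.φ x (P.c x)| + P.Lφ * ‖op (P.Q x)‖ * ‖e‖)
    ((integrable_const _).add (hP.integrable_norm_noise.const_mul _))
    hcont.aestronglyMeasurable (Filter.Eventually.of_forall fun e => ?_)
  have h1 := hP.cost_sub_le_right hx (P.response x e) (P.c x)
  have h2 : ‖P.response x e - P.c x‖ ≤ ‖op (P.Q x)‖ * ‖e‖ := by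
    simp only [response, add_sub_cancel_left]
    exact ContinuousLinearMap.le_opNorm _ _
  have h3 := mul_le_mul_of_nonneg_left h2 h0
  have h4 := abs_sub_abs_le_abs_sub (P.φ x (P.response x e)) (P.φ x (P.c x))
  rw [Real.norm_eq_abs]
  linarith

lemma Regular.integrable_noiseLip (hP : P.Regular) (z : Vec d) :
    Integrable (P.noiseLip z) P.noise := by
  have := hP.prob_noise
  exact ((integrable_const _).add (hP.integrable_norm_noise.const_mul _)).const_mul _

lemma Regular.abs_linCost_le (hP : P.Regular) {z x : Vec d} (hz : z ∈ P.dom) (hx : x ∈ P.dom)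
    (e : Vec ℓ) :
    |P.linCost z e x| ≤ |P.φ z (P.response z e)| + P.noiseLip z e * ‖x - z‖ := by
  have h1 := hP.linCost_sub_le z e hx hz
  have h2 := abs_sub_abs_le_abs_sub (P.linCost z e x) (P.linCost z e z)
  rw [linCost_self] at h1 h2
  linarith

lemma Regular.integrable_linCost (hP : P.Regular) {z x : Vec d} (hz : z ∈ P.dom) (hx : x ∈ P.dom) :
    Integrable (fun e => P.linCost z e x) P.noise :=
  Integrable.mono' ((hP.integrable_response hz).abs.add ((hP.integrable_noiseLip z).mul_const _))
    (hP.continuous_linCost_noise z hx).aestronglyMeasurable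
    (Filter.Eventually.of_forall fun e => hP.abs_linCost_le hz hx e)

lemma Regular.integrable_sq_noiseLip (hP : P.Regular) (z : Vec d) :
    Integrable (fun e => P.noiseLip z e ^ 2) P.noise := by
  have := hP.prob_noise
  have : (fun e => P.noiseLip z e ^ 2) = fun e =>
      (P.Lφ * (1 + ‖fderiv ℝ P.c z‖)) ^ 2
      + 2 * (P.Lφ * (1 + ‖fderiv ℝ P.c z‖)) * (P.Lφ * √(∑ j, ‖fderiv ℝ (P.q j) z‖ ^ 2)) * ‖e‖
      + (P.Lφ * √(∑ j, ‖fderiv ℝ (P.q j) z‖ ^ 2)) ^ 2 * ‖e‖ ^ 2 := by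
    ext e
    unfold noiseLip
    ring
  rw [this]
  exact ((integrable_const _).add (hP.integrable_norm_noise.const_mul _)).add
    (hP.integrable_sq_noise.const_mul _)

lemma Regular.lip_le_L (hP : P.Regular) {z : Vec d} (hz : z ∈ P.feas) :
    P.Lφ * (1 + (‖fderiv ℝ P.c z‖ + √(ℓ : ℝ) * √(∑ j, ‖fderiv ℝ (P.q j) z‖ ^ 2))) ≤ P.L := by
  refine mul_le_mul_of_nonneg_left (add_le_add le_rfl ?_) hP.Lφ_nonneg
  refine le_csSup ?_ ⟨z, hz, rfl⟩
  apply hP.isCompact_feas.bddAbove_image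
  have h1 := hP.continuousOn_fderiv_c.mono hP.feas_subset
  have h2 := fun j => (hP.continuousOn_fderiv_q j).mono hP.feas_subset
  refine h1.norm.add (continuousOn_const.mul (ContinuousOn.sqrt ?_))
  exact continuousOn_finsetSum _ fun j _ => (h2 j).norm.pow 2

/-- The modulus has the form `a + b * ‖e‖` with `a, b ≥ 0`. Its second moment is at most `(a + b *
√ℓ) ^ 2` by the two moment bounds on the noise, and `a + b * √ℓ` is the quantity maximized in `P.L`.
-/
lemma Regular.integral_sq_noiseLip_le (hP : P.Regular) {z : Vec d} (hz : z ∈ P.feas) :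
    ∫ e, P.noiseLip z e ^ 2 ∂P.noise ≤ P.L ^ 2 := by
  have := hP.prob_noise
  have h0 := hP.Lφ_nonneg
  set a := P.Lφ * (1 + ‖fderiv ℝ P.c z‖) with ha
  set b := P.Lφ * √(∑ j, ‖fderiv ℝ (P.q j) z‖ ^ 2) with hb
  have ha0 : 0 ≤ a := by positivity
  have hb0 : 0 ≤ b := by positivity
  have : (fun e => P.noiseLip z e ^ 2) = fun e =>
      a ^ 2 + 2 * a * b * ‖e‖ + b ^ 2 * ‖e‖ ^ 2 := by
    ext e
    simp only [noiseLip, ha, hb]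
    ring
  have hi : Integrable (fun e : Vec ℓ => a ^ 2 + 2 * a * b * ‖e‖) P.noise :=
    (integrable_const _).add (hP.integrable_norm_noise.const_mul _)
  rw [this, integral_add hi (hP.integrable_sq_noise.const_mul _), integral_add (integrable_const _)
    (hP.integrable_norm_noise.const_mul _), integral_const, integral_const_mul, integral_const_mul,
    hP.integral_sq_noise]
  have h1 := mul_le_mul_of_nonneg_left hP.integral_norm_noise_le
    (by positivity : 0 ≤ 2 * a * b)
  have h2 : (√(ℓ : ℝ)) ^ 2 = ℓ := Real.sq_sqrt (Nat.cast_nonneg _)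
  have h3 : a + b * √(ℓ : ℝ) ≤ P.L := by
    refine le_trans (le_of_eq ?_) (hP.lip_le_L hz)
    simp only [ha, hb]
    ring
  have h4 : (a + b * √(ℓ : ℝ)) ^ 2 ≤ P.L ^ 2 := pow_le_pow_left₀ (by positivity) h3 2
  simp only [probReal_univ, one_smul]
  nlinarith

/-! ### Weak convexity of the objective -/

/-- For fixed noise the difference is a sum of Taylor remainders: that of `c`, and those of the rows
`q j` tested against `e`. The `ℓ` rows contribute the factor `√ℓ`. -/
lemma Regular.norm_response_sub_le (hP : P.Regular) {x z : Vec d} (hx : x ∈ P.dom)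
    (hz : z ∈ P.dom) (e : Vec ℓ) :
    ‖P.response x e - linResp (P.c z) (fderiv ℝ P.c z) (fun j => P.q j z)
      (fun j => fderiv ℝ (P.q j) z) z e x‖
      ≤ (P.Lc + √(ℓ : ℝ) * P.Lq * ‖e‖) / 2 * ‖x - z‖ ^ 2 := by
  have hLq := hP.Lq_nonneg
  have hsplit : P.response x e - linResp (P.c z) (fderiv ℝ P.c z) (fun j => P.q j z)
      (fun j => fderiv ℝ (P.q j) z) z e x
      = (P.c x - P.c z - fderiv ℝ P.c z (x - z))
        + WithLp.toLp 2 fun j => inner ℝ e (P.q j x - P.q j z - fderiv ℝ (P.q j) z (x - z)) := by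
    ext j
    simp only [response, linResp, Q, PiLp.sub_apply, PiLp.add_apply, op_rowMat_apply, gradNoise,
      inner_sub_right]
    ring
  rw [hsplit]
  have h1 := norm_taylor_le hP.isOpen_dom hP.convex_dom hP.contDiff_c hP.lipschitz_c hx hz
  have h2 : ‖(WithLp.toLp 2 fun j => inner ℝ e (P.q j x - P.q j z - fderiv ℝ (P.q j) z (x - z)) :
      Vec ℓ)‖ ≤ ‖e‖ * (P.Lq / 2 * ‖x - z‖ ^ 2) * √(∑ _j : Fin ℓ, (1 : ℝ) ^ 2) := by
    refine norm_toLp_le (by positivity) fun j => ?_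
    rw [mul_one]
    refine (abs_real_inner_le_norm _ _).trans (mul_le_mul_of_nonneg_left ?_ (norm_nonneg _))
    exact norm_taylor_le hP.isOpen_dom hP.convex_dom (hP.contDiff_q j) (hP.lipschitz_q j) hx hz
  have h3 : (∑ _j : Fin ℓ, (1 : ℝ) ^ 2) = ℓ := by simp
  rw [h3] at h2
  refine (norm_add_le _ _).trans ((add_le_add h1 h2).trans (le_of_eq ?_))
  ring

lemma Regular.τ_nonneg (hP : P.Regular) : 0 ≤ P.τ := by
  have h1 := hP.Lφ_nonneg
  have h2 := hP.Lc_nonneg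
  have h3 := hP.Lq_nonneg
  unfold τ
  positivity

/-- Average the Taylor remainder over the noise: `E‖ε‖ ≤ √ℓ` meets the factor `√ℓ` from the rows,
and their product is the `ℓ` in `P.τ`. -/
lemma Regular.abs_f_sub_meanCost_le (hP : P.Regular) {x z : Vec d} (hx : x ∈ P.dom)
    (hz : z ∈ P.dom) : |P.f x - P.meanCost z x| ≤ P.τ / 2 * ‖x - z‖ ^ 2 := by
  have := hP.prob_noise
  have h0 := hP.Lφ_nonneg
  have hLq := hP.Lq_nonneg
  rw [f, meanCost, ← integral_sub (hP.integrable_response hx) (hP.integrable_linCost hz hx)]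
  refine (abs_integral_le_integral_abs).trans ?_
  have hb : ∫ e, |P.φ x (P.response x e) - P.linCost z e x| ∂P.noise
      ≤ ∫ e, (P.Lφ * P.Lc / 2 * ‖x - z‖ ^ 2
        + P.Lφ * √(ℓ : ℝ) * P.Lq / 2 * ‖x - z‖ ^ 2 * ‖e‖) ∂P.noise := by
    refine integral_mono ((hP.integrable_response hx).sub (hP.integrable_linCost hz hx)).abs
      ((integrable_const _).add (hP.integrable_norm_noise.const_mul _)) fun e => ?_
    have h1 := hP.cost_sub_le_right hx (P.response x e) (linResp (P.c z) (fderiv ℝ P.c z)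
      (fun j => P.q j z) (fun j => fderiv ℝ (P.q j) z) z e x)
    have h2 := mul_le_mul_of_nonneg_left (hP.norm_response_sub_le hx hz e) h0
    refine h1.trans (h2.trans (le_of_eq ?_))
    ring
  refine hb.trans ?_
  rw [integral_add (integrable_const _) (hP.integrable_norm_noise.const_mul _), integral_const,
    integral_const_mul]
  simp only [probReal_univ, one_smul]
  have h1 := mul_le_mul_of_nonneg_left hP.integral_norm_noise_le
    (by positivity : 0 ≤ P.Lφ * √(ℓ : ℝ) * P.Lq / 2 * ‖x - z‖ ^ 2)
  have h2 : √(ℓ : ℝ) * √(ℓ : ℝ) = ℓ := Real.mul_self_sqrt (Nat.cast_nonneg _)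
  refine (add_le_add le_rfl h1).trans (le_of_eq ?_)
  unfold τ
  linear_combination (P.Lφ * P.Lq / 2 * ‖x - z‖ ^ 2) * h2

lemma Regular.convexOn_meanCost (hP : P.Regular) {z : Vec d} (hz : z ∈ P.dom) :
    ConvexOn ℝ P.dom (P.meanCost z) := by
  refine ⟨hP.convex_dom, fun x hx y hy a b ha hb hab => ?_⟩
  have hm := hP.convex_dom hx hy ha hb hab
  have hix := hP.integrable_linCost hz hx
  have hiy := hP.integrable_linCost hz hy
  simp only [meanCost, smul_eq_mul]
  rw [← integral_const_mul, ← integral_const_mul,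
    ← integral_add (hix.const_mul _) (hiy.const_mul _)]
  exact integral_mono (hP.integrable_linCost hz hm) ((hix.const_mul _).add (hiy.const_mul _))
    fun e => (hP.convexOn_linCost z e).2 hx hy ha hb hab

lemma meanCost_self (z : Vec d) : P.meanCost z z = P.f z := by
  simp [meanCost, linCost_self, f]

/-- The mean linearized costs are convex, touch `f` at their reference points, and exceed it by at
most `τ / 2` times the squared distance. -/
lemma Regular.convexOn_f_add (hP : P.Regular) (w : Vec d) :
    ConvexOn ℝ P.dom fun x => P.f x + P.τ / 2 * ‖x - w‖ ^ 2 := by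
  refine convexOn_of_convex_minorants hP.convex_dom (m := P.meanCost)
    (fun z hz => hP.convexOn_meanCost hz) (fun z _ => meanCost_self z) (fun z hz x hx => ?_) w
  have := (abs_le.1 (hP.abs_f_sub_meanCost_le hx hz)).1
  linarith

/-- A finite convex function is continuous on an open set, and `f` differs from one by a quadratic.
-/
lemma Regular.continuousOn_f (hP : P.Regular) : ContinuousOn P.f P.dom := by
  have h := (hP.convexOn_f_add 0).continuousOn hP.isOpen_dom
  have h2 : ContinuousOn (fun x : Vec d => P.τ / 2 * ‖x - 0‖ ^ 2) P.dom := by fun_prop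
  exact (h.sub h2).congr fun x _ => by simp

/-! ### The proximal operator -/

/-- Existence needs only compactness and continuity, so no condition is put on `ρ`; at `ρ = 0` the
conventions for division make both forms of the coefficient zero. Uniqueness is where `τ < ρ`
enters. -/
lemma Regular.prox_spec (hP : P.Regular) (hne : P.feas.Nonempty) {ρ : ℝ} (z : Vec d) :
    prox P.feas P.f (1 / ρ) z ∈ P.feas ∧
      ∀ y ∈ P.feas, P.f (prox P.feas P.f (1 / ρ) z) + ρ / 2 * ‖prox P.feas P.f (1 / ρ) z - z‖ ^ 2
        ≤ P.f y + ρ / 2 * ‖y - z‖ ^ 2 := by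
  have hρ' : 1 / (2 * (1 / ρ)) = ρ / 2 := by
    rw [one_div, mul_inv, one_div, inv_inv]
    ring
  have hc : ContinuousOn (fun y => P.f y + 1 / (2 * (1 / ρ)) * ‖y - z‖ ^ 2) P.feas :=
    (hP.continuousOn_f.mono hP.feas_subset).add (by fun_prop)
  have h := argminOn_spec hP.isCompact_feas hne hc
  refine ⟨h.1, fun y hy => ?_⟩
  have h2 := h.2 hy
  simp only [hρ', Set.mem_ofPred_eq] at h2
  simp only [prox, hρ']
  exact h2

lemma Regular.measurable_prox (hP : P.Regular) (hne : P.feas.Nonempty) {ρ : ℝ} (hρ : P.τ < ρ) :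
    Measurable (prox P.feas P.f (1 / ρ)) := by
  refine measurable_argmin (g := fun z y => P.f y + ρ / 2 * ‖y - z‖ ^ 2) hP.isCompact_feas
    (fun x _ => by fun_prop)
    (fun z => (hP.continuousOn_f.mono hP.feas_subset).add (by fun_prop))
    (fun z => (hP.prox_spec hne z).1) (fun z y hy => (hP.prox_spec hne z).2 y hy) ?_
  intro z y hy hymin
  have hx := hP.prox_spec (ρ := ρ) hne z
  set x := prox P.feas P.f (1 / ρ) z
  have hconv := (hP.convexOn_f_add z).subset hP.feas_subset hP.convex_feas
  -- Split `ρ / 2 = τ / 2 + (ρ - τ) / 2`: the first part makes `f` convex, and the second remains as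
  -- strong convexity, which forces uniqueness.
  have h1 := quadratic_growth (a := ρ - P.τ) (z := z) hconv hy hx.1 (by
    intro u hu
    have := hymin hu
    simp only [Set.mem_ofPred_eq] at this ⊢
    linarith)
  have h2 := hx.2 y hy
  have h3 : (ρ - P.τ) / 2 * ‖x - y‖ ^ 2 ≤ 0 := by linarith
  have h4 : ‖x - y‖ ^ 2 ≤ 0 := by
    by_contra hcon
    push Not at hcon
    have : 0 < (ρ - P.τ) / 2 * ‖x - y‖ ^ 2 := mul_pos (by linarith) hcon
    linarith
  have h5 : ‖x - y‖ = 0 := by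
    have := sq_nonneg ‖x - y‖
    exact pow_eq_zero_iff (n := 2) (by norm_num) |>.1 (le_antisymm h4 this)
  rw [norm_eq_zero, sub_eq_zero] at h5
  exact h5.symm

lemma Regular.f_sub_le_Δ₀ (hP : P.Regular) {x y : Vec d} (hx : x ∈ P.feas) (hy : y ∈ P.feas) :
    P.f x - P.f y ≤ P.Δ₀ := by
  refine le_csSup ?_ ⟨(x, y), ⟨hx, hy⟩, rfl⟩
  apply (hP.isCompact_feas.prod hP.isCompact_feas).bddAbove_image
  have hf := hP.continuousOn_f.mono hP.feas_subset
  exact (hf.comp continuousOn_fst fun p hp => hp.1).sub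
    (hf.comp continuousOn_snd fun p hp => hp.2)

end Problem

/-! ### ### Sample average surrogates and stability of their minimizers -/

/-- Resampling one coordinate of an i.i.d. sample preserves its law. -/
lemma measurePreserving_update {m : ℕ} {E : Type*} [MeasurableSpace E] (ν : Measure E)
    [IsProbabilityMeasure ν] (i : Fin m) :
    MeasurePreserving (fun p : (Fin m → E) × E => Function.update p.1 i p.2)
      ((Measure.pi fun _ => ν).prod ν) (Measure.pi fun _ => ν) := by
  have hm : Measurable (fun p : (Fin m → E) × E => Function.update p.1 i p.2) := by
    refine measurable_pi_lambda _ fun j => ?_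
    by_cases h : j = i
    · subst h
      simpa using measurable_snd
    · simp only [Function.update_of_ne h]
      exact (measurable_pi_apply j).comp measurable_fst
  refine ⟨hm, (Measure.pi_eq fun s hs => ?_).symm⟩
  rw [Measure.map_apply hm (MeasurableSet.univ_pi hs)]
  have : (fun p : (Fin m → E) × E => Function.update p.1 i p.2) ⁻¹' (Set.univ.pi s)
      = (Set.univ.pi (Function.update s i Set.univ)) ×ˢ s i := by
    ext p
    simp only [Set.mem_preimage, Set.mem_pi, Set.mem_univ, forall_true_left, Set.mem_prod]
    constructor
    · intro h
      refine ⟨fun j => ?_, by simpa using h i⟩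
      by_cases hj : j = i
      · subst hj
        simp
      · simpa [hj] using h j
    · rintro ⟨h1, h2⟩ j
      by_cases hj : j = i
      · subst hj
        simpa using h2
      · simpa [hj] using h1 j
  rw [this, Measure.prod_prod, Measure.pi_pi]
  rw [← Finset.mul_prod_erase _ _ (Finset.mem_univ i),
    ← Finset.mul_prod_erase (a := i) Finset.univ (fun j => ν (s j)) (Finset.mem_univ i)]
  simp only [Function.update_self, measure_univ, one_mul]
  rw [mul_comm]
  congr 1
  exact Finset.prod_congr rfl fun j hj => by rw [Function.update_of_ne (Finset.ne_of_mem_erase hj)]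

lemma integral_comp_of_measurePreserving {A B : Type*} [MeasurableSpace A] [MeasurableSpace B]
    {κ : Measure A} {ν : Measure B} {N : A → B} (hN : MeasurePreserving N κ ν) {g : B → ℝ}
    (hg : AEStronglyMeasurable g ν) : ∫ a, g (N a) ∂κ = ∫ b, g b ∂ν := by
  rw [← hN.map_eq] at hg ⊢
  exact (integral_map hN.measurable.aemeasurable hg).symm

namespace Problem

variable {P : Problem d ℓ}

variable (P) in
/-- The average of the linearized costs at the reference point `z` over a sample of the noise. -/
def avgCost {m : ℕ} (z : Vec d) (ω : Fin m → Vec ℓ) (x : Vec d) : ℝ :=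
  (∑ i, P.linCost z (ω i) x) / m

variable (P) in
/-- The regularized average of the linearized costs. -/
def regAvg {m : ℕ} (α : ℝ) (z : Vec d) (ω : Fin m → Vec ℓ) (x : Vec d) : ℝ :=
  P.avgCost z ω x + α / 2 * ‖x - z‖ ^ 2

variable (P) in
/-- The minimizer of the regularized average of the linearized costs. -/
def regArgmin {m : ℕ} (α : ℝ) (z : Vec d) (ω : Fin m → Vec ℓ) : Vec d :=
  argminOn P.feas (P.regAvg α z ω)

lemma convexOn_sum_div {E ι : Type*} [AddCommGroup E] [Module ℝ E] {U : Set E} (hU : Convex ℝ U)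
    (s : Finset ι) {g : ι → E → ℝ} (hg : ∀ i ∈ s, ConvexOn ℝ U (g i)) {m : ℝ} (hm : 0 ≤ m) :
    ConvexOn ℝ U fun x => (∑ i ∈ s, g i x) / m := by
  refine ⟨hU, fun x hx y hy a b ha hb hab => ?_⟩
  simp only [smul_eq_mul]
  have : ∑ i ∈ s, g i (a • x + b • y) ≤ a * ∑ i ∈ s, g i x + b * ∑ i ∈ s, g i y := by
    rw [Finset.mul_sum, Finset.mul_sum, ← Finset.sum_add_distrib]
    exact Finset.sum_le_sum fun i hi => (hg i hi).2 hx hy ha hb hab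
  calc _ ≤ (a * ∑ i ∈ s, g i x + b * ∑ i ∈ s, g i y) / m := by gcongr
    _ = _ := by ring

variable {m : ℕ}

lemma Regular.convexOn_avgCost (hP : P.Regular) (z : Vec d) (ω : Fin m → Vec ℓ) :
    ConvexOn ℝ P.dom (P.avgCost z ω) :=
  convexOn_sum_div hP.convex_dom _ (fun i _ => hP.convexOn_linCost z (ω i)) (Nat.cast_nonneg m)

lemma Regular.continuousOn_regAvg (hP : P.Regular) (α : ℝ) (z : Vec d) (ω : Fin m → Vec ℓ) :
    ContinuousOn (P.regAvg α z ω) P.dom :=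
  ((continuousOn_finsetSum _ fun i _ => hP.continuousOn_linCost z (ω i)).div_const _).add
    (by fun_prop)

lemma Regular.regArgmin_spec (hP : P.Regular) (hne : P.feas.Nonempty) (α : ℝ) (z : Vec d)
    (ω : Fin m → Vec ℓ) :
    P.regArgmin α z ω ∈ P.feas ∧ IsMinOn (P.regAvg α z ω) P.feas (P.regArgmin α z ω) :=
  argminOn_spec hP.isCompact_feas hne ((hP.continuousOn_regAvg α z ω).mono hP.feas_subset)

lemma Regular.regAvg_growth (hP : P.Regular) {α : ℝ} {z : Vec d} {ω : Fin m → Vec ℓ} {x y : Vec d}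
    (hx : x ∈ P.feas) (hy : y ∈ P.feas) (hmin : IsMinOn (P.regAvg α z ω) P.feas x) :
    P.regAvg α z ω x + α / 2 * ‖y - x‖ ^ 2 ≤ P.regAvg α z ω y :=
  quadratic_growth ((hP.convexOn_avgCost z ω).subset hP.feas_subset hP.convex_feas) hx hy hmin

lemma Regular.measurable_regArgmin (hP : P.Regular) (hne : P.feas.Nonempty) {α : ℝ} (hα : 0 < α)
    (z : Vec d) : Measurable fun ω : Fin m → Vec ℓ => P.regArgmin α z ω := by
  refine measurable_argmin (g := fun ω => P.regAvg α z ω) hP.isCompact_feas ?_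
    (fun ω => (hP.continuousOn_regAvg α z ω).mono hP.feas_subset)
    (fun ω => (hP.regArgmin_spec hne α z ω).1) (fun ω => (hP.regArgmin_spec hne α z ω).2) ?_
  · intro x hx
    refine ((Finset.measurable_sum _ fun i _ => ?_).div_const _).add_const _
    exact (hP.continuous_linCost_noise z (hP.feas_subset hx)).measurable.comp
      (measurable_pi_apply i)
  · intro ω y hy hmin
    have hx := hP.regArgmin_spec hne α z ω
    have h1 := hP.regAvg_growth hy hx.1 hmin
    have h2 : P.regAvg α z ω (P.regArgmin α z ω) ≤ P.regAvg α z ω y := hx.2 hy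
    have h3 : ‖P.regArgmin α z ω - y‖ ^ 2 ≤ 0 := by nlinarith
    have h4 : ‖P.regArgmin α z ω - y‖ = 0 :=
      (pow_eq_zero_iff (n := 2) (by norm_num)).1 (le_antisymm h3 (sq_nonneg _))
    rw [norm_eq_zero, sub_eq_zero] at h4
    exact h4.symm

lemma avgCost_sub_update (z : Vec d) (ω : Fin m → Vec ℓ) (i : Fin m) (e : Vec ℓ) (x : Vec d) :
    P.avgCost z ω x - P.avgCost z (Function.update ω i e) x
      = (P.linCost z (ω i) x - P.linCost z e x) / m := by
  unfold avgCost
  rw [← Finset.add_sum_erase _ _ (Finset.mem_univ i),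
    ← Finset.add_sum_erase (a := i) Finset.univ
      (fun j => P.linCost z (Function.update ω i e j) x) (Finset.mem_univ i),
    Finset.sum_congr rfl (g := fun j => P.linCost z (ω j) x)
      (fun j hj => by rw [Function.update_of_ne (Finset.ne_of_mem_erase hj)] :
        ∀ j ∈ Finset.univ.erase i, P.linCost z (Function.update ω i e j) x = P.linCost z (ω j) x),
    Function.update_self]
  ring

/-- Stability of the minimizer under the replacement of one sample. -/
lemma Regular.norm_regArgmin_sub_le (hP : P.Regular) (hne : P.feas.Nonempty) {α : ℝ} (hα : 0 < α)
    (hm : 0 < m) (z : Vec d) (ω : Fin m → Vec ℓ) (i : Fin m) (e : Vec ℓ) :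
    ‖P.regArgmin α z ω - P.regArgmin α z (Function.update ω i e)‖
      ≤ (P.noiseLip z (ω i) + P.noiseLip z e) / (m * α) := by
  have hx := hP.regArgmin_spec hne α z ω
  have hy := hP.regArgmin_spec hne α z (Function.update ω i e)
  set x := P.regArgmin α z ω
  set y := P.regArgmin α z (Function.update ω i e)
  have h1 := hP.regAvg_growth hx.1 hy.1 hx.2
  have h2 := hP.regAvg_growth hy.1 hx.1 hy.2
  have h3 := avgCost_sub_update (P := P) z ω i e x
  have h4 := avgCost_sub_update (P := P) z ω i e y
  have h5 := (abs_le.1 (hP.linCost_sub_le z (ω i) (hP.feas_subset hx.1) (hP.feas_subset hy.1))).1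
  have h6 := (abs_le.1 (hP.linCost_sub_le z e (hP.feas_subset hx.1) (hP.feas_subset hy.1))).2
  have hm' : (0 : ℝ) < m := Nat.cast_pos.2 hm
  rw [norm_sub_rev y x] at h1
  simp only [regAvg] at h1 h2
  -- Add the two growth inequalities. The averages differ in a single summand, so what remains is an
  -- increment of two linearized costs between `x` and `y`, divided by `m`.
  have h7 : α * ‖x - y‖ ^ 2
      ≤ ((P.noiseLip z (ω i) + P.noiseLip z e) * ‖x - y‖) / m := by
    calc α * ‖x - y‖ ^ 2
        ≤ (P.linCost z (ω i) y - P.linCost z e y) / m - (P.linCost z (ω i) x - P.linCost z e x) / m := by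
          rw [← h3, ← h4]
          linarith
      _ = ((P.linCost z (ω i) y - P.linCost z e y) - (P.linCost z (ω i) x - P.linCost z e x)) / m := by
          ring
      _ ≤ _ := by
          gcongr
          linarith
  rcases (norm_nonneg (x - y)).eq_or_lt with h0 | h0
  · rw [← h0]
    have := hP.noiseLip_nonneg z (ω i)
    have := hP.noiseLip_nonneg z e
    positivity
  · rw [le_div_iff₀ (by positivity)]
    rw [le_div_iff₀ hm'] at h7
    refine le_of_mul_le_mul_right ?_ h0
    nlinarith

/-- A Carathéodory function, continuous in the point and measurable in the noise, is jointly
measurable; this allows a sample-dependent minimizer to be substituted for the point. -/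
lemma Regular.measurable_linCost (hP : P.Regular) (z : Vec d) :
    Measurable fun p : P.feas × Vec ℓ => P.linCost z p.2 p.1 :=
  measurable_uncurry_of_continuous_of_measurable
    (u := fun (x : P.feas) (e : Vec ℓ) => P.linCost z e x)
    (fun e => ((hP.continuousOn_linCost z e).mono hP.feas_subset).domRestrict)
    (fun x => (hP.continuous_linCost_noise z (hP.feas_subset x.2)).measurable)

lemma Regular.exists_norm_sub_le (hP : P.Regular) : ∃ R : ℝ, 0 ≤ R ∧
    ∀ x ∈ P.feas, ∀ y ∈ P.feas, ‖x - y‖ ≤ R :=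
  ⟨Metric.diam P.feas, Metric.diam_nonneg, fun x hx y hy => by
    rw [← dist_eq_norm]
    exact Metric.dist_le_diam_of_mem hP.isCompact_feas.isBounded hx hy⟩

/-- Integrability of the linearized cost along measurable selections of points and noises. -/
lemma Regular.integrable_linCost_comp (hP : P.Regular) {z : Vec d} (hz : z ∈ P.feas) {A : Type*}
    [MeasurableSpace A] {κ : Measure A} {N : A → Vec ℓ} (hN : MeasurePreserving N κ P.noise)
    {x : A → Vec d} (hx : Measurable x) (hxf : ∀ a, x a ∈ P.feas) :
    Integrable (fun a => P.linCost z (N a) (x a)) κ := by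
  have hzd := hP.feas_subset hz
  obtain ⟨R, hR0, hR⟩ := hP.exists_norm_sub_le
  have hmeas : Measurable fun a => P.linCost z (N a) (x a) :=
    (hP.measurable_linCost z).comp ((hx.subtype_mk (h := hxf)).prodMk hN.measurable)
  have hi : Integrable (fun e => |P.φ z (P.response z e)| + P.noiseLip z e * R) P.noise :=
    (hP.integrable_response hzd).abs.add ((hP.integrable_noiseLip z).mul_const R)
  refine Integrable.mono' (hN.integrable_comp_of_integrable hi) hmeas.aestronglyMeasurable
    (Filter.Eventually.of_forall fun a => ?_)
  refine (hP.abs_linCost_le hzd (hP.feas_subset (hxf a)) (N a)).trans ?_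
  simp only [Function.comp_apply]
  gcongr
  · exact hP.noiseLip_nonneg _ _
  · exact hR _ (hxf a) _ hz

lemma integrable_of_norm_le {A : Type*} [MeasurableSpace A] {κ : Measure A} [IsFiniteMeasure κ]
    {g : A → ℝ} (hg : Measurable g) {R : ℝ} (hR : ∀ a, |g a| ≤ R) : Integrable g κ :=
  Integrable.mono' (integrable_const R) hg.aestronglyMeasurable (Filter.Eventually.of_forall hR)

/-- The expected linearized cost of the sampled minimizer exceeds its expected sampled cost by at
most the stability gap. -/
lemma Regular.integral_meanCost_sub_le (hP : P.Regular) {z : Vec d} (hz : z ∈ P.feas) {α : ℝ}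
    (hα : 0 < α) (hm : 0 < m) (i : Fin m) :
    ∫ p : (Fin m → Vec ℓ) × Vec ℓ, P.linCost z p.2 (P.regArgmin α z p.1)
        ∂((Measure.pi fun _ => P.noise).prod P.noise)
      - ∫ ω : Fin m → Vec ℓ, P.linCost z (ω i) (P.regArgmin α z ω) ∂(Measure.pi fun _ => P.noise)
      ≤ 2 * P.L ^ 2 / (m * α) := by
  have := hP.prob_noise
  have hne : P.feas.Nonempty := ⟨z, hz⟩
  have hm' : (0 : ℝ) < m := Nat.cast_pos.2 hm
  set μ : Measure (Fin m → Vec ℓ) := Measure.pi fun _ => P.noise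
  have hx : Measurable fun ω : Fin m → Vec ℓ => P.regArgmin α z ω := hP.measurable_regArgmin hne hα z
  have hxf : ∀ ω : Fin m → Vec ℓ, P.regArgmin α z ω ∈ P.feas := fun ω =>
    (hP.regArgmin_spec hne α z ω).1
  have hupd := measurePreserving_update (m := m) P.noise i
  have hsnd : MeasurePreserving (Prod.snd : (Fin m → Vec ℓ) × Vec ℓ → Vec ℓ) (μ.prod P.noise)
      P.noise := measurePreserving_snd
  have hfst : MeasurePreserving (Prod.fst : (Fin m → Vec ℓ) × Vec ℓ → (Fin m → Vec ℓ))
      (μ.prod P.noise) μ := measurePreserving_fst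
  have hev : MeasurePreserving (fun ω : Fin m → Vec ℓ => ω i) μ P.noise :=
    measurePreserving_eval (fun _ => P.noise) i
  have hevf : MeasurePreserving (fun p : (Fin m → Vec ℓ) × Vec ℓ => p.1 i) (μ.prod P.noise)
      P.noise := hev.comp hfst
  have hi1 : Integrable (fun p : (Fin m → Vec ℓ) × Vec ℓ =>
      P.linCost z p.2 (P.regArgmin α z p.1)) (μ.prod P.noise) :=
    hP.integrable_linCost_comp hz hsnd (hx.comp measurable_fst) fun p => hxf _
  have hi2 : Integrable (fun p : (Fin m → Vec ℓ) × Vec ℓ =>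
      P.linCost z p.2 (P.regArgmin α z (Function.update p.1 i p.2))) (μ.prod P.noise) :=
    hP.integrable_linCost_comp hz hsnd (hx.comp hupd.measurable) fun p => hxf _
  have hi3 : Integrable (fun ω : Fin m → Vec ℓ => P.linCost z (ω i) (P.regArgmin α z ω)) μ :=
    hP.integrable_linCost_comp hz hev hx hxf
  -- By exchangeability, the cost of the `i`-th sample at its own minimizer has the law of the cost
  -- of a fresh noise at the minimizer recomputed with that noise in place of sample `i`. Both terms
  -- then use the same noise `p.2` and differ only in the minimizer.
  have hswap : ∫ ω, P.linCost z (ω i) (P.regArgmin α z ω) ∂μ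
      = ∫ p : (Fin m → Vec ℓ) × Vec ℓ,
        P.linCost z p.2 (P.regArgmin α z (Function.update p.1 i p.2)) ∂(μ.prod P.noise) := by
    rw [← integral_comp_of_measurePreserving hupd hi3.aestronglyMeasurable]
    simp only [Function.update_self]
    rfl
  rw [hswap, ← integral_sub hi1 hi2]
  have hs2 : Integrable (fun p : (Fin m → Vec ℓ) × Vec ℓ => P.noiseLip z p.2 ^ 2) (μ.prod P.noise) :=
    hsnd.integrable_comp_of_integrable (hP.integrable_sq_noiseLip z)
  have hs1 : Integrable (fun p : (Fin m → Vec ℓ) × Vec ℓ => P.noiseLip z (p.1 i) ^ 2)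
      (μ.prod P.noise) := hevf.integrable_comp_of_integrable (hP.integrable_sq_noiseLip z)
  have hv2 : ∫ p : (Fin m → Vec ℓ) × Vec ℓ, P.noiseLip z p.2 ^ 2 ∂(μ.prod P.noise)
      = ∫ e, P.noiseLip z e ^ 2 ∂P.noise := by
    exact integral_comp_of_measurePreserving hsnd (hP.integrable_sq_noiseLip z).aestronglyMeasurable
  have hv1 : ∫ p : (Fin m → Vec ℓ) × Vec ℓ, P.noiseLip z (p.1 i) ^ 2 ∂(μ.prod P.noise)
      = ∫ e, P.noiseLip z e ^ 2 ∂P.noise := by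
    exact integral_comp_of_measurePreserving hevf (hP.integrable_sq_noiseLip z).aestronglyMeasurable
  have hL := hP.integral_sq_noiseLip_le hz
  -- With `u` the modulus of the fresh noise and `v` that of the replaced one, `u * (u + v) ≤ 3 / 2
  -- * u ^ 2 + 1 / 2 * v ^ 2`. Both have second moment at most `L ^ 2`, which gives the constant
  -- `2`.
  calc _ ≤ ∫ p : (Fin m → Vec ℓ) × Vec ℓ, (3 / 2 * P.noiseLip z p.2 ^ 2
        + 1 / 2 * P.noiseLip z (p.1 i) ^ 2) / (m * α) ∂(μ.prod P.noise) := by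
        refine integral_mono (hi1.sub hi2) (((hs2.const_mul _).add (hs1.const_mul _)).div_const _)
          fun p => ?_
        have h1 := (abs_le.1 (hP.linCost_sub_le z p.2 (hP.feas_subset (hxf p.1))
          (hP.feas_subset (hxf (Function.update p.1 i p.2))))).2
        have h2 := mul_le_mul_of_nonneg_left (hP.norm_regArgmin_sub_le hne hα hm z p.1 i p.2)
          (hP.noiseLip_nonneg z p.2)
        refine h1.trans (h2.trans ?_)
        rw [mul_div_assoc']
        refine div_le_div_of_nonneg_right ?_ (by positivity)
        nlinarith [sq_nonneg (P.noiseLip z p.2 - P.noiseLip z (p.1 i))]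
    _ = (3 / 2 * ∫ e, P.noiseLip z e ^ 2 ∂P.noise + 1 / 2 * ∫ e, P.noiseLip z e ^ 2 ∂P.noise)
        / (m * α) := by
        rw [integral_div, integral_add (hs2.const_mul _) (hs1.const_mul _), integral_const_mul,
          integral_const_mul, hv1, hv2]
    _ ≤ _ := by
        gcongr
        linarith

/-- Lower bound on the expected minimum of the sampled surrogate. -/
lemma Regular.le_integral_regAvg_regArgmin (hP : P.Regular) {z : Vec d} (hz : z ∈ P.feas) {α b : ℝ}
    (hα : 0 < α) (hm : 0 < m)
    (hb : ∀ x ∈ P.feas, b ≤ P.meanCost z x + α / 2 * ‖x - z‖ ^ 2) :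
    Integrable (fun ω : Fin m → Vec ℓ => P.regAvg α z ω (P.regArgmin α z ω))
        (Measure.pi fun _ => P.noise) ∧
      b - 2 * P.L ^ 2 / (m * α) ≤ ∫ ω : Fin m → Vec ℓ, P.regAvg α z ω (P.regArgmin α z ω)
        ∂(Measure.pi fun _ => P.noise) := by
  have := hP.prob_noise
  have hne : P.feas.Nonempty := ⟨z, hz⟩
  have hm' : (0 : ℝ) < m := Nat.cast_pos.2 hm
  set μ : Measure (Fin m → Vec ℓ) := Measure.pi fun _ => P.noise
  have hx : Measurable fun ω : Fin m → Vec ℓ => P.regArgmin α z ω := hP.measurable_regArgmin hne hα z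
  have hxf : ∀ ω : Fin m → Vec ℓ, P.regArgmin α z ω ∈ P.feas := fun ω =>
    (hP.regArgmin_spec hne α z ω).1
  have hsnd : MeasurePreserving (Prod.snd : (Fin m → Vec ℓ) × Vec ℓ → Vec ℓ) (μ.prod P.noise)
      P.noise := measurePreserving_snd
  have hi1 : Integrable (fun p : (Fin m → Vec ℓ) × Vec ℓ =>
      P.linCost z p.2 (P.regArgmin α z p.1)) (μ.prod P.noise) :=
    hP.integrable_linCost_comp hz hsnd (hx.comp measurable_fst) fun p => hxf _
  have hi3 : ∀ i, Integrable (fun ω : Fin m → Vec ℓ => P.linCost z (ω i) (P.regArgmin α z ω)) μ :=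
    fun i => hP.integrable_linCost_comp hz (measurePreserving_eval (fun _ => P.noise) i) hx hxf
  obtain ⟨R, hR0, hR⟩ := hP.exists_norm_sub_le
  have hi4 : Integrable (fun ω : Fin m → Vec ℓ => α / 2 * ‖P.regArgmin α z ω - z‖ ^ 2) μ := by
    refine Integrable.const_mul (integrable_of_norm_le (R := R ^ 2)
      ((hx.sub_const z).norm.pow_const 2) fun ω => ?_) _
    rw [abs_of_nonneg (sq_nonneg _)]
    exact pow_le_pow_left₀ (norm_nonneg _) (hR _ (hxf ω) _ hz) 2
  have hi5 : Integrable (fun ω : Fin m → Vec ℓ => P.avgCost z ω (P.regArgmin α z ω)) μ :=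
    (integrable_finsetSum _ fun i _ => hi3 i).div_const _
  refine ⟨hi5.add hi4, ?_⟩
  -- The fresh noise is independent of the minimizer, so integrating it out gives the mean cost at
  -- the minimizer.
  have hmean : ∫ p : (Fin m → Vec ℓ) × Vec ℓ, P.linCost z p.2 (P.regArgmin α z p.1)
      ∂(μ.prod P.noise) = ∫ ω, P.meanCost z (P.regArgmin α z ω) ∂μ := integral_prod _ hi1
  have hi6 : Integrable (fun ω => P.meanCost z (P.regArgmin α z ω)) μ := hi1.integral_prod_left
  have hge : b ≤ ∫ ω, P.meanCost z (P.regArgmin α z ω) ∂μ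
      + ∫ ω, α / 2 * ‖P.regArgmin α z ω - z‖ ^ 2 ∂μ := by
    rw [← integral_add hi6 hi4]
    have : b = ∫ _ω : Fin m → Vec ℓ, b ∂μ := by simp
    rw [this]
    exact integral_mono (integrable_const _) (hi6.add hi4) fun ω => hb _ (hxf ω)
  have hsum : ∫ ω, P.avgCost z ω (P.regArgmin α z ω) ∂μ
      = (∑ i, ∫ ω, P.linCost z (ω i) (P.regArgmin α z ω) ∂μ) / m := by
    unfold avgCost
    rw [integral_div, integral_finsetSum _ fun i _ => hi3 i]
  have hge2 : ∫ ω, P.meanCost z (P.regArgmin α z ω) ∂μ - 2 * P.L ^ 2 / (m * α)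
      ≤ ∫ ω, P.avgCost z ω (P.regArgmin α z ω) ∂μ := by
    rw [hsum, le_div_iff₀ hm', ← hmean]
    -- The stability gap is the same for every sample, so it survives the average over `i`.
    have : ∀ i ∈ (Finset.univ : Finset (Fin m)),
        ∫ p : (Fin m → Vec ℓ) × Vec ℓ, P.linCost z p.2 (P.regArgmin α z p.1) ∂(μ.prod P.noise)
          - 2 * P.L ^ 2 / (m * α) ≤ ∫ ω, P.linCost z (ω i) (P.regArgmin α z ω) ∂μ := fun i _ => by
      linarith [hP.integral_meanCost_sub_le hz hα hm i]
    have h2 := Finset.card_nsmul_le_sum _ _ _ this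
    rw [Finset.card_univ, Fintype.card_fin, nsmul_eq_mul] at h2
    linarith
  have hfin : ∫ ω, P.regAvg α z ω (P.regArgmin α z ω) ∂μ
      = ∫ ω, P.avgCost z ω (P.regArgmin α z ω) ∂μ
        + ∫ ω, α / 2 * ‖P.regArgmin α z ω - z‖ ^ 2 ∂μ := integral_add hi5 hi4
  rw [hfin]
  linarith

/-- Expected decrease of the sampled surrogate from the proximal point to its minimizer. -/
lemma Regular.lintegral_regAvg_sub_le (hP : P.Regular) {z y : Vec d} (hz : z ∈ P.feas)
    (hy : y ∈ P.feas) {α ρ : ℝ} (hα : 0 < α) (hm : 0 < m) (hαρ : ρ + P.τ ≤ α)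
    (hprox : ∀ x ∈ P.feas, P.f y + ρ / 2 * ‖y - z‖ ^ 2 ≤ P.f x + ρ / 2 * ‖x - z‖ ^ 2) :
    ∫⁻ ω : Fin m → Vec ℓ,
        ENNReal.ofReal (P.regAvg α z ω y - P.regAvg α z ω (P.regArgmin α z ω))
        ∂(Measure.pi fun _ => P.noise)
      ≤ ENNReal.ofReal ((P.τ + α - ρ) / 2 * ‖y - z‖ ^ 2 + 2 * P.L ^ 2 / (m * α)) := by
  have := hP.prob_noise
  have hne : P.feas.Nonempty := ⟨z, hz⟩
  have hm' : (0 : ℝ) < m := Nat.cast_pos.2 hm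
  have hzd := hP.feas_subset hz
  have hyd := hP.feas_subset hy
  -- The proximal value is a lower bound for the regularized mean cost: `f` exceeds the mean cost by
  -- at most `τ / 2 * ‖x - z‖ ^ 2`, and `α - τ ≥ ρ`.
  obtain ⟨hint, hle⟩ := hP.le_integral_regAvg_regArgmin (m := m) hz hα hm
    (b := P.f y + ρ / 2 * ‖y - z‖ ^ 2) fun x hx => by
      have h1 := (abs_le.1 (hP.abs_f_sub_meanCost_le (hP.feas_subset hx) hzd)).2
      have h2 := hprox x hx
      have h3 : (ρ + P.τ) * ‖x - z‖ ^ 2 ≤ α * ‖x - z‖ ^ 2 := by gcongr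
      linarith
  have hi : ∀ i : Fin m, Integrable (fun ω : Fin m → Vec ℓ => P.linCost z (ω i) y)
      (Measure.pi fun _ => P.noise) := fun i =>
    hP.integrable_linCost_comp hz (measurePreserving_eval (fun _ => P.noise) i) measurable_const
      fun _ => hy
  have hia : Integrable (fun ω : Fin m → Vec ℓ => P.avgCost z ω y)
      (Measure.pi fun _ => P.noise) := (integrable_finsetSum _ fun i _ => hi i).div_const _
  have hiy : Integrable (fun ω : Fin m → Vec ℓ => P.regAvg α z ω y)
      (Measure.pi fun _ => P.noise) := hia.add (integrable_const _)
  have hval : ∫ ω : Fin m → Vec ℓ, P.regAvg α z ω y ∂(Measure.pi fun _ => P.noise)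
      = P.meanCost z y + α / 2 * ‖y - z‖ ^ 2 := by
    unfold regAvg
    rw [integral_add hia (integrable_const _)]
    unfold avgCost
    rw [integral_div, integral_finsetSum _ fun i _ => hi i]
    have : ∀ i : Fin m, ∫ ω : Fin m → Vec ℓ, P.linCost z (ω i) y ∂(Measure.pi fun _ => P.noise)
        = P.meanCost z y := by
      intro i
      have hev := measurePreserving_eval (fun _ : Fin m => P.noise) i
      exact integral_comp_of_measurePreserving hev
        (hP.continuous_linCost_noise z hyd).aestronglyMeasurable
    simp only [this, Finset.sum_const, Finset.card_univ, Fintype.card_fin, nsmul_eq_mul,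
      integral_const, probReal_univ, one_smul]
    field_simp
  have hid : Integrable (fun ω : Fin m → Vec ℓ =>
      P.regAvg α z ω y - P.regAvg α z ω (P.regArgmin α z ω)) (Measure.pi fun _ => P.noise) :=
    hiy.sub hint
  rw [← ofReal_integral_eq_lintegral_ofReal hid
    (Filter.Eventually.of_forall fun ω =>
      sub_nonneg.2 ((hP.regArgmin_spec hne α z ω).2 hy))]
  refine ENNReal.ofReal_le_ofReal ?_
  rw [integral_sub hiy hint, hval]
  have h1 := (abs_le.1 (hP.abs_f_sub_meanCost_le hyd hzd)).1
  linarith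

end Problem

/-! ### ### Measurable families of laws and conditional laws -/

/-- Powers of a measurable family of probability measures form a measurable family. -/
lemma measurable_pi_iid {A E : Type*} [MeasurableSpace A] [MeasurableSpace E] {k : A → Measure E}
    (hk : Measurable k) [∀ a, IsProbabilityMeasure (k a)] (n : ℕ) :
    Measurable fun a => Measure.pi fun _ : Fin n => k a := by
  refine Measurable.measure_of_isPiSystem_of_isProbabilityMeasure generateFrom_pi.symm isPiSystem_pi
    ?_
  rintro _ ⟨s, hs, rfl⟩
  simp only [Measure.pi_pi]
  exact Finset.measurable_fun_prod _ fun i _ =>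
    (Measure.measurable_coe (hs i trivial)).comp hk

lemma measurable_prod_measure {A E F : Type*} [MeasurableSpace A] [MeasurableSpace E]
    [MeasurableSpace F] {k : A → Measure E} {k' : A → Measure F} (hk : Measurable k)
    (hk' : Measurable k') [∀ a, IsProbabilityMeasure (k a)] [∀ a, IsProbabilityMeasure (k' a)] :
    Measurable fun a => (k a).prod (k' a) := by
  let K : Kernel A E := ⟨k, hk⟩
  let K' : Kernel A F := ⟨k', hk'⟩
  have : IsMarkovKernel K := ⟨fun a => inferInstanceAs (IsProbabilityMeasure (k a))⟩
  have : IsMarkovKernel K' := ⟨fun a => inferInstanceAs (IsProbabilityMeasure (k' a))⟩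
  have h := (K ×ₖ K').measurable
  have h2 : (fun a => (k a).prod (k' a)) = fun a => (K ×ₖ K') a := by
    ext1 a
    rw [Kernel.prod_apply]
    rfl
  rw [h2]
  exact h

/-- Disintegration of the joint law of a random point and data whose conditional law given the
past is a kernel evaluated at the point. -/
lemma lintegral_comp_eq_of_condLaw {Ω A B : Type*} {𝒢 mΩ : MeasurableSpace Ω} [MeasurableSpace A]
    [MeasurableSpace B] {μ : Measure Ω} [IsProbabilityMeasure μ]
    (h𝒢 : 𝒢 ≤ mΩ) {κ : Kernel A B} [IsMarkovKernel κ] {Z : Ω → A} {b : Ω → B}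
    (hZ : Measurable[𝒢] Z) (hb : Measurable b)
    (hlaw : ∀ G : Set Ω, MeasurableSet[𝒢] G → ∀ D : Set B, MeasurableSet D →
      μ (G ∩ b ⁻¹' D) = ∫⁻ ω in G, κ (Z ω) D ∂μ)
    {h : A × B → ENNReal} (hh : Measurable h) :
    ∫⁻ ω, h (Z ω, b ω) ∂μ = ∫⁻ ω, ∫⁻ y, h (Z ω, y) ∂(κ (Z ω)) ∂μ := by
  have hZ' : Measurable Z := hZ.mono h𝒢 le_rfl
  -- Rectangles determine a finite measure on a product; on a rectangle the claim is `hlaw` for the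
  -- event `Z ⁻¹' s`, which belongs to `𝒢`.
  have hjoint : μ.map (fun ω => (Z ω, b ω)) = (μ.map Z) ⊗ₘ κ := by
    have : IsProbabilityMeasure (μ.map fun ω => (Z ω, b ω)) :=
      Measure.isProbabilityMeasure_map (hZ'.prodMk hb).aemeasurable
    refine Measure.ext_prod fun {s t} hs ht => ?_
    have : IsProbabilityMeasure (μ.map Z) := Measure.isProbabilityMeasure_map hZ'.aemeasurable
    rw [Measure.map_apply (hZ'.prodMk hb) (hs.prod ht), Measure.compProd_apply_prod hs ht,
      setLIntegral_map hs (κ.measurable_coe ht) hZ']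
    exact hlaw _ (hZ hs) t ht
  have : IsProbabilityMeasure (μ.map Z) := Measure.isProbabilityMeasure_map hZ'.aemeasurable
  rw [← lintegral_map hh (hZ'.prodMk hb), hjoint, Measure.lintegral_compProd hh,
    lintegral_map hh.lintegral_kernel_prod_right' hZ']

/-! ### ### Predictor laws of the oracle -/

namespace SimOracle

variable {O : SimOracle d} {X : Set (Vec d)}

lemma Valid.isProbabilityMeasure_designLaw (hO : O.Valid X) (n : ℕ) (z : Vec d) :
    IsProbabilityMeasure (O.designLaw n z) := by
  cases O with
  | static ν => exact hO.1
  | adaptive M =>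
    have := hO.1 n
    exact inferInstanceAs (IsProbabilityMeasure (M n z))

lemma Valid.isProbabilityMeasure_residualLaw (hO : O.Valid X) (z : Vec d) :
    IsProbabilityMeasure (O.residualLaw z) := by
  cases O with
  | static ν => exact hO.1
  | adaptive M => exact inferInstanceAs (IsProbabilityMeasure (Measure.dirac z))

lemma Valid.ae_designLaw (hO : O.Valid X) (n : ℕ) {z : Vec d} (hz : z ∈ X) :
    ∀ᵐ x ∂(O.designLaw n z), x ∈ X := by
  cases O with
  | static ν => exact hO.2
  | adaptive M => exact hO.2 n z hz

lemma Valid.ae_residualLaw (hO : O.Valid X) (hX : MeasurableSet X) {z : Vec d} (hz : z ∈ X) :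
    ∀ᵐ x ∂(O.residualLaw z), x ∈ X := by
  cases O with
  | static ν => exact hO.2
  | adaptive M => exact (ae_dirac_iff hX).2 hz

lemma measurable_designLaw (n : ℕ) : Measurable (O.designLaw n) := by
  cases O with
  | static ν => exact measurable_const
  | adaptive M => exact (M n).measurable

lemma measurable_residualLaw : Measurable O.residualLaw := by
  cases O with
  | static ν => exact measurable_const
  | adaptive M => exact Measure.measurable_dirac

end SimOracle

/-! ### ### Realized noise and the sampling kernel -/

namespace Problem

variable {P : Problem d ℓ}

lemma Regular.measurableSet_feas (hP : P.Regular) : MeasurableSet P.feas :=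
  hP.isCompact_feas.isClosed.measurableSet

lemma Regular.isUnit_det_Q (hP : P.Regular) {x : Vec d} (hx : x ∈ P.dom) : IsUnit (P.Q x).det :=
  (hP.posDef_Q x hx).det_pos.ne'.isUnit

variable (P) in
/-- The noise realized in a pair `(x, ξ)`. -/
def noiseOf (w : Vec d × Vec ℓ) : Vec ℓ := recoverNoise (P.c w.1) (fun j => P.q j w.1) w.2

lemma Regular.noiseOf_response (hP : P.Regular) {x : Vec d} (hx : x ∈ P.dom) (e : Vec ℓ) :
    P.noiseOf (x, P.response x e) = e := by
  simp only [noiseOf, recoverNoise, response, add_sub_cancel_left]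
  rw [← op_mul_apply]
  have : (rowMat fun j => P.q j x)⁻¹ * P.Q x = 1 := Matrix.nonsing_inv_mul _ (hP.isUnit_det_Q hx)
  rw [this, op_one_apply]

lemma Regular.op_Q_noiseOf (hP : P.Regular) {w : Vec d × Vec ℓ} (hw : w.1 ∈ P.dom) :
    op (P.Q w.1) (P.noiseOf w) = w.2 - P.c w.1 := by
  simp only [noiseOf, recoverNoise]
  rw [← op_mul_apply]
  have : P.Q w.1 * (rowMat fun j => P.q j w.1)⁻¹ = 1 :=
    Matrix.mul_nonsing_inv _ (hP.isUnit_det_Q hw)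
  rw [this, op_one_apply]

lemma Regular.continuousOn_Q (hP : P.Regular) : ContinuousOn P.Q P.dom :=
  continuous_rowMat.comp_continuousOn (continuousOn_pi.2 fun j => hP.continuousOn_q j)

/-- Cramer's rule: the determinant does not vanish on `P.dom`. -/
lemma Regular.continuousOn_inv_Q (hP : P.Regular) : ContinuousOn (fun x => (P.Q x)⁻¹) P.dom := by
  simp only [Matrix.inv_def, Ring.inverse_eq_inv']
  have h1 : ContinuousOn (fun x => (P.Q x).det) P.dom :=
    (continuous_id.matrix_det).comp_continuousOn hP.continuousOn_Q
  have h2 : ContinuousOn (fun x => (P.Q x).adjugate) P.dom :=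
    (continuous_id.matrix_adjugate).comp_continuousOn hP.continuousOn_Q
  exact (h1.inv₀ fun x hx => (hP.isUnit_det_Q hx).ne_zero).smul h2

lemma Regular.continuousOn_response (hP : P.Regular) :
    ContinuousOn (fun p : Vec d × Vec ℓ => P.response p.1 p.2) (P.feas ×ˢ Set.univ) := by
  have hmaps : Set.MapsTo (Prod.fst : Vec d × Vec ℓ → Vec d) (P.feas ×ˢ Set.univ) P.dom :=
    fun p hp => hP.feas_subset hp.1
  have h1 := hP.continuousOn_c.comp continuousOn_fst hmaps
  have h2 := (continuous_op.comp_continuousOn hP.continuousOn_Q).comp continuousOn_fst hmaps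
  exact h1.add (h2.clm_apply continuousOn_snd)

lemma Regular.continuousOn_noiseOf (hP : P.Regular) :
    ContinuousOn P.noiseOf (P.feas ×ˢ Set.univ) := by
  have hmaps : Set.MapsTo (Prod.fst : Vec d × Vec ℓ → Vec d) (P.feas ×ˢ Set.univ) P.dom :=
    fun p hp => hP.feas_subset hp.1
  have h1 := hP.continuousOn_c.comp continuousOn_fst hmaps
  have h2 := (continuous_op.comp_continuousOn hP.continuousOn_inv_Q).comp continuousOn_fst hmaps
  exact h2.clm_apply (continuousOn_snd.sub h1)

open Classical in
variable (P) in
/-- A measurable version of the map `(x, e) ↦ (x, ξ(x))`. -/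
def pairMap (p : Vec d × Vec ℓ) : Vec d × Vec ℓ :=
  (p.1, (P.feas ×ˢ Set.univ).piecewise (fun p : Vec d × Vec ℓ => P.response p.1 p.2) (fun _ => 0) p)

open Classical in
variable (P) in
/-- A measurable version of `noiseOf`. -/
def noiseMap : Vec d × Vec ℓ → Vec ℓ :=
  (P.feas ×ˢ Set.univ).piecewise P.noiseOf (fun _ => 0)

lemma Regular.measurable_pairMap (hP : P.Regular) : Measurable P.pairMap := by
  classical
  exact measurable_fst.prodMk (hP.continuousOn_response.measurable_piecewise continuousOn_const
    (hP.measurableSet_feas.prod MeasurableSet.univ))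

lemma Regular.measurable_noiseMap (hP : P.Regular) : Measurable P.noiseMap := by
  classical
  exact hP.continuousOn_noiseOf.measurable_piecewise continuousOn_const
    (hP.measurableSet_feas.prod MeasurableSet.univ)

lemma pairMap_of_mem {p : Vec d × Vec ℓ} (hp : p.1 ∈ P.feas) :
    P.pairMap p = (p.1, P.response p.1 p.2) := by
  classical
  unfold pairMap
  rw [Set.piecewise_eq_of_mem _ _ _ (show p ∈ P.feas ×ˢ Set.univ from ⟨hp, trivial⟩)]

lemma noiseMap_of_mem {w : Vec d × Vec ℓ} (hw : w.1 ∈ P.feas) : P.noiseMap w = P.noiseOf w := by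
  classical
  unfold noiseMap
  rw [Set.piecewise_eq_of_mem _ _ _ (show w ∈ P.feas ×ˢ Set.univ from ⟨hw, trivial⟩)]

lemma ae_fst_mem {ν : Measure (Vec d)} (hν : ∀ᵐ x ∂ν, x ∈ P.feas) :
    ∀ᵐ p ∂(ν.prod P.noise), p.1 ∈ P.feas := Measure.quasiMeasurePreserving_fst.ae hν

/-- `P.response` is regular only over `P.dom`, while `Measure.map` of a map that is not a.e.
measurable is zero by convention. The a.e. equal measurable version `P.pairMap` gives access to the
pushforward. -/
lemma pairLaw_eq_map {ν : Measure (Vec d)} (hν : ∀ᵐ x ∂ν, x ∈ P.feas) :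
    P.pairLaw ν = (ν.prod P.noise).map P.pairMap :=
  Measure.map_congr ((ae_fst_mem hν).mono fun _ hp => (pairMap_of_mem hp).symm)

lemma Regular.isProbabilityMeasure_pairLaw (hP : P.Regular) {ν : Measure (Vec d)}
    [IsProbabilityMeasure ν] (hν : ∀ᵐ x ∂ν, x ∈ P.feas) : IsProbabilityMeasure (P.pairLaw ν) := by
  have := hP.prob_noise
  rw [pairLaw_eq_map hν]
  exact Measure.isProbabilityMeasure_map hP.measurable_pairMap.aemeasurable

lemma Regular.ae_pairLaw (hP : P.Regular) {ν : Measure (Vec d)}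
    (hν : ∀ᵐ x ∂ν, x ∈ P.feas) {p : Vec d × Vec ℓ → Prop}
    (hp : MeasurableSet {w | p w})
    (h : ∀ᵐ y ∂(ν.prod P.noise), y.1 ∈ P.feas → p (y.1, P.response y.1 y.2)) :
    ∀ᵐ w ∂(P.pairLaw ν), p w := by
  rw [pairLaw_eq_map hν, ae_map_iff hP.measurable_pairMap.aemeasurable hp]
  filter_upwards [ae_fst_mem hν, h] with y h1 h2
  rw [pairMap_of_mem h1]
  exact h2 h1

lemma Regular.ae_pairLaw_fst (hP : P.Regular) {ν : Measure (Vec d)}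
    (hν : ∀ᵐ x ∂ν, x ∈ P.feas) : ∀ᵐ w ∂(P.pairLaw ν), w.1 ∈ P.feas :=
  hP.ae_pairLaw hν (measurable_fst hP.measurableSet_feas) (Filter.Eventually.of_forall fun _ h => h)

/-- The noise realized in a simulated pair has the law of the noise. -/
lemma Regular.measurePreserving_noiseMap (hP : P.Regular) {ν : Measure (Vec d)}
    [IsProbabilityMeasure ν] (hν : ∀ᵐ x ∂ν, x ∈ P.feas) :
    MeasurePreserving P.noiseMap (P.pairLaw ν) P.noise := by
  have := hP.prob_noise
  refine ⟨hP.measurable_noiseMap, ?_⟩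
  rw [pairLaw_eq_map hν, Measure.map_map hP.measurable_noiseMap hP.measurable_pairMap]
  have h : P.noiseMap ∘ P.pairMap =ᵐ[ν.prod P.noise] Prod.snd := by
    filter_upwards [ae_fst_mem hν] with p hp
    rw [Function.comp_apply, pairMap_of_mem hp, noiseMap_of_mem (by exact hp),
      hP.noiseOf_response (hP.feas_subset hp)]
  rw [Measure.map_congr h]
  exact measurePreserving_snd.map_eq

lemma Regular.measurePreserving_pi_noiseMap (hP : P.Regular) {ν : Measure (Vec d)}
    [IsProbabilityMeasure ν] (hν : ∀ᵐ x ∂ν, x ∈ P.feas) (m : ℕ) :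
    MeasurePreserving (fun (W : Fin m → Vec d × Vec ℓ) i => P.noiseMap (W i))
      (Measure.pi fun _ => P.pairLaw ν) (Measure.pi fun _ => P.noise) := by
  have := hP.prob_noise
  exact measurePreserving_pi (fun _ : Fin m => P.pairLaw ν) (fun _ : Fin m => P.noise)
    (fun _ => hP.measurePreserving_noiseMap hν)

lemma Regular.ae_pi_pairLaw_fst (hP : P.Regular) {ν : Measure (Vec d)}
    [IsProbabilityMeasure ν] (hν : ∀ᵐ x ∂ν, x ∈ P.feas) (m : ℕ) :
    ∀ᵐ W ∂(Measure.pi fun _ : Fin m => P.pairLaw ν), ∀ i, (W i).1 ∈ P.feas := by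
  have := hP.isProbabilityMeasure_pairLaw hν
  exact ae_all_iff.2 fun i => (measurePreserving_eval
    (fun _ : Fin m => P.pairLaw ν) i).quasiMeasurePreserving.ae (hP.ae_pairLaw_fst hν)

lemma Regular.measurable_pairLaw_comp (hP : P.Regular) {A : Type*} [MeasurableSpace A]
    {k : A → Measure (Vec d)} (hk : Measurable k) [∀ a, IsProbabilityMeasure (k a)]
    (hkf : ∀ a, ∀ᵐ x ∂(k a), x ∈ P.feas) : Measurable fun a => P.pairLaw (k a) := by
  have := hP.prob_noise
  have h : (fun a => P.pairLaw (k a)) = fun a => ((k a).prod P.noise).map P.pairMap := by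
    ext1 a
    exact pairLaw_eq_map (hkf a)
  rw [h]
  exact (Measure.measurable_map _ hP.measurable_pairMap).comp
    (measurable_prod_measure (k' := fun _ => P.noise) hk measurable_const)

variable {O : SimOracle d}

lemma Regular.isProbabilityMeasure_dataLaw (hP : P.Regular) (hO : O.Valid P.feas) (n : ℕ) {z : Vec d}
    (hz : z ∈ P.feas) : IsProbabilityMeasure (P.dataLaw O n z) := by
  have := hO.isProbabilityMeasure_designLaw n z
  have := hP.isProbabilityMeasure_pairLaw (hO.ae_designLaw n hz)
  unfold dataLaw
  infer_instance

lemma Regular.isProbabilityMeasure_residual (hP : P.Regular) (hO : O.Valid P.feas) {z : Vec d}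
    (hz : z ∈ P.feas) : IsProbabilityMeasure (P.pairLaw (O.residualLaw z)) := by
  have := hO.isProbabilityMeasure_residualLaw z
  exact hP.isProbabilityMeasure_pairLaw (hO.ae_residualLaw hP.measurableSet_feas hz)

/-- The law of the samples of one iteration, as a kernel on the feasible set. -/
lemma Regular.exists_batchKernel (hP : P.Regular) (hO : O.Valid P.feas) (n m : ℕ) :
    ∃ κ : Kernel P.feas ((Fin n → Vec d × Vec ℓ) × (Fin m → Vec d × Vec ℓ)),
      IsMarkovKernel κ ∧ ∀ z : P.feas, κ z = P.batchLaw O n m z := by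
  -- The kernel lives on the subtype because the adaptive design law is known to charge only the
  -- feasible set when `z` is feasible.
  have h1 : ∀ z : P.feas, IsProbabilityMeasure (O.designLaw n z) := fun z =>
    hO.isProbabilityMeasure_designLaw n z
  have h2 : ∀ z : P.feas, IsProbabilityMeasure (O.residualLaw z) := fun z =>
    hO.isProbabilityMeasure_residualLaw z
  have h3 : ∀ z : P.feas, IsProbabilityMeasure (P.pairLaw (O.designLaw n z)) := fun z =>
    hP.isProbabilityMeasure_pairLaw (hO.ae_designLaw n z.2)
  have h4 : ∀ z : P.feas, IsProbabilityMeasure (P.pairLaw (O.residualLaw z)) := fun z =>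
    hP.isProbabilityMeasure_residual hO z.2
  have h5 : ∀ z : P.feas, IsProbabilityMeasure (P.dataLaw O n z) := fun z =>
    hP.isProbabilityMeasure_dataLaw hO n z.2
  have hm1 : Measurable fun z : P.feas => P.dataLaw O n z :=
    measurable_pi_iid (hP.measurable_pairLaw_comp (k := fun z : P.feas => O.designLaw n z)
      ((SimOracle.measurable_designLaw n).comp measurable_subtype_coe)
      fun z => hO.ae_designLaw n z.2) n
  have hm2 : Measurable fun z : P.feas => Measure.pi fun _ : Fin m => P.pairLaw (O.residualLaw z) :=
    measurable_pi_iid (hP.measurable_pairLaw_comp (k := fun z : P.feas => O.residualLaw z)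
      (SimOracle.measurable_residualLaw.comp measurable_subtype_coe)
      fun z => hO.ae_residualLaw hP.measurableSet_feas z.2) m
  refine ⟨⟨fun z => P.batchLaw O n m z, measurable_prod_measure hm1 hm2⟩, ⟨fun z => ?_⟩, fun z => rfl⟩
  change IsProbabilityMeasure (P.batchLaw O n m z)
  unfold batchLaw
  infer_instance

end Problem

/-! ### ### Surrogates along the data and the one-step estimate -/

section Surrogates

variable {n m : ℕ}

lemma sum_add_const_div {m : ℕ} (hm : 0 < m) (a : Fin m → ℝ) (q : ℝ) :
    (∑ i, (a i + q)) / m = (∑ i, a i) / m + q := by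
  have hm' : (0 : ℝ) < m := Nat.cast_pos.2 hm
  rw [Finset.sum_add_distrib, Finset.sum_const, Finset.card_univ, Fintype.card_fin, nsmul_eq_mul]
  field_simp

/-- Cramer's rule again; singular matrices are covered, since both sides vanish there by convention.
-/
lemma measurable_op_inv : Measurable fun q : Fin ℓ → Vec ℓ => op (rowMat q)⁻¹ := by
  have h : (fun q : Fin ℓ → Vec ℓ => op (rowMat q)⁻¹)
      = fun q => (rowMat q).det⁻¹ • op (rowMat q).adjugate := by
    ext1 q
    rw [Matrix.inv_def, Ring.inverse_eq_inv']
    simp [op]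
  rw [h]
  have h1 : Measurable fun q : Fin ℓ → Vec ℓ => (rowMat q).det :=
    (continuous_rowMat.matrix_det).measurable
  have h2 : Measurable fun q : Fin ℓ → Vec ℓ => op (rowMat q).adjugate :=
    (continuous_op.comp continuous_rowMat.matrix_adjugate).measurable
  exact h1.inv.smul h2

namespace Estimators

variable (est : Estimators d ℓ)

/-- The empirical residual of the pair `w`. -/
def residual (S : Fin n → Vec d × Vec ℓ) (w : Vec d × Vec ℓ) : Vec ℓ :=
  recoverNoise (est.c n S w.1) (fun j => est.q j n S w.1) w.2

/-- The linearized response at `z` built from the estimators. -/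
def resp (S : Fin n → Vec d × Vec ℓ) (z : Vec d) (e : Vec ℓ) (x : Vec d) : Vec ℓ :=
  linResp (est.c n S z) (est.Dc n S z) (fun j => est.q j n S z) (fun j => est.Dq j n S z) z e x

variable {est}

lemma batchSurrogate_eq (hm : 0 < m) (φ : Vec d → Vec ℓ → ℝ) (S : Fin n → Vec d × Vec ℓ)
    (W : Fin m → Vec d × Vec ℓ) (α : ℝ) (z x : Vec d) :
    est.batchSurrogate φ S W α z x
      = (∑ i, φ x (est.resp S z (est.residual S (W i)) x)) / m + α / 2 * ‖x - z‖ ^ 2 := by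
  rw [← sum_add_const_div hm]
  rfl

lemma measurable_residual : Measurable fun p : (Fin n → Vec d × Vec ℓ) × (Vec d × Vec ℓ) =>
    est.residual p.1 p.2 := by
  unfold residual recoverNoise
  have h0 : Measurable fun p : (Fin n → Vec d × Vec ℓ) × (Vec d × Vec ℓ) => (p.1, p.2.1) := by
    fun_prop
  have hc := (est.measurable_c n).comp h0
  have hq : Measurable fun p : (Fin n → Vec d × Vec ℓ) × (Vec d × Vec ℓ) =>
      fun j => est.q j n p.1 p.2.1 :=
    measurable_pi_lambda _ fun j => (est.measurable_q j n).comp h0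
  exact measurable_clm_apply (measurable_op_inv.comp hq) ((measurable_snd.comp measurable_snd).sub hc)

end Estimators

namespace Problem

variable {P : Problem d ℓ}

lemma batchSurrogate_eq (hm : 0 < m) (W : Fin m → Vec d × Vec ℓ) (α : ℝ) (z x : Vec d) :
    P.batchSurrogate W α z x = P.regAvg α z (fun i => P.noiseOf (W i)) x := by
  unfold regAvg avgCost
  rw [← sum_add_const_div hm]
  rfl

variable {est : Estimators d ℓ}

lemma Regular.continuousOn_est_batchSurrogate (hP : P.Regular) (hm : 0 < m)
    (S : Fin n → Vec d × Vec ℓ) (W : Fin m → Vec d × Vec ℓ) (α : ℝ) (z : Vec d) :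
    ContinuousOn (est.batchSurrogate P.φ S W α z) P.dom := by
  have h : est.batchSurrogate P.φ S W α z = fun x =>
      (∑ i, P.φ x (est.resp S z (est.residual S (W i)) x)) / m + α / 2 * ‖x - z‖ ^ 2 :=
    funext fun x => Estimators.batchSurrogate_eq hm P.φ S W α z x
  rw [h]
  exact ((continuousOn_finsetSum _ fun i _ => hP.continuousOn_cost_linResp _ _ _ _ z _).div_const
    _).add (by fun_prop)

/-- The next iterate is a minimizer of the learning-based surrogate, with quadratic growth. -/
lemma Regular.est_argmin_growth (hP : P.Regular) (hm : 0 < m)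
    (S : Fin n → Vec d × Vec ℓ) (W : Fin m → Vec d × Vec ℓ) (α : ℝ) {z y : Vec d} (hy : y ∈ P.feas) :
    argminOn P.feas (est.batchSurrogate P.φ S W α z) ∈ P.feas ∧
    est.batchSurrogate P.φ S W α z (argminOn P.feas (est.batchSurrogate P.φ S W α z))
      + α / 2 * ‖y - argminOn P.feas (est.batchSurrogate P.φ S W α z)‖ ^ 2
      ≤ est.batchSurrogate P.φ S W α z y := by
  have hs := argminOn_spec hP.isCompact_feas ⟨y, hy⟩
    ((hP.continuousOn_est_batchSurrogate (est := est) hm S W α z).mono hP.feas_subset)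
  refine ⟨hs.1, ?_⟩
  have hconv : ConvexOn ℝ P.feas fun x =>
      (∑ i, P.φ x (est.resp S z (est.residual S (W i)) x)) / m :=
    convexOn_sum_div hP.convex_feas _ (fun i _ =>
      (hP.convexOn_cost_linResp _ _ _ _ z _).subset hP.feas_subset hP.convex_feas)
      (Nat.cast_nonneg m)
  have hmin := hs.2
  generalize argminOn P.feas (est.batchSurrogate P.φ S W α z) = x at hs hmin ⊢
  have := quadratic_growth (a := α) (z := z) hconv hs.1 hy (by
    intro u hu
    have h := hmin hu
    simp only [Set.mem_ofPred_eq, Estimators.batchSurrogate_eq hm] at h ⊢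
    exact h)
  rw [Estimators.batchSurrogate_eq hm, Estimators.batchSurrogate_eq hm]
  exact this

lemma Regular.measurable_est_batchSurrogate (hP : P.Regular) (hm : 0 < m) (α : ℝ) {x : Vec d}
    (hx : x ∈ P.dom) :
    Measurable fun p : P.feas × ((Fin n → Vec d × Vec ℓ) × (Fin m → Vec d × Vec ℓ)) =>
      est.batchSurrogate P.φ p.2.1 p.2.2 α p.1 x := by
  have hv : Measurable fun p : P.feas × ((Fin n → Vec d × Vec ℓ) × (Fin m → Vec d × Vec ℓ)) =>
      (p.1 : Vec d) := measurable_subtype_coe.comp measurable_fst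
  have hterm : ∀ i : Fin m,
      Measurable fun p : P.feas × ((Fin n → Vec d × Vec ℓ) × (Fin m → Vec d × Vec ℓ)) =>
        P.φ x (est.resp p.2.1 p.1 (est.residual p.2.1 (p.2.2 i)) x) := by
    intro i
    have h0 : Measurable fun p : P.feas × ((Fin n → Vec d × Vec ℓ) × (Fin m → Vec d × Vec ℓ)) =>
        (p.2.1, (p.1 : Vec d)) := measurable_snd.fst.prodMk hv
    have h1 : Measurable fun p : P.feas × ((Fin n → Vec d × Vec ℓ) × (Fin m → Vec d × Vec ℓ)) =>
        (p.2.1, p.2.2 i) :=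
      measurable_snd.fst.prodMk ((measurable_pi_apply i).comp measurable_snd.snd)
    have h2 := (est.measurable_c n).comp h0
    have h3 := (est.measurable_Dc n).comp h0
    have h4 := fun j => (est.measurable_q j n).comp h0
    have h5 := fun j => (est.measurable_Dq j n).comp h0
    have h6 := (Estimators.measurable_residual (est := est)).comp h1
    have h7 := measurable_linResp (x := x) h2 h3 h4 h5 hv h6
    exact (hP.continuous_cost_right hx).measurable.comp h7
  simp only [Estimators.batchSurrogate_eq hm]
  refine Measurable.add ?_ (by fun_prop)
  exact (Finset.measurable_sum _ fun i _ => hterm i).div_const _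

lemma Regular.measurable_regAvg (hP : P.Regular) (α : ℝ) {x : Vec d} (hx : x ∈ P.dom) :
    Measurable fun p : P.feas × (Fin m → Vec ℓ) => P.regAvg α p.1 p.2 x := by
  have hv : Measurable fun p : P.feas × (Fin m → Vec ℓ) => (p.1 : Vec d) :=
    measurable_subtype_coe.comp measurable_fst
  refine ((Finset.measurable_sum _ fun i _ => ?_).div_const _).add (by fun_prop)
  have hc : Measurable fun z : P.feas => P.c z :=
    ((hP.continuousOn_c.mono hP.feas_subset).domRestrict).measurable
  have hq : ∀ j, Measurable fun z : P.feas => P.q j z := fun j =>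
    (((hP.continuousOn_q j).mono hP.feas_subset).domRestrict).measurable
  exact (hP.continuous_cost_right hx).measurable.comp (measurable_linResp (hc.comp measurable_fst)
    ((measurable_fderiv ℝ P.c).comp hv) (fun j => (hq j).comp measurable_fst)
    (fun j => (measurable_fderiv ℝ (P.q j)).comp hv) hv
    ((measurable_pi_apply i).comp measurable_snd))

/-- Continuity in the evaluation point upgrades measurability at fixed points to joint
measurability, after which the proximal point can be inserted. -/
lemma Regular.measurable_regAvg_prox (hP : P.Regular) (hne : P.feas.Nonempty) (α : ℝ) {ρ : ℝ}
    (hρ : P.τ < ρ) :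
    Measurable fun p : P.feas × (Fin m → Vec ℓ) =>
      P.regAvg α p.1 p.2 (prox P.feas P.f (1 / ρ) p.1) := by
  have hu : Measurable fun q : P.feas × (P.feas × (Fin m → Vec ℓ)) => P.regAvg α q.2.1 q.2.2 q.1 :=
    measurable_uncurry_of_continuous_of_measurable
      (u := fun (x : P.feas) (p : P.feas × (Fin m → Vec ℓ)) => P.regAvg α p.1 p.2 x)
      (fun p => ((hP.continuousOn_regAvg α p.1 p.2).mono hP.feas_subset).domRestrict)
      (fun x => hP.measurable_regAvg α (hP.feas_subset x.2))
  have hpx : Measurable fun p : P.feas × (Fin m → Vec ℓ) =>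
      (⟨prox P.feas P.f (1 / ρ) p.1, (hP.prox_spec hne p.1).1⟩ : P.feas) :=
    ((hP.measurable_prox hne hρ).comp (measurable_subtype_coe.comp measurable_fst)).subtype_mk
  exact hu.comp (hpx.prodMk measurable_id)

variable (P) in
/-- The noises realized in a sample of pairs. -/
def batchNoise (W : Fin m → Vec d × Vec ℓ) : Fin m → Vec ℓ := fun i => P.noiseMap (W i)

lemma Regular.measurable_batchNoise (hP : P.Regular) :
    Measurable (P.batchNoise : (Fin m → Vec d × Vec ℓ) → Fin m → Vec ℓ) :=
  measurable_pi_lambda _ fun i => hP.measurable_noiseMap.comp (measurable_pi_apply i)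

variable (P est) in
/-- The largest error of the learning-based surrogate along a dense sequence. -/
def errSup [Nonempty P.feas] (α : ℝ)
    (p : P.feas × ((Fin n → Vec d × Vec ℓ) × (Fin m → Vec d × Vec ℓ))) : ENNReal :=
  ⨆ i : ℕ, ENNReal.ofReal |est.batchSurrogate P.φ p.2.1 p.2.2 α p.1
      (TopologicalSpace.denseSeq P.feas i)
    - P.regAvg α p.1 (P.batchNoise p.2.2) (TopologicalSpace.denseSeq P.feas i)|

variable (P) in
/-- The largest decrease of the sampled surrogate from the proximal point along a dense sequence. -/
def gapSup [Nonempty P.feas] (α ρ : ℝ) (p : P.feas × (Fin m → Vec ℓ)) : ENNReal :=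
  ⨆ i : ℕ, ENNReal.ofReal (P.regAvg α p.1 p.2 (prox P.feas P.f (1 / ρ) p.1)
    - P.regAvg α p.1 p.2 (TopologicalSpace.denseSeq P.feas i))

lemma Regular.measurable_errSup (hP : P.Regular) [Nonempty P.feas] (hm : 0 < m) (α : ℝ) :
    Measurable (P.errSup est α (n := n) (m := m)) := by
  have hNp : Measurable fun p : P.feas × ((Fin n → Vec d × Vec ℓ) × (Fin m → Vec d × Vec ℓ)) =>
      (p.1, P.batchNoise p.2.2) :=
    measurable_fst.prodMk (hP.measurable_batchNoise.comp measurable_snd.snd)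
  refine Measurable.iSup fun i => ?_
  have hx := hP.feas_subset (TopologicalSpace.denseSeq P.feas i).2
  have h1 := hP.measurable_est_batchSurrogate (est := est) (n := n) hm α hx
  have h2 := (hP.measurable_regAvg α hx).comp hNp
  exact (h1.sub h2).abs.ennreal_ofReal

lemma Regular.measurable_gapSup (hP : P.Regular) [Nonempty P.feas] (α : ℝ) {ρ : ℝ}
    (hρ : P.τ < ρ) : Measurable (P.gapSup α ρ (m := m)) := by
  have hne : P.feas.Nonempty := Set.nonempty_coe_sort.1 ‹_›
  refine Measurable.iSup fun i => ?_
  have h1 := hP.measurable_regAvg_prox (m := m) hne α hρ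
  have h2 := hP.measurable_regAvg (m := m) α
    (hP.feas_subset (TopologicalSpace.denseSeq P.feas i).2)
  exact (h1.sub h2).ennreal_ofReal

variable {O : SimOracle d}

/-- Expected squared distance of the next iterate from the proximal point. -/
lemma Regular.integral_step_le (hP : P.Regular) (hO : O.Valid P.feas) {r K : ℝ}
    (hK : P.IsEstConst O est r K) (hn : 0 < n) (hm : 0 < m) {α ρ : ℝ} (hα : 0 < α)
    (hρ : P.τ < ρ) (hαρ : ρ + P.τ ≤ α) {Ω : Type*} {𝒢 mΩ : MeasurableSpace Ω} {μ : Measure Ω}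
    [IsProbabilityMeasure μ] (h𝒢 : 𝒢 ≤ mΩ) {Z : Ω → P.feas} (hZ : Measurable[𝒢] Z)
    {S : Ω → Fin n → Vec d × Vec ℓ} {W : Ω → Fin m → Vec d × Vec ℓ}
    (hS : Measurable S) (hW : Measurable W)
    (hlaw : ∀ G : Set Ω, MeasurableSet[𝒢] G →
      ∀ D : Set ((Fin n → Vec d × Vec ℓ) × (Fin m → Vec d × Vec ℓ)), MeasurableSet D →
        μ (G ∩ (fun ω => (S ω, W ω)) ⁻¹' D) = ∫⁻ ω in G, P.batchLaw O n m (Z ω) D ∂μ)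
    {z' : Ω → Vec d} (hz' : Measurable z')
    (hstep : ∀ ω, z' ω = argminOn P.feas (est.batchSurrogate P.φ (S ω) (W ω) α (Z ω))) :
    α / 2 * ∫ ω, ‖prox P.feas P.f (1 / ρ) (Z ω) - z' ω‖ ^ 2 ∂μ
      ≤ 2 * (K * (n : ℝ) ^ (-r / 2)) + 2 * P.L ^ 2 / (m * α)
        + (P.τ + α - ρ) / 2 * ∫ ω, ‖prox P.feas P.f (1 / ρ) (Z ω) - Z ω‖ ^ 2 ∂μ := by
  obtain ⟨ω₀⟩ : Nonempty Ω := μ.nonempty_of_neZero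
  have hne : P.feas.Nonempty := ⟨Z ω₀, (Z ω₀).2⟩
  have : Nonempty P.feas := hne.to_subtype
  have hm' : (0 : ℝ) < m := Nat.cast_pos.2 hm
  have hZ' : Measurable Z := hZ.mono h𝒢 le_rfl
  have hb : Measurable fun ω => (S ω, W ω) := hS.prodMk hW
  obtain ⟨κ, hκ, hκeq⟩ := hP.exists_batchKernel hO n m
  have hlaw' : ∀ G : Set Ω, MeasurableSet[𝒢] G →
      ∀ D : Set ((Fin n → Vec d × Vec ℓ) × (Fin m → Vec d × Vec ℓ)), MeasurableSet D →
        μ (G ∩ (fun ω => (S ω, W ω)) ⁻¹' D) = ∫⁻ ω in G, κ (Z ω) D ∂μ := by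
    intro G hG D hD
    simp only [hκeq]
    exact hlaw G hG D hD
  let pr : Vec d → Vec d := prox P.feas P.f (1 / ρ)
  have hpr : Measurable pr := hP.measurable_prox hne hρ
  have hprf : ∀ z, pr z ∈ P.feas := fun z => (hP.prox_spec hne z).1
  have hk1 := hP.measurable_errSup (est := est) (n := n) hm α
  have hk2 := hP.measurable_gapSup (m := m) α hρ
  -- Quadratic growth of the learned surrogate at `z'`, compared with the proximal point. Passing to
  -- the sampled surrogate costs one estimation error at each of the two points, whence the factor
  -- `2`. By continuity, suprema along a dense sequence dominate these values and, being countable,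
  -- are measurable.
  have hpoint : ∀ ω, ENNReal.ofReal (α / 2 * ‖pr (Z ω) - z' ω‖ ^ 2)
      ≤ 2 * P.errSup est α (Z ω, (S ω, W ω)) + P.gapSup α ρ (Z ω, P.batchNoise (W ω)) := by
    intro ω
    have hg := hP.est_argmin_growth (est := est) hm (S ω) (W ω) α (z := Z ω) (hprf (Z ω))
    rw [← hstep ω] at hg
    have hc1 : ContinuousOn (fun x => |est.batchSurrogate P.φ (S ω) (W ω) α (Z ω) x
        - P.regAvg α (Z ω) (P.batchNoise (W ω)) x|) P.feas :=
      (((hP.continuousOn_est_batchSurrogate hm _ _ _ _).sub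
        (hP.continuousOn_regAvg _ _ _)).abs).mono hP.feas_subset
    have hc2 : ContinuousOn (fun x => P.regAvg α (Z ω) (P.batchNoise (W ω)) (pr (Z ω))
        - P.regAvg α (Z ω) (P.batchNoise (W ω)) x) P.feas :=
      (continuousOn_const.sub (hP.continuousOn_regAvg _ _ _)).mono hP.feas_subset
    have e1 : ENNReal.ofReal |est.batchSurrogate P.φ (S ω) (W ω) α (Z ω) (pr (Z ω))
        - P.regAvg α (Z ω) (P.batchNoise (W ω)) (pr (Z ω))| ≤ P.errSup est α (Z ω, (S ω, W ω)) :=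
      le_iSup_denseSeq hc1 (hprf (Z ω))
    have e2 : ENNReal.ofReal |est.batchSurrogate P.φ (S ω) (W ω) α (Z ω) (z' ω)
        - P.regAvg α (Z ω) (P.batchNoise (W ω)) (z' ω)| ≤ P.errSup est α (Z ω, (S ω, W ω)) :=
      le_iSup_denseSeq hc1 hg.1
    have e3 : ENNReal.ofReal (P.regAvg α (Z ω) (P.batchNoise (W ω)) (pr (Z ω))
        - P.regAvg α (Z ω) (P.batchNoise (W ω)) (z' ω)) ≤ P.gapSup α ρ (Z ω, P.batchNoise (W ω)) :=
      le_iSup_denseSeq hc2 hg.1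
    have h1 := le_abs_self (est.batchSurrogate P.φ (S ω) (W ω) α (Z ω) (pr (Z ω))
        - P.regAvg α (Z ω) (P.batchNoise (W ω)) (pr (Z ω)))
    have h2 := neg_abs_le (est.batchSurrogate P.φ (S ω) (W ω) α (Z ω) (z' ω)
        - P.regAvg α (Z ω) (P.batchNoise (W ω)) (z' ω))
    rw [two_mul]
    refine le_trans ?_ (add_le_add (add_le_add e1 e2) e3)
    refine (ENNReal.ofReal_le_ofReal ?_).trans
      (ENNReal.ofReal_add_le.trans (add_le_add ENNReal.ofReal_add_le le_rfl))
    linarith [hg.2]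
  -- The supremum along the dense sequence is at most the one in `IsEstConst`. Residual points are
  -- a.s. feasible, so the measurable version of the noise agrees with the recovered one.
  have hint1 : ∀ z : P.feas, ∫⁻ b, P.errSup est α (z, b) ∂(κ z) ≤ ENNReal.ofReal (K * (n : ℝ) ^ (-r / 2)) := by
    intro z
    rw [hκeq]
    refine le_trans (lintegral_mono_ae ?_) (hK.2 n m hn hm α hα z z.2)
    have := hO.isProbabilityMeasure_residualLaw z
    have := hP.isProbabilityMeasure_residual hO z.2
    have hae := hP.ae_pi_pairLaw_fst (hO.ae_residualLaw hP.measurableSet_feas z.2) m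
    have hae' : ∀ᵐ b ∂(P.batchLaw O n m z), ∀ i, (b.2 i).1 ∈ P.feas :=
      Measure.quasiMeasurePreserving_snd.ae hae
    filter_upwards [hae'] with b hbf
    refine iSup_le fun i => ?_
    have hNb : P.batchNoise b.2 = fun i => P.noiseOf (b.2 i) := funext fun i => noiseMap_of_mem (hbf i)
    refine le_trans (le_of_eq ?_) (le_iSup₂ (f := fun (x : Vec d) (_ : x ∈ P.feas) =>
      ENNReal.ofReal |est.batchSurrogate P.φ b.1 b.2 α z x - P.batchSurrogate b.2 α z x|)
      (TopologicalSpace.denseSeq P.feas i : Vec d)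
      (TopologicalSpace.denseSeq P.feas i).2)
    rw [batchSurrogate_eq hm, hNb]
  -- The realized noises are i.i.d. with law `P.noise`, and the sampled minimizer bounds the
  -- surrogate from below at every point of the dense sequence.
  have hint2 : ∀ z : P.feas, ∫⁻ b, P.gapSup α ρ (z, P.batchNoise b.2) ∂(κ z)
      ≤ ENNReal.ofReal ((P.τ + α - ρ) / 2 * ‖pr z - z‖ ^ 2 + 2 * P.L ^ 2 / (m * α)) := by
    intro z
    rw [hκeq]
    have := hP.prob_noise
    have := hO.isProbabilityMeasure_residualLaw z
    have := hP.isProbabilityMeasure_residual hO z.2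
    have := hP.isProbabilityMeasure_dataLaw hO n z.2
    have hmp : MeasurePreserving (fun b : (Fin n → Vec d × Vec ℓ) × (Fin m → Vec d × Vec ℓ) => P.batchNoise b.2)
        (P.batchLaw O n m z) (Measure.pi fun _ => P.noise) :=
      (hP.measurePreserving_pi_noiseMap (hO.ae_residualLaw hP.measurableSet_feas z.2) m).comp
        measurePreserving_snd
    have hk2z : Measurable fun w => P.gapSup α ρ (z, w) := hk2.comp measurable_prodMk_left
    rw [hmp.lintegral_comp hk2z]
    refine le_trans (lintegral_mono fun w => iSup_le fun i => ?_)
      (hP.lintegral_regAvg_sub_le z.2 (hprf z) hα hm hαρ (hP.prox_spec hne z).2)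
    refine ENNReal.ofReal_le_ofReal (sub_le_sub_left ?_ _)
    exact (hP.regArgmin_spec hne α z w).2 (TopologicalSpace.denseSeq P.feas i).2
  obtain ⟨R, hR0, hR⟩ := hP.exists_norm_sub_le
  have hbd : ∀ x ∈ P.feas, ∀ y ∈ P.feas, |‖x - y‖ ^ 2| ≤ R ^ 2 := fun x hx y hy => by
    rw [abs_of_nonneg (sq_nonneg _)]
    exact pow_le_pow_left₀ (norm_nonneg _) (hR x hx y hy) 2
  have hz'f : ∀ ω, z' ω ∈ P.feas := fun ω => by
    rw [hstep ω]
    exact (hP.est_argmin_growth (est := est) hm (S ω) (W ω) α (z := Z ω) (Z ω).2).1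
  have hZv : Measurable fun ω => (Z ω : Vec d) := measurable_subtype_coe.comp hZ'
  have hi1 : Integrable (fun ω => α / 2 * ‖pr (Z ω) - z' ω‖ ^ 2) μ :=
    (integrable_of_norm_le (((hpr.comp hZv).sub hz').norm.pow_const 2)
      fun ω => hbd _ (hprf _) _ (hz'f ω)).const_mul _
  have hi2 : Integrable (fun ω => (P.τ + α - ρ) / 2 * ‖pr (Z ω) - Z ω‖ ^ 2) μ :=
    (integrable_of_norm_le (((hpr.comp hZv).sub hZv).norm.pow_const 2)
      fun ω => hbd _ (hprf _) _ (Z ω).2).const_mul _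
  have hi3 : Integrable (fun ω => (P.τ + α - ρ) / 2 * ‖pr (Z ω) - Z ω‖ ^ 2
      + 2 * P.L ^ 2 / (m * α)) μ := hi2.add (integrable_const _)
  have hτ := hP.τ_nonneg
  have hco : 0 ≤ (P.τ + α - ρ) / 2 := by linarith
  have hK0 : 0 ≤ K * (n : ℝ) ^ (-r / 2) := mul_nonneg hK.1.le (by positivity)
  have hmain : ENNReal.ofReal (∫ ω, α / 2 * ‖pr (Z ω) - z' ω‖ ^ 2 ∂μ)
      ≤ ENNReal.ofReal (2 * (K * (n : ℝ) ^ (-r / 2))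
        + ∫ ω, ((P.τ + α - ρ) / 2 * ‖pr (Z ω) - Z ω‖ ^ 2 + 2 * P.L ^ 2 / (m * α)) ∂μ) := by
    rw [ofReal_integral_eq_lintegral_ofReal hi1 (Filter.Eventually.of_forall fun ω => by
        change 0 ≤ _
        positivity),
      ENNReal.ofReal_add (by positivity) (integral_nonneg fun ω => by
        change 0 ≤ _
        positivity),
      ofReal_integral_eq_lintegral_ofReal hi3 (Filter.Eventually.of_forall fun ω => by
        change 0 ≤ _
        positivity),
      ENNReal.ofReal_mul (by norm_num), ENNReal.ofReal_ofNat]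
    calc _ ≤ ∫⁻ ω, (2 * P.errSup est α (Z ω, (S ω, W ω)) + P.gapSup α ρ (Z ω, P.batchNoise (W ω))) ∂μ := lintegral_mono hpoint
      _ = 2 * ∫⁻ ω, P.errSup est α (Z ω, (S ω, W ω)) ∂μ + ∫⁻ ω, P.gapSup α ρ (Z ω, P.batchNoise (W ω)) ∂μ := by
          have hm1 : Measurable fun ω => P.errSup est α (Z ω, (S ω, W ω)) :=
            hk1.comp (hZ'.prodMk hb)
          rw [lintegral_add_left (hm1.const_mul 2), lintegral_const_mul _ hm1]
      _ = 2 * ∫⁻ ω, ∫⁻ b, P.errSup est α (Z ω, b) ∂(κ (Z ω)) ∂μ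
          + ∫⁻ ω, ∫⁻ b, P.gapSup α ρ (Z ω, P.batchNoise b.2) ∂(κ (Z ω)) ∂μ := by
          -- Conditioning on the past freezes the reference point, so the bounds for fixed `z` apply
          -- inside the outer integral.
          refine congrArg₂ (fun a b : ENNReal => 2 * a + b) ?_ ?_
          · exact lintegral_comp_eq_of_condLaw h𝒢 hZ hb hlaw' hk1
          · exact lintegral_comp_eq_of_condLaw h𝒢 hZ hb hlaw'
              (h := fun p => P.gapSup α ρ (p.1, P.batchNoise p.2.2))
              (hk2.comp (measurable_fst.prodMk (hP.measurable_batchNoise.comp measurable_snd.snd)))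
      _ ≤ _ := by
          refine add_le_add (mul_le_mul_right ?_ _) (lintegral_mono fun ω => hint2 (Z ω))
          refine (lintegral_mono fun ω => hint1 (Z ω)).trans (le_of_eq ?_)
          simp
  have hfin := (ENNReal.ofReal_le_ofReal_iff (add_nonneg (by positivity) (integral_nonneg fun ω => by
        change 0 ≤ _
        positivity))).1 hmain
  rw [integral_add hi2 (integrable_const _), integral_const_mul, integral_const_mul] at hfin
  simp only [integral_const, probReal_univ, one_smul] at hfin
  linarith

end Problem

end Surrogates

/-! ### ### Random indices -/

/-- Averages over an independent random index that is almost surely in a finite set. -/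
lemma integral_random_index {Ω E : Type*} [MeasurableSpace Ω] [MeasurableSpace E] {μ : Measure Ω}
    [IsProbabilityMeasure μ] {I : Finset ℕ} {s : Ω → ℕ} (hs : Measurable s)
    (hsI : ∀ᵐ ω ∂μ, s ω ∈ I) {z : ℕ → Ω → E} (hz : ∀ t ∈ I, Measurable (z t))
    (hind : ∀ t ∈ I, IndepFun s (z t) μ) {ψ : ℕ → E → ℝ} (hψ : ∀ t ∈ I, Measurable (ψ t))
    (hint : ∀ t ∈ I, Integrable (fun ω => ψ t (z t ω)) μ) :
    Integrable (fun ω => ψ (s ω) (z (s ω) ω)) μ ∧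
      ∫ ω, ψ (s ω) (z (s ω) ω) ∂μ
        = ∑ t ∈ I, μ.real (s ⁻¹' {t}) * ∫ ω, ψ t (z t ω) ∂μ := by
  have hset : ∀ t, MeasurableSet (s ⁻¹' {t}) := fun t => hs (measurableSet_singleton t)
  have hae : (fun ω => ψ (s ω) (z (s ω) ω)) =ᵐ[μ]
      fun ω => ∑ t ∈ I, (s ⁻¹' {t}).indicator (fun ω => ψ t (z t ω)) ω := by
    filter_upwards [hsI] with ω hω
    rw [Finset.sum_eq_single (s ω)]
    · rw [Set.indicator_of_mem (by rfl)]
    · intro t _ ht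
      exact Set.indicator_of_notMem (fun h => ht h.symm) _
    · exact fun h => absurd hω h
  have hint' : ∀ t ∈ I, Integrable ((s ⁻¹' {t}).indicator fun ω => ψ t (z t ω)) μ := fun t ht =>
    (hint t ht).indicator (hset t)
  refine ⟨(integrable_finsetSum _ hint').congr hae.symm, ?_⟩
  rw [integral_congr_ae hae, integral_finsetSum _ hint']
  refine Finset.sum_congr rfl fun t ht => ?_
  -- The event `s = t` enters as a factor depending on `s` only, so independence splits the
  -- expectation.
  have hprod : (s ⁻¹' {t}).indicator (fun ω => ψ t (z t ω))
      = (({t} : Set ℕ).indicator (fun _ => (1 : ℝ)) ∘ s) * (ψ t ∘ z t) := by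
    ext ω
    by_cases h : s ω = t <;> simp [Set.indicator, h]
  rw [hprod, (hind t ht).integral_comp_mul_comp hs.aemeasurable (hz t ht).aemeasurable
    (measurable_from_top.aestronglyMeasurable) (hψ t ht).aestronglyMeasurable]
  congr 1
  have : (({t} : Set ℕ).indicator (fun _ => (1 : ℝ)) ∘ s)
      = (s ⁻¹' {t}).indicator fun _ => (1 : ℝ) := rfl
  rw [this, integral_indicator_const _ (hset t)]
  simp

/-! ### ### Descent of the Moreau envelope -/

namespace Problem

variable {P : Problem d ℓ} {O : SimOracle d} {est : Estimators d ℓ}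

variable (P) in
/-- The Moreau envelope of the objective. -/
def envelope (ρ : ℝ) (y : Vec d) : ℝ :=
  P.f (prox P.feas P.f (1 / ρ) y) + ρ / 2 * ‖prox P.feas P.f (1 / ρ) y - y‖ ^ 2

lemma Regular.exists_abs_f_le (hP : P.Regular) : ∃ M : ℝ, ∀ x ∈ P.feas, |P.f x| ≤ M := by
  obtain ⟨M, hM⟩ := (hP.isCompact_feas.image_of_continuousOn
    (hP.continuousOn_f.mono hP.feas_subset)).isBounded.exists_norm_le
  exact ⟨M, fun x hx => hM _ ⟨x, hx, rfl⟩⟩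

lemma Regular.integrable_f_comp (hP : P.Regular) {Ω : Type*} [MeasurableSpace Ω] {μ : Measure Ω}
    [IsProbabilityMeasure μ] {x : Ω → Vec d} (hx : Measurable x) (hxf : ∀ ω, x ω ∈ P.feas) :
    Integrable (fun ω => P.f (x ω)) μ := by
  obtain ⟨M, hM⟩ := hP.exists_abs_f_le
  have hm : Measurable fun ω => P.f (x ω) :=
    ((hP.continuousOn_f.mono hP.feas_subset).domRestrict.measurable).comp (hx.subtype_mk (h := hxf))
  exact integrable_of_norm_le hm fun ω => hM _ (hxf ω)

lemma Regular.integrable_sq_dist (hP : P.Regular) {Ω : Type*} [MeasurableSpace Ω] {μ : Measure Ω}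
    [IsProbabilityMeasure μ] {x y : Ω → Vec d} (hx : Measurable x) (hy : Measurable y)
    (hxf : ∀ ω, x ω ∈ P.feas) (hyf : ∀ ω, y ω ∈ P.feas) :
    Integrable (fun ω => ‖x ω - y ω‖ ^ 2) μ := by
  obtain ⟨R, hR0, hR⟩ := hP.exists_norm_sub_le
  refine integrable_of_norm_le (R := R ^ 2) ((hx.sub hy).norm.pow_const 2) fun ω => ?_
  rw [abs_of_nonneg (sq_nonneg _)]
  exact pow_le_pow_left₀ (norm_nonneg _) (hR _ (hxf ω) _ (hyf ω)) 2

section Run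

variable {r K : ℝ} {ρ α : ℕ → ℝ} {n m : ℕ → ℕ} {tbar T : ℕ} {Ω : Type*} [mΩ : MeasurableSpace Ω]
  {μ : Measure Ω} {ℱ : Filtration ℕ mΩ} {z0 : Vec d}
  {S : (t : ℕ) → Ω → Fin (n t) → Vec d × Vec ℓ} {W : (t : ℕ) → Ω → Fin (m t) → Vec d × Vec ℓ}
  {z : ℕ → Ω → Vec d}

lemma IsALSRun.mem_feas (hP : P.Regular) (hm : ∀ t, 0 < m t) (hz0 : z0 ∈ P.feas)
    (hrun : P.IsALSRun O est μ ℱ z0 T n m α S W z) : ∀ t ≤ T + 1, ∀ ω, z t ω ∈ P.feas := by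
  intro t ht ω
  cases t with
  | zero =>
    rw [hrun.init ω]
    exact hz0
  | succ t =>
    rw [hrun.step t (by omega) ω]
    exact (hP.est_argmin_growth (est := est) (hm t) (S t ω) (W t ω) (α t) (z := z t ω) hz0).1

lemma IsALSRun.measurable_iterate (hrun : P.IsALSRun O est μ ℱ z0 T n m α S W z) {t : ℕ}
    (ht : t ≤ T + 1) : Measurable (z t) := (hrun.measurable_z t ht).mono (ℱ.le t) le_rfl

variable [IsProbabilityMeasure μ]

/-- Expected decrease of the Moreau envelope in one iteration. -/
lemma IsALSRun.envelope_decrease (hP : P.Regular) (hO : O.Valid P.feas)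
    (hK : P.IsEstConst O est r K) (hα : ∀ t, 0 < α t) (hn : ∀ t, 0 < n t) (hm : ∀ t, 0 < m t)
    (hz0 : z0 ∈ P.feas) (hrun : P.IsALSRun O est μ ℱ z0 T n m α S W z) {t : ℕ} (htT : t ≤ T)
    (hρ : P.τ < ρ t) (hρ' : P.τ < ρ (t + 1)) (hαρ : ρ t + P.τ ≤ α t) :
    P.weight ρ α t * ∫ ω, ‖z t ω - prox P.feas P.f (1 / ρ t) (z t ω)‖ ^ 2 ∂μ
      ≤ 2 * ∫ ω, P.envelope (ρ t) (z t ω) ∂μ - 2 * ∫ ω, P.envelope (ρ (t + 1)) (z (t + 1) ω) ∂μ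
        + 4 * ρ (t + 1) * P.L ^ 2 / (m t * α t ^ 2)
        + 4 * ρ (t + 1) * K / ((n t : ℝ) ^ (r / 2) * α t) := by
  have hne : P.feas.Nonempty := ⟨z0, hz0⟩
  have hzf := hrun.mem_feas hP hm hz0 t (by omega)
  have hzf' := hrun.mem_feas hP hm hz0 (t + 1) (by omega)
  have hz := hrun.measurable_iterate (t := t) (by omega)
  have hz' := hrun.measurable_iterate (t := t + 1) (by omega)
  have hα0 := hα t
  have hm0 : (0 : ℝ) < m t := Nat.cast_pos.2 (hm t)
  have hn0 : (0 : ℝ) < n t := Nat.cast_pos.2 (hn t)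
  have hτ := hP.τ_nonneg
  have hpr := hP.measurable_prox hne hρ
  have hpr' := hP.measurable_prox hne hρ'
  have hprf : ∀ (s : ℝ) y, prox P.feas P.f (1 / s) y ∈ P.feas := fun s y =>
    (hP.prox_spec (ρ := s) hne y).1
  have hstep := hP.integral_step_le (est := est) hO hK (hn t) (hm t) hα0 hρ hαρ (ℱ.le t)
    (Z := fun ω => (⟨z t ω, hzf ω⟩ : P.feas)) ((hrun.measurable_z t (by omega)).subtype_mk)
    ((hrun.measurable_S t htT).mono (ℱ.le (t + 1)) le_rfl)
    ((hrun.measurable_W t htT).mono (ℱ.le (t + 1)) le_rfl)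
    (hrun.law t htT) hz' (hrun.step t htT)
  simp only at hstep
  have hif : Integrable (fun ω => P.f (prox P.feas P.f (1 / ρ t) (z t ω))) μ :=
    hP.integrable_f_comp (hpr.comp hz) fun ω => hprf _ _
  have hif' : Integrable (fun ω => P.f (prox P.feas P.f (1 / ρ (t + 1)) (z (t + 1) ω))) μ :=
    hP.integrable_f_comp (hpr'.comp hz') fun ω => hprf _ _
  have hid : Integrable (fun ω => ‖prox P.feas P.f (1 / ρ t) (z t ω) - z t ω‖ ^ 2) μ :=
    hP.integrable_sq_dist (hpr.comp hz) hz (fun ω => hprf _ _) hzf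
  have hid1 : Integrable (fun ω => ‖prox P.feas P.f (1 / ρ t) (z t ω) - z (t + 1) ω‖ ^ 2) μ :=
    hP.integrable_sq_dist (hpr.comp hz) hz' (fun ω => hprf _ _) hzf'
  have hid' : Integrable (fun ω =>
      ‖prox P.feas P.f (1 / ρ (t + 1)) (z (t + 1) ω) - z (t + 1) ω‖ ^ 2) μ :=
    hP.integrable_sq_dist (hpr'.comp hz') hz' (fun ω => hprf _ _) hzf'
  have he : ∫ ω, P.envelope (ρ t) (z t ω) ∂μ
      = ∫ ω, P.f (prox P.feas P.f (1 / ρ t) (z t ω)) ∂μ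
        + ρ t / 2 * ∫ ω, ‖prox P.feas P.f (1 / ρ t) (z t ω) - z t ω‖ ^ 2 ∂μ := by
    unfold envelope
    rw [integral_add hif (hid.const_mul _), integral_const_mul]
  -- The proximal point of the old iterate is a competitor in the envelope at the new one.
  have he' : ∫ ω, P.envelope (ρ (t + 1)) (z (t + 1) ω) ∂μ
      ≤ ∫ ω, P.f (prox P.feas P.f (1 / ρ t) (z t ω)) ∂μ
        + ρ (t + 1) / 2 * ∫ ω, ‖prox P.feas P.f (1 / ρ t) (z t ω) - z (t + 1) ω‖ ^ 2 ∂μ := by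
    rw [← integral_const_mul, ← integral_add hif (hid1.const_mul _)]
    exact integral_mono (hif'.add (hid'.const_mul _)) (hif.add (hid1.const_mul _)) fun ω =>
      (hP.prox_spec hne _).2 _ (hprf _ _)
  simp only [norm_sub_rev (z t _)]
  set D := ∫ ω, ‖prox P.feas P.f (1 / ρ t) (z t ω) - z t ω‖ ^ 2 ∂μ
  set D1 := ∫ ω, ‖prox P.feas P.f (1 / ρ t) (z t ω) - z (t + 1) ω‖ ^ 2 ∂μ
  have hpow : (n t : ℝ) ^ (-r / 2) = ((n t : ℝ) ^ (r / 2))⁻¹ := by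
    rw [neg_div, Real.rpow_neg hn0.le]
  rw [hpow] at hstep
  have hnr : 0 < (n t : ℝ) ^ (r / 2) := by positivity
  have hρ0 : 0 ≤ ρ (t + 1) := by linarith
  -- The factor turns `α t / 2 * D1` into `ρ (t + 1) * D1`, twice the quadratic term of `he'`. On
  -- the right, `(τ + α t - ρ t) / α t = 1 - (ρ t - τ) / α t` produces the first part of the weight;
  -- the part `ρ (t + 1) - ρ t` comes from the different parameters of the two envelopes.
  have hscaled := mul_le_mul_of_nonneg_left hstep (by positivity : 0 ≤ 2 * ρ (t + 1) / α t)
  have h1 : 2 * ρ (t + 1) / α t * (α t / 2 * D1) = ρ (t + 1) * D1 := by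
    field_simp
  have h2 : 2 * ρ (t + 1) / α t * (2 * (K * ((n t : ℝ) ^ (r / 2))⁻¹) + 2 * P.L ^ 2 / (m t * α t)
        + (P.τ + α t - ρ t) / 2 * D)
      = 4 * ρ (t + 1) * K / ((n t : ℝ) ^ (r / 2) * α t)
        + 4 * ρ (t + 1) * P.L ^ 2 / (m t * α t ^ 2) + ρ (t + 1) * D
        - ρ (t + 1) * (ρ t - P.τ) / α t * D := by
    field_simp
    ring
  rw [h1, h2] at hscaled
  unfold weight
  linarith

/-- The weighted sum of the expected squared proximal residuals is within the error budget. -/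
lemma IsALSRun.sum_weight_mul_le (hP : P.Regular) (hO : O.Valid P.feas)
    (hK : P.IsEstConst O est r K) (hα : ∀ t, 0 < α t) (hn : ∀ t, 0 < n t) (hm : ∀ t, 0 < m t)
    (hρ : ∀ t, tbar ≤ t → P.τ < ρ t ∧ ρ t + P.τ ≤ α t) (hT : tbar ≤ T) (hz0 : z0 ∈ P.feas)
    (hrun : P.IsALSRun O est μ ℱ z0 T n m α S W z) :
    ∑ t ∈ Finset.Icc tbar T, P.weight ρ α t
        * ∫ ω, ‖z t ω - prox P.feas P.f (1 / ρ t) (z t ω)‖ ^ 2 ∂μ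
      ≤ P.budget r K ρ α n m tbar T := by
  have hne : P.feas.Nonempty := ⟨z0, hz0⟩
  have hprf : ∀ (s : ℝ) y, prox P.feas P.f (1 / s) y ∈ P.feas := fun s y =>
    (hP.prox_spec (ρ := s) hne y).1
  have htel : ∑ t ∈ Finset.Icc tbar T, (2 * ∫ ω, P.envelope (ρ t) (z t ω) ∂μ
      - 2 * ∫ ω, P.envelope (ρ (t + 1)) (z (t + 1) ω) ∂μ)
      = 2 * ∫ ω, P.envelope (ρ tbar) (z tbar ω) ∂μ
        - 2 * ∫ ω, P.envelope (ρ (T + 1)) (z (T + 1) ω) ∂μ := by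
    rw [← Finset.Ico_add_one_right_eq_Icc, ← neg_inj, ← Finset.sum_neg_distrib]
    simp only [neg_sub]
    exact Finset.sum_Ico_sub (fun t => 2 * ∫ ω, P.envelope (ρ t) (z t ω) ∂μ) (by omega)
  have hsum := Finset.sum_le_sum (s := Finset.Icc tbar T) fun t ht => by
    rw [Finset.mem_Icc] at ht
    exact hrun.envelope_decrease (ρ := ρ) hP hO hK hα hn hm hz0 ht.2 (hρ t ht.1).1
      (hρ (t + 1) (by omega)).1 (hρ t ht.1).2
  rw [Finset.sum_add_distrib, Finset.sum_add_distrib, htel] at hsum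
  -- The envelope at `z tbar` is at most `f (z tbar)`, taking the point itself as competitor. The
  -- last envelope is at least `f` at its proximal point, since `ρ (T + 1) > τ ≥ 0`.
  have hlast : ∫ ω, P.envelope (ρ tbar) (z tbar ω) ∂μ
      - ∫ ω, P.envelope (ρ (T + 1)) (z (T + 1) ω) ∂μ ≤ P.Δ₀ := by
    have hint : ∀ t, tbar ≤ t → t ≤ T + 1 → Integrable (fun ω => P.envelope (ρ t) (z t ω)) μ := by
      intro t h1 h2
      have hpr := hP.measurable_prox hne (hρ t h1).1
      have hz := hrun.measurable_iterate h2
      exact (hP.integrable_f_comp (hpr.comp hz) fun ω => hprf _ _).add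
        ((hP.integrable_sq_dist (hpr.comp hz) hz (fun ω => hprf _ _)
          (hrun.mem_feas hP hm hz0 t h2)).const_mul _)
    rw [← integral_sub (hint tbar le_rfl (by omega)) (hint (T + 1) (by omega) le_rfl)]
    have hc : P.Δ₀ = ∫ _ω : Ω, P.Δ₀ ∂μ := by simp
    rw [hc]
    refine integral_mono ((hint tbar le_rfl (by omega)).sub (hint (T + 1) (by omega) le_rfl))
      (integrable_const _) fun ω => ?_
    have hz := hrun.mem_feas hP hm hz0 tbar (by omega) ω
    have h1 := (hP.prox_spec (ρ := ρ tbar) hne (z tbar ω)).2 _ hz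
    have h2 := hP.f_sub_le_Δ₀ hz (hprf (ρ (T + 1)) (z (T + 1) ω))
    have h3 : 0 ≤ ρ (T + 1) / 2
        * ‖prox P.feas P.f (1 / ρ (T + 1)) (z (T + 1) ω) - z (T + 1) ω‖ ^ 2 := by
      have := (hρ (T + 1) (by omega)).1
      have := hP.τ_nonneg
      exact mul_nonneg (by linarith) (sq_nonneg _)
    simp only [sub_self, norm_zero] at h1
    simp only [envelope]
    linarith
  unfold budget
  linarith

end Run

end Problem

/-! ### ### Rate of the estimation error -/

section EstimationError

variable {n m : ℕ}

/-- Young's inequality, trading an error of first order for its square: if `V` is of order `s ^ 2`,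
the right side is of order `s`. -/
lemma le_add_inv_mul_sq {s a V : ℝ} (hs : 0 < s) (hV : a ^ 2 ≤ V) : a ≤ s + s⁻¹ * V := by
  have h1 : a ≤ s + s⁻¹ * a ^ 2 := by
    have h2 : s⁻¹ * (a - s) ^ 2 = s⁻¹ * a ^ 2 - 2 * a + s := by
      field_simp
      ring
    have h3 : 0 ≤ s⁻¹ * (a - s) ^ 2 := by positivity
    by_cases ha : 0 ≤ a
    · linarith
    · have : 0 ≤ s⁻¹ * a ^ 2 := by positivity
      linarith
  have h4 : s⁻¹ * a ^ 2 ≤ s⁻¹ * V := by gcongr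
  linarith

/-- A product of two errors is already of second order; `s ≤ 1` lets it be put in the same form as
the first-order terms. -/
lemma mul_le_add_inv_mul {s a b V : ℝ} (hs : 0 < s) (hs1 : s ≤ 1) (hV : a ^ 2 + b ^ 2 ≤ V) :
    a * b ≤ s + s⁻¹ * V := by
  have h0 : 0 ≤ V := le_trans (by positivity) hV
  have h1 : 1 ≤ s⁻¹ := (one_le_inv₀ hs).2 hs1
  nlinarith [sq_nonneg (a - b), sq_nonneg (a + b)]

lemma enorm_sq_eq_ofReal {E : Type*} [NormedAddCommGroup E] (x : E) :
    ‖x‖ₑ ^ 2 = ENNReal.ofReal (‖x‖ ^ 2) := by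
  rw [← ofReal_norm, ENNReal.ofReal_pow (norm_nonneg _)]

/-- Perturbation of the linearized response. -/
lemma norm_linResp_sub_linResp_le (c c' : Vec ℓ) (Dc Dc' : Vec d →L[ℝ] Vec ℓ) (q q' : Fin ℓ → Vec ℓ)
    (Dq Dq' : Fin ℓ → Vec d →L[ℝ] Vec ℓ) (z x : Vec d) (e e' : Vec ℓ) {B CQ CG R : ℝ}
    (hR0 : 0 ≤ R) (hB : ‖e‖ ≤ B) (hCQ : ‖op (rowMat q)‖ ≤ CQ) (hCG : √(∑ j, ‖Dq j‖ ^ 2) ≤ CG)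
    (hR : ‖x - z‖ ≤ R) :
    ‖linResp c' Dc' q' Dq' z e' x - linResp c Dc q Dq z e x‖
      ≤ ‖c' - c‖ + R * ‖Dc' - Dc‖ + B * ‖op (rowMat q' - rowMat q)‖
        + ‖op (rowMat q' - rowMat q)‖ * ‖e' - e‖ + CQ * ‖e' - e‖
        + B * R * √(∑ j, ‖Dq' j - Dq j‖ ^ 2) + R * (‖e' - e‖ * √(∑ j, ‖Dq' j - Dq j‖ ^ 2))
        + R * CG * ‖e' - e‖ := by
  -- Expand around the true data: each product then has either one error and a bounded factor, or
  -- two errors. No bound on the estimated matrices and Jacobians is needed.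
  have hsplit : linResp c' Dc' q' Dq' z e' x - linResp c Dc q Dq z e x
      = (c' - c) + (Dc' - Dc) (x - z) + op (rowMat q' - rowMat q) e
        + op (rowMat q' - rowMat q) (e' - e) + op (rowMat q) (e' - e)
        + gradNoise (fun j => Dq' j - Dq j) e (x - z)
        + gradNoise (fun j => Dq' j - Dq j) (e' - e) (x - z) + gradNoise Dq (e' - e) (x - z) := by
    simp only [linResp, op_sub, gradNoise_sub_left, gradNoise_sub_mid, sub_apply, map_sub]
    abel
  have hB0 : 0 ≤ B := (norm_nonneg _).trans hB
  rw [hsplit]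
  refine (norm_add_le _ _).trans (add_le_add ((norm_add_le _ _).trans (add_le_add
    ((norm_add_le _ _).trans (add_le_add ((norm_add_le _ _).trans (add_le_add
    ((norm_add_le _ _).trans (add_le_add ((norm_add_le _ _).trans (add_le_add
    ((norm_add_le _ _).trans (add_le_add le_rfl ?_)) ?_)) ?_)) ?_)) ?_)) ?_)) ?_)
  · calc _ ≤ ‖Dc' - Dc‖ * ‖x - z‖ := ContinuousLinearMap.le_opNorm _ _
      _ ≤ ‖Dc' - Dc‖ * R := by gcongr
      _ = _ := mul_comm _ _
  · calc _ ≤ ‖op (rowMat q' - rowMat q)‖ * ‖e‖ := ContinuousLinearMap.le_opNorm _ _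
      _ ≤ ‖op (rowMat q' - rowMat q)‖ * B := by gcongr
      _ = _ := mul_comm _ _
  · exact ContinuousLinearMap.le_opNorm _ _
  · exact (ContinuousLinearMap.le_opNorm _ _).trans (by gcongr)
  · exact (norm_gradNoise_le _ _ _).trans (by gcongr)
  · calc _ ≤ ‖e' - e‖ * ‖x - z‖ * √(∑ j, ‖Dq' j - Dq j‖ ^ 2) := norm_gradNoise_le _ _ _
      _ ≤ ‖e' - e‖ * R * √(∑ j, ‖Dq' j - Dq j‖ ^ 2) := by gcongr
      _ = _ := by ring
  · calc _ ≤ ‖e' - e‖ * ‖x - z‖ * √(∑ j, ‖Dq j‖ ^ 2) := norm_gradNoise_le _ _ _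
      _ ≤ ‖e' - e‖ * R * CG := by gcongr
      _ = _ := by ring

namespace Problem

variable {P : Problem d ℓ} {O : SimOracle d} {est : Estimators d ℓ}

/-- Error of the empirical residuals. -/
lemma Regular.norm_residual_sub_le (hP : P.Regular) {S : Fin n → Vec d × Vec ℓ}
    {w : Vec d × Vec ℓ} (hw : w.1 ∈ P.dom) {B Cc CQ CI : ℝ} (hB : ‖P.noiseOf w‖ ≤ B)
    (hBc : ‖est.c n S w.1‖ ≤ B) (hc : ‖P.c w.1‖ ≤ Cc) (hQ : ‖op (P.Q w.1)‖ ≤ CQ)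
    (hI : ‖op (P.Q w.1)⁻¹‖ ≤ CI) :
    ‖est.residual S w - P.noiseOf w‖
      ≤ CI * ‖est.c n S w.1 - P.c w.1‖
        + (B + Cc + CQ * B) * ‖op ((est.Q n S w.1)⁻¹ - (P.Q w.1)⁻¹)‖ := by
  have hη : w.2 = P.c w.1 + op (P.Q w.1) (P.noiseOf w) := by
    rw [hP.op_Q_noiseOf hw]
    abel
  -- The error of the trend is multiplied by the true inverse, and the error of the inverse by `η -
  -- ĉ`, which is bounded through the noise and the bound on `ĉ`. Thus no bound on the estimated
  -- inverse is needed.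
  have hsplit : est.residual S w - P.noiseOf w
      = op (P.Q w.1)⁻¹ (P.c w.1 - est.c n S w.1)
        + op ((est.Q n S w.1)⁻¹ - (P.Q w.1)⁻¹) (w.2 - est.c n S w.1) := by
    have h1 : P.noiseOf w = op (P.Q w.1)⁻¹ (w.2 - P.c w.1) := rfl
    have h2 : est.residual S w = op (est.Q n S w.1)⁻¹ (w.2 - est.c n S w.1) := rfl
    rw [h1, h2, op_sub]
    simp only [sub_apply, map_sub]
    abel
  rw [hsplit]
  have hB0 : 0 ≤ B := (norm_nonneg _).trans hB
  have hCQ0 : 0 ≤ CQ := (norm_nonneg _).trans hQ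
  refine (norm_add_le _ _).trans (add_le_add ?_ ?_)
  · rw [norm_sub_rev (est.c n S w.1)]
    exact (ContinuousLinearMap.le_opNorm _ _).trans (by gcongr)
  · have h3 : ‖w.2 - est.c n S w.1‖ ≤ B + Cc + CQ * B := by
      calc ‖w.2 - est.c n S w.1‖ ≤ ‖w.2‖ + ‖est.c n S w.1‖ := norm_sub_le _ _
        _ ≤ (‖P.c w.1‖ + ‖op (P.Q w.1)‖ * ‖P.noiseOf w‖) + B := by
            refine add_le_add ?_ hBc
            conv_lhs => rw [hη]
            exact (norm_add_le _ _).trans (add_le_add le_rfl (ContinuousLinearMap.le_opNorm _ _))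
        _ ≤ (Cc + CQ * B) + B := by gcongr
        _ = _ := by ring
    refine (ContinuousLinearMap.le_opNorm _ _).trans ?_
    rw [mul_comm (B + Cc + CQ * B)]
    gcongr

/-- Bounds on the data of the program over the feasible set. -/
lemma Regular.exists_bounds (hP : P.Regular) : ∃ C : ℝ, 0 ≤ C ∧ ∀ x ∈ P.feas,
    ‖P.c x‖ ≤ C ∧ ‖op (P.Q x)‖ ≤ C ∧ ‖op (P.Q x)⁻¹‖ ≤ C ∧
      √(∑ j, ‖fderiv ℝ (P.q j) x‖ ^ 2) ≤ C := by
  have hb : ∀ {g : Vec d → ℝ}, ContinuousOn g P.dom → ∃ C : ℝ, ∀ x ∈ P.feas, g x ≤ C := by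
    intro g hg
    obtain ⟨C, hC⟩ := hP.isCompact_feas.bddAbove_image (hg.mono hP.feas_subset)
    exact ⟨C, fun x hx => hC ⟨x, hx, rfl⟩⟩
  obtain ⟨C1, h1⟩ := hb hP.continuousOn_c.norm
  obtain ⟨C2, h2⟩ := hb (continuous_op.comp_continuousOn hP.continuousOn_Q).norm
  obtain ⟨C3, h3⟩ := hb (continuous_op.comp_continuousOn hP.continuousOn_inv_Q).norm
  obtain ⟨C4, h4⟩ := hb (ContinuousOn.sqrt (continuousOn_finsetSum Finset.univ fun j _ =>
    (hP.continuousOn_fderiv_q j).norm.pow 2))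
  refine ⟨max 0 (max (max C1 C2) (max C3 C4)), le_max_left _ _, fun x hx => ⟨?_, ?_, ?_, ?_⟩⟩
  · exact (h1 x hx).trans (by simp)
  · exact (h2 x hx).trans (by simp)
  · exact (h3 x hx).trans (by simp)
  · exact (h4 x hx).trans (by simp)

/-- Almost every residual point has the same design law as the reference point. -/
lemma Regular.ae_dataLaw_eq (hP : P.Regular) (hO : O.Valid P.feas) (n : ℕ) {z : Vec d}
    (hz : z ∈ P.feas) :
    ∀ᵐ w ∂(P.pairLaw (O.residualLaw z)), w.1 ∈ P.feas ∧ P.dataLaw O n z = P.dataLaw O n w.1 := by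
  have hfeas := hP.ae_pairLaw_fst (hO.ae_residualLaw hP.measurableSet_feas hz)
  -- The error assumptions at a point `y` refer to data simulated at reference point `y`, whereas
  -- residuals evaluate estimators from data simulated at `z`. For the static oracle the data law
  -- does not depend on the reference point; for the adaptive one the residual point is `z`.
  cases O with
  | static ν => exact hfeas.mono fun w hw => ⟨hw, rfl⟩
  | adaptive M =>
    have heq : ∀ᵐ w ∂(P.pairLaw ((SimOracle.adaptive M).residualLaw z)), w.1 = z := by
      refine hP.ae_pairLaw (hO.ae_residualLaw hP.measurableSet_feas hz)
        (measurable_fst (measurableSet_singleton z)) ?_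
      have h : ∀ᵐ x ∂(Measure.dirac z : Measure (Vec d)), x = z :=
        (ae_dirac_iff (measurableSet_singleton z)).2 rfl
      have h2 : ∀ᵐ y ∂((Measure.dirac z : Measure (Vec d)).prod P.noise), y.1 = z :=
        Measure.quasiMeasurePreserving_fst.ae h
      exact h2.mono fun y hy _ => hy
    filter_upwards [hfeas, heq] with w hw hwz
    exact ⟨hw, by rw [hwz]⟩

/-- Integrals over the estimation sample and one residual point, for functions controlled pointwise
on the feasible set. -/
lemma Regular.lintegral_residual_le (hP : P.Regular) (hO : O.Valid P.feas) {z : Vec d}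
    (hz : z ∈ P.feas) {U : (Fin n → Vec d × Vec ℓ) × Vec d → ENNReal} (hU : Measurable U)
    {E : ENNReal} (hE : ∀ y ∈ P.feas, ∫⁻ S, U (S, y) ∂(P.dataLaw O n y) ≤ E) (i : Fin m) :
    ∫⁻ b, U (b.1, (b.2 i).1) ∂(P.batchLaw O n m z) ≤ E := by
  have := hP.isProbabilityMeasure_dataLaw hO n hz
  have := hP.isProbabilityMeasure_residual hO hz
  have hmp : MeasurePreserving (fun b : (Fin n → Vec d × Vec ℓ) × (Fin m → Vec d × Vec ℓ) =>
      (b.1, b.2 i)) (P.batchLaw O n m z)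
      ((P.dataLaw O n z).prod (P.pairLaw (O.residualLaw z))) :=
    (MeasurePreserving.id _).prod (measurePreserving_eval _ i)
  have hU' : Measurable fun p : (Fin n → Vec d × Vec ℓ) × (Vec d × Vec ℓ) => U (p.1, p.2.1) :=
    hU.comp (measurable_fst.prodMk measurable_snd.fst)
  -- By independence of the two data sets, integrate over `S` first with the residual point fixed.
  rw [hmp.lintegral_comp hU', lintegral_prod_symm _ hU'.aemeasurable]
  calc _ ≤ ∫⁻ _w, E ∂(P.pairLaw (O.residualLaw z)) := by
        refine lintegral_mono_ae ?_
        filter_upwards [hP.ae_dataLaw_eq hO n hz] with w hw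
        rw [hw.2]
        exact hE _ hw.1
    _ = E := by simp

/-- The almost sure bound at each fixed point passes to the random residual points by integrating
the indicator of its failure, as `lintegral_residual_le` with `E = 0`. -/
lemma Regular.ae_norm_est_c_le (hP : P.Regular) (hO : O.Valid P.feas) {z : Vec d} (hz : z ∈ P.feas)
    {B : ℝ} (hB : ∀ y ∈ P.feas, ∀ᵐ S ∂(P.dataLaw O n y), ‖est.c n S y‖ ≤ B) :
    ∀ᵐ b ∂(P.batchLaw O n m z), ∀ i, ‖est.c n b.1 (b.2 i).1‖ ≤ B := by
  refine ae_all_iff.2 fun i => ?_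
  have hset : MeasurableSet {p : (Fin n → Vec d × Vec ℓ) × Vec d | B < ‖est.c n p.1 p.2‖} :=
    measurableSet_lt measurable_const (est.measurable_c n).norm
  have hU : Measurable ({p : (Fin n → Vec d × Vec ℓ) × Vec d |
      B < ‖est.c n p.1 p.2‖}.indicator fun _ => (1 : ENNReal)) := measurable_const.indicator hset
  have h0 := hP.lintegral_residual_le hO (m := m) hz hU (E := 0) (fun y hy => by
    refine le_of_eq ((lintegral_congr_ae (g := fun _ => (0 : ENNReal)) ?_).trans
      lintegral_zero)
    filter_upwards [hB y hy] with S hS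
    simp [Set.indicator, not_lt.2 hS]) i
  have hUb : Measurable fun b : (Fin n → Vec d × Vec ℓ) × (Fin m → Vec d × Vec ℓ) =>
      ({p : (Fin n → Vec d × Vec ℓ) × Vec d |
        B < ‖est.c n p.1 p.2‖}.indicator fun _ => (1 : ENNReal)) (b.1, (b.2 i).1) :=
    hU.comp (measurable_fst.prodMk ((measurable_pi_apply i).comp measurable_snd).fst)
  have h1 := (lintegral_eq_zero_iff hUb).1 (le_antisymm h0 zero_le)
  filter_upwards [h1] with b hb
  by_contra hcon
  push Not at hcon
  simp only [Pi.zero_apply] at hb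
  rw [Set.indicator_of_mem (by exact hcon)] at hb
  exact one_ne_zero hb

lemma Regular.ae_residual_sample (hP : P.Regular) (hO : O.Valid P.feas) {z : Vec d} (hz : z ∈ P.feas)
    {B : ℝ} (hB : ∀ᵐ e ∂P.noise, ‖e‖ ≤ B) :
    ∀ᵐ b ∂(P.batchLaw O n m z), ∀ i, (b.2 i).1 ∈ P.feas ∧ ‖P.noiseOf (b.2 i)‖ ≤ B := by
  have := hP.prob_noise
  have := hP.isProbabilityMeasure_dataLaw hO n hz
  have := hO.isProbabilityMeasure_residualLaw z
  have := hP.isProbabilityMeasure_residual hO hz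
  have hν := hO.ae_residualLaw hP.measurableSet_feas hz
  have h1 : ∀ᵐ w ∂(P.pairLaw (O.residualLaw z)), ‖P.noiseMap w‖ ≤ B :=
    (hP.measurePreserving_noiseMap hν).quasiMeasurePreserving.ae hB
  have h2 : ∀ᵐ w ∂(P.pairLaw (O.residualLaw z)), w.1 ∈ P.feas ∧ ‖P.noiseOf w‖ ≤ B := by
    filter_upwards [h1, hP.ae_pairLaw_fst hν] with w hw hwf
    rw [noiseMap_of_mem hwf] at hw
    exact ⟨hwf, hw⟩
  have h3 : ∀ᵐ W ∂(Measure.pi fun _ : Fin m => P.pairLaw (O.residualLaw z)),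
      ∀ i, (W i).1 ∈ P.feas ∧ ‖P.noiseOf (W i)‖ ≤ B :=
    ae_all_iff.2 fun i => (measurePreserving_eval
      (fun _ : Fin m => P.pairLaw (O.residualLaw z)) i).quasiMeasurePreserving.ae h2
  exact Measure.quasiMeasurePreserving_snd.ae h3

variable (P est) in
/-- Squared estimation errors of the data of the linearized response at `z`. -/
def refErr (n : ℕ) (z : Vec d) (S : Fin n → Vec d × Vec ℓ) : ℝ :=
  ‖est.c n S z - P.c z‖ ^ 2 + ‖est.Dc n S z - fderiv ℝ P.c z‖ ^ 2 + ‖op (est.Q n S z - P.Q z)‖ ^ 2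
    + ∑ j, ‖est.Dq j n S z - fderiv ℝ (P.q j) z‖ ^ 2

open Classical in
variable (P est) in
/-- Weighted squared estimation errors of the trend and of the inverse scale matrix, measurable in
the point of evaluation. -/
def resErr (n : ℕ) (a b : ℝ) (p : (Fin n → Vec d × Vec ℓ) × Vec d) : ℝ :=
  a * ‖est.c n p.1 p.2 - P.feas.piecewise P.c (fun _ => 0) p.2‖ ^ 2
    + b * ‖op (est.Q n p.1 p.2)⁻¹ - P.feas.piecewise (fun y => op (P.Q y)⁻¹) (fun _ => 0) p.2‖ ^ 2

lemma refErr_nonneg (z : Vec d) (S : Fin n → Vec d × Vec ℓ) : 0 ≤ P.refErr est n z S := by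
  unfold refErr
  positivity

lemma resErr_nonneg {a b : ℝ} (ha : 0 ≤ a) (hb : 0 ≤ b) (p : (Fin n → Vec d × Vec ℓ) × Vec d) :
    0 ≤ P.resErr est n a b p := by
  unfold resErr
  positivity

lemma resErr_of_mem (a b : ℝ) (S : Fin n → Vec d × Vec ℓ) {y : Vec d} (hy : y ∈ P.feas) :
    P.resErr est n a b (S, y) = a * ‖est.c n S y - P.c y‖ ^ 2
      + b * ‖op ((est.Q n S y)⁻¹ - (P.Q y)⁻¹)‖ ^ 2 := by
  classical
  simp only [resErr, Set.piecewise_eq_of_mem _ _ _ hy, op_sub]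

lemma measurable_est_Q (n : ℕ) : Measurable fun p : (Fin n → Vec d × Vec ℓ) × Vec d =>
    op (est.Q n p.1 p.2) := by
  have hq : Measurable fun p : (Fin n → Vec d × Vec ℓ) × Vec d => fun j => est.q j n p.1 p.2 :=
    measurable_pi_lambda _ fun j => est.measurable_q j n
  exact (continuous_op.comp continuous_rowMat).measurable.comp hq

lemma Regular.measurable_resErr (hP : P.Regular) (a b : ℝ) : Measurable (P.resErr est n a b) := by
  classical
  have hq : Measurable fun p : (Fin n → Vec d × Vec ℓ) × Vec d => fun j => est.q j n p.1 p.2 :=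
    measurable_pi_lambda _ fun j => est.measurable_q j n
  have h1 : Measurable (P.feas.piecewise P.c (fun _ => 0)) :=
    (hP.continuousOn_c.mono hP.feas_subset).measurable_piecewise continuousOn_const
      hP.measurableSet_feas
  have h2 : Measurable (P.feas.piecewise (fun y => op (P.Q y)⁻¹) (fun _ => 0)) :=
    ((continuous_op.comp_continuousOn hP.continuousOn_inv_Q).mono
      hP.feas_subset).measurable_piecewise continuousOn_const hP.measurableSet_feas
  have h3 : Measurable fun p : (Fin n → Vec d × Vec ℓ) × Vec d => op (est.Q n p.1 p.2)⁻¹ :=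
    measurable_op_inv.comp hq
  exact ((((est.measurable_c n).sub (h1.comp measurable_snd)).norm.pow_const 2).const_mul a).add
    (((h3.sub (h2.comp measurable_snd)).norm.pow_const 2).const_mul b)

lemma measurable_refErr (z : Vec d) : Measurable (P.refErr est n z) := by
  have hz : Measurable fun S : Fin n → Vec d × Vec ℓ => (S, z) := measurable_prodMk_right
  have h1 := (((est.measurable_c n).comp hz).sub_const (P.c z)).norm.pow_const 2
  have h2 := (((est.measurable_Dc n).comp hz).sub_const (fderiv ℝ P.c z)).norm.pow_const 2
  have h3 := (((measurable_est_Q (est := est) n).comp hz).sub_const (op (P.Q z))).norm.pow_const 2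
  have h4 := fun j => (((est.measurable_Dq j n).comp hz).sub_const
    (fderiv ℝ (P.q j) z)).norm.pow_const 2
  unfold refErr
  simp only [op_sub]
  exact ((h1.add h2).add h3).add (Finset.measurable_fun_sum _ fun j _ => h4 j)

/-- Pointwise bound on the error of one summand of the learning-based surrogate. -/
lemma Regular.exists_summand_bound (hP : P.Regular) (est : Estimators d ℓ) {B : ℝ} (hB : 0 < B) :
    ∃ M a b : ℝ, 0 ≤ M ∧ 0 ≤ a ∧ 0 ≤ b ∧ ∀ (n : ℕ) (S : Fin n → Vec d × Vec ℓ) (w : Vec d × Vec ℓ)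
      (z x : Vec d) (s : ℝ), z ∈ P.feas → x ∈ P.feas → w.1 ∈ P.feas → ‖P.noiseOf w‖ ≤ B →
      ‖est.c n S w.1‖ ≤ B → 0 < s → s ≤ 1 →
      |P.φ x (est.resp S z (est.residual S w) x) - P.linCost z (P.noiseOf w) x|
        ≤ M * (s + s⁻¹ * (P.refErr est n z S + P.resErr est n a b (S, w.1))) := by
  obtain ⟨C, hC0, hC⟩ := hP.exists_bounds
  obtain ⟨R, hR0, hR⟩ := hP.exists_norm_sub_le
  have hLφ := hP.Lφ_nonneg
  -- `M` collects the coefficients of the eight terms of `norm_linResp_sub_linResp_le`; `a` and `b`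
  -- come from `(p + q) ^ 2 ≤ 2 * p ^ 2 + 2 * q ^ 2` applied to the bound on the residual error.
  refine ⟨P.Lφ * (1 + R + B + 1 + C + B * R + R + R * C), 2 * C ^ 2, 2 * (B + C + C * B) ^ 2,
    by positivity, by positivity, by positivity, ?_⟩
  intro n S w z x s hz hx hw hwB hcB hs hs1
  have hδ := hP.norm_residual_sub_le (est := est) (hP.feas_subset hw) hwB hcB (hC _ hw).1
    (hC _ hw).2.1 (hC _ hw).2.2.1
  have hlin := norm_linResp_sub_linResp_le (P.c z) (est.c n S z) (fderiv ℝ P.c z) (est.Dc n S z)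
    (fun j => P.q j z) (fun j => est.q j n S z) (fun j => fderiv ℝ (P.q j) z)
    (fun j => est.Dq j n S z) z x (P.noiseOf w) (est.residual S w) hR0 hwB (hC z hz).2.1
    (hC z hz).2.2.2 (hR x hx z hz)
  rw [mul_assoc]
  refine (hP.cost_sub_le_right (hP.feas_subset hx) _ _).trans
    (mul_le_mul_of_nonneg_left (hlin.trans ?_) hLφ)
  rw [resErr_of_mem _ _ _ hw]
  set δ := ‖est.residual S w - P.noiseOf w‖
  set u := ‖est.c n S w.1 - P.c w.1‖
  set v := ‖op ((est.Q n S w.1)⁻¹ - (P.Q w.1)⁻¹)‖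
  have hδ2 : δ ^ 2 ≤ 2 * C ^ 2 * u ^ 2 + 2 * (B + C + C * B) ^ 2 * v ^ 2 := by
    have h1 : δ ^ 2 ≤ (C * u + (B + C + C * B) * v) ^ 2 :=
      pow_le_pow_left₀ (norm_nonneg _) hδ 2
    nlinarith [sq_nonneg (C * u - (B + C + C * B) * v)]
  unfold refErr
  have hγ : √(∑ j, ‖est.Dq j n S z - fderiv ℝ (P.q j) z‖ ^ 2) ^ 2
      = ∑ j, ‖est.Dq j n S z - fderiv ℝ (P.q j) z‖ ^ 2 :=
    Real.sq_sqrt (Finset.sum_nonneg fun j _ => sq_nonneg _)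
  set γ := √(∑ j, ‖est.Dq j n S z - fderiv ℝ (P.q j) z‖ ^ 2)
  rw [← hγ]
  change ‖est.c n S z - P.c z‖ + R * ‖est.Dc n S z - fderiv ℝ P.c z‖
    + B * ‖op (est.Q n S z - P.Q z)‖ + ‖op (est.Q n S z - P.Q z)‖ * δ + C * δ + B * R * γ
    + R * (δ * γ) + R * C * δ ≤ _
  set a1 := ‖est.c n S z - P.c z‖
  set a2 := ‖est.Dc n S z - fderiv ℝ P.c z‖
  set a3 := ‖op (est.Q n S z - P.Q z)‖
  -- `V` dominates every squared error, including `δ ^ 2`, and the sums of two squares needed for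
  -- the products, so all eight terms share one bound.
  set V := a1 ^ 2 + a2 ^ 2 + a3 ^ 2 + γ ^ 2
    + (2 * C ^ 2 * u ^ 2 + 2 * (B + C + C * B) ^ 2 * v ^ 2) with hV
  have s1 := sq_nonneg a1
  have s2 := sq_nonneg a2
  have s3 := sq_nonneg a3
  have s4 := sq_nonneg γ
  have s5 := sq_nonneg δ
  have b1 : a1 ≤ s + s⁻¹ * V := le_add_inv_mul_sq hs (by linarith)
  have b2 : a2 ≤ s + s⁻¹ * V := le_add_inv_mul_sq hs (by linarith)
  have b3 : a3 ≤ s + s⁻¹ * V := le_add_inv_mul_sq hs (by linarith)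
  have b4 : γ ≤ s + s⁻¹ * V := le_add_inv_mul_sq hs (by linarith)
  have b5 : δ ≤ s + s⁻¹ * V := le_add_inv_mul_sq hs (by linarith)
  have b6 : a3 * δ ≤ s + s⁻¹ * V := mul_le_add_inv_mul hs hs1 (by linarith)
  have b7 : δ * γ ≤ s + s⁻¹ * V := mul_le_add_inv_mul hs hs1 (by linarith)
  generalize s + s⁻¹ * V = H at b1 b2 b3 b4 b5 b6 b7 ⊢
  calc a1 + R * a2 + B * a3 + a3 * δ + C * δ + B * R * γ + R * (δ * γ) + R * C * δ
      ≤ H + R * H + B * H + H + C * H + B * R * H + R * H + R * C * H := by gcongr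
    _ = _ := by ring

lemma lintegral_refErr_le {z : Vec d} {μ : Measure (Fin n → Vec d × Vec ℓ)} {E : ENNReal}
    (h1 : ∫⁻ S, ‖est.c n S z - P.c z‖ₑ ^ 2 ∂μ ≤ E)
    (h2 : ∫⁻ S, ‖est.Dc n S z - fderiv ℝ P.c z‖ₑ ^ 2 ∂μ ≤ E)
    (h3 : ∫⁻ S, ‖op (est.Q n S z - P.Q z)‖ₑ ^ 2 ∂μ ≤ E)
    (h4 : ∀ j, ∫⁻ S, ‖est.Dq j n S z - fderiv ℝ (P.q j) z‖ₑ ^ 2 ∂μ ≤ E) :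
    ∫⁻ S, ENNReal.ofReal (P.refErr est n z S) ∂μ ≤ (3 + ℓ) * E := by
  have hz : Measurable fun S : Fin n → Vec d × Vec ℓ => (S, z) := measurable_prodMk_right
  have m1 : Measurable fun S : Fin n → Vec d × Vec ℓ => ‖est.c n S z - P.c z‖ₑ ^ 2 :=
    (((est.measurable_c n).comp hz).sub_const (P.c z)).enorm.pow_const 2
  have m2 : Measurable fun S : Fin n → Vec d × Vec ℓ => ‖est.Dc n S z - fderiv ℝ P.c z‖ₑ ^ 2 :=
    (((est.measurable_Dc n).comp hz).sub_const (fderiv ℝ P.c z)).enorm.pow_const 2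
  have m3 : Measurable fun S : Fin n → Vec d × Vec ℓ => ‖op (est.Q n S z - P.Q z)‖ₑ ^ 2 := by
    simp only [op_sub]
    exact (((measurable_est_Q (est := est) n).comp hz).sub_const (op (P.Q z))).enorm.pow_const 2
  have m4 : ∀ j, Measurable fun S : Fin n → Vec d × Vec ℓ =>
      ‖est.Dq j n S z - fderiv ℝ (P.q j) z‖ₑ ^ 2 := fun j =>
    (((est.measurable_Dq j n).comp hz).sub_const (fderiv ℝ (P.q j) z)).enorm.pow_const 2
  have heq : ∀ S, ENNReal.ofReal (P.refErr est n z S) = ‖est.c n S z - P.c z‖ₑ ^ 2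
      + ‖est.Dc n S z - fderiv ℝ P.c z‖ₑ ^ 2 + ‖op (est.Q n S z - P.Q z)‖ₑ ^ 2
      + ∑ j, ‖est.Dq j n S z - fderiv ℝ (P.q j) z‖ₑ ^ 2 := by
    intro S
    unfold refErr
    rw [ENNReal.ofReal_add (by positivity) (by positivity),
      ENNReal.ofReal_add (by positivity) (by positivity),
      ENNReal.ofReal_add (by positivity) (by positivity),
      ENNReal.ofReal_sum_of_nonneg fun j _ => by positivity]
    simp only [enorm_sq_eq_ofReal]
  simp only [heq]
  rw [lintegral_add_left ((m1.fun_add m2).fun_add m3), lintegral_add_left (m1.fun_add m2),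
    lintegral_add_left m1, lintegral_finsetSum _ fun j _ => m4 j]
  calc _ ≤ E + E + E + ∑ _j : Fin ℓ, E :=
        add_le_add (add_le_add (add_le_add h1 h2) h3) (Finset.sum_le_sum fun j _ => h4 j)
    _ = (3 + ℓ) * E := by
        rw [Finset.sum_const, Finset.card_univ, Fintype.card_fin, nsmul_eq_mul]
        ring

lemma lintegral_resErr_le {y : Vec d} (hy : y ∈ P.feas) {μ : Measure (Fin n → Vec d × Vec ℓ)}
    {E : ENNReal} {a b : ℝ} (ha : 0 ≤ a) (hb : 0 ≤ b)
    (h1 : ∫⁻ S, ‖est.c n S y - P.c y‖ₑ ^ 2 ∂μ ≤ E)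
    (h2 : ∫⁻ S, ‖op ((est.Q n S y)⁻¹ - (P.Q y)⁻¹)‖ₑ ^ 2 ∂μ ≤ E) :
    ∫⁻ S, ENNReal.ofReal (P.resErr est n a b (S, y)) ∂μ ≤ ENNReal.ofReal (a + b) * E := by
  have hz : Measurable fun S : Fin n → Vec d × Vec ℓ => (S, y) := measurable_prodMk_right
  have m1 : Measurable fun S : Fin n → Vec d × Vec ℓ => ‖est.c n S y - P.c y‖ₑ ^ 2 :=
    (((est.measurable_c n).comp hz).sub_const (P.c y)).enorm.pow_const 2
  have heq : ∀ S, ENNReal.ofReal (P.resErr est n a b (S, y))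
      = ENNReal.ofReal a * ‖est.c n S y - P.c y‖ₑ ^ 2
        + ENNReal.ofReal b * ‖op ((est.Q n S y)⁻¹ - (P.Q y)⁻¹)‖ₑ ^ 2 := by
    intro S
    rw [resErr_of_mem _ _ _ hy, ENNReal.ofReal_add (by positivity) (by positivity),
      ENNReal.ofReal_mul ha, ENNReal.ofReal_mul hb]
    simp only [enorm_sq_eq_ofReal]
  simp only [heq]
  rw [lintegral_add_left (m1.const_mul _), lintegral_const_mul' _ _ ENNReal.ofReal_ne_top,
    lintegral_const_mul' _ _ ENNReal.ofReal_ne_top, ENNReal.ofReal_add ha hb, add_mul]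
  gcongr

/-- The estimation error of the learning-based surrogates has the rate `n ^ (-r / 2)`. -/
lemma Regular.exists_isEstConst (hP : P.Regular) (hO : O.Valid P.feas) (hbdd : P.EssBounded O est)
    {r : ℝ} (hrate : P.EstRates O est r) : ∃ K : ℝ, P.IsEstConst O est r K := by
  obtain ⟨B, hB, hBe, hBc⟩ := hbdd
  obtain ⟨hr, -, C, hC, hCr⟩ := hrate
  obtain ⟨M, a, b, hM, ha, hb, hbound⟩ := hP.exists_summand_bound est hB
  -- The `1` inside is the first-order slack `s`; `3 + ℓ` counts the errors at `z`, and `a + b`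
  -- weighs those at the residual points. The final `+ 1` makes the constant positive even if `M =
  -- 0`.
  refine ⟨M * (1 + (3 + ℓ + (a + b)) * C) + 1, by positivity, ?_⟩
  intro n m hn hm α hα z hz
  have hm' : (0 : ℝ) < m := Nat.cast_pos.2 hm
  have hn' : (0 : ℝ) < n := Nat.cast_pos.2 hn
  have := hP.isProbabilityMeasure_dataLaw hO n hz
  have := hP.isProbabilityMeasure_residual hO hz
  -- This scale balances the two terms: `s⁻¹ * n ^ (-r) = s`.
  set s : ℝ := (n : ℝ) ^ (-r / 2) with hs
  have hs0 : 0 < s := by positivity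
  have hs1 : s ≤ 1 := Real.rpow_le_one_of_one_le_of_nonpos (by exact_mod_cast hn) (by linarith)
  have hss : s⁻¹ * (n : ℝ) ^ (-r) = s := by
    have : (n : ℝ) ^ (-r) = s * s := by
      rw [hs, ← Real.rpow_add hn']
      congr 1
      ring
    rw [this]
    field_simp
  set E : ENNReal := ENNReal.ofReal (C * (n : ℝ) ^ (-r)) with hE
  let V : (Fin n → Vec d × Vec ℓ) → ENNReal := fun S => ENNReal.ofReal (P.refErr est n z S)
  let U : (Fin n → Vec d × Vec ℓ) × Vec d → ENNReal := fun p =>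
    ENNReal.ofReal (P.resErr est n a b p)
  have hV : Measurable V := (measurable_refErr z).ennreal_ofReal
  have hU : Measurable U := (hP.measurable_resErr a b).ennreal_ofReal
  have hVint : ∫⁻ b, V b.1 ∂(P.batchLaw O n m z) ≤ (3 + ℓ) * E := by
    have hmp : MeasurePreserving (Prod.fst :
        (Fin n → Vec d × Vec ℓ) × (Fin m → Vec d × Vec ℓ) → _) (P.batchLaw O n m z)
        (P.dataLaw O n z) := measurePreserving_fst
    rw [hmp.lintegral_comp hV]
    obtain ⟨h1, h2, h3, h4, -⟩ := hCr n hn z hz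
    exact lintegral_refErr_le h1 h2 h3 h4
  have hUint : ∀ i : Fin m, ∫⁻ c, U (c.1, (c.2 i).1) ∂(P.batchLaw O n m z)
      ≤ ENNReal.ofReal (a + b) * E := fun i =>
    hP.lintegral_residual_le hO hz hU (fun y hy => by
      obtain ⟨h1, -, -, -, h5⟩ := hCr n hn y hy
      exact lintegral_resErr_le hy ha hb h1 h5) i
  -- The summand bound does not depend on `x`, so it controls the supremum over the feasible set
  -- before integration.
  have hpoint : ∀ᵐ c ∂(P.batchLaw O n m z),
      ⨆ x ∈ P.feas, ENNReal.ofReal |est.batchSurrogate P.φ c.1 c.2 α z x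
        - P.batchSurrogate c.2 α z x|
      ≤ ENNReal.ofReal (M * s)
        + ∑ i : Fin m, ENNReal.ofReal (M * s⁻¹ / m) * (V c.1 + U (c.1, (c.2 i).1)) := by
    filter_upwards [hP.ae_residual_sample hO (n := n) (m := m) hz hBe,
      hP.ae_norm_est_c_le hO (n := n) (m := m) hz (hBc n hn)] with c hc1 hc2
    refine iSup₂_le fun x hx => ?_
    have hreal : |est.batchSurrogate P.φ c.1 c.2 α z x - P.batchSurrogate c.2 α z x|
        ≤ M * s + ∑ i : Fin m, M * s⁻¹ / m
          * (P.refErr est n z c.1 + P.resErr est n a b (c.1, (c.2 i).1)) := by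
      rw [Estimators.batchSurrogate_eq hm, batchSurrogate_eq hm]
      unfold regAvg avgCost
      rw [add_sub_add_right_eq_sub, ← sub_div, ← Finset.sum_sub_distrib, abs_div,
        abs_of_pos hm', div_le_iff₀ hm']
      calc _ ≤ ∑ i : Fin m, |P.φ x (est.resp c.1 z (est.residual c.1 (c.2 i)) x)
            - P.linCost z (P.noiseOf (c.2 i)) x| := Finset.abs_sum_le_sum_abs _ _
        _ ≤ ∑ i : Fin m, M * (s + s⁻¹ * (P.refErr est n z c.1
            + P.resErr est n a b (c.1, (c.2 i).1))) := Finset.sum_le_sum fun i _ =>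
            hbound n c.1 (c.2 i) z x s hz hx (hc1 i).1 (hc1 i).2 (hc2 i) hs0 hs1
        _ = _ := by
            simp only [mul_add M]
            rw [Finset.sum_add_distrib, Finset.sum_const, Finset.card_univ, Fintype.card_fin,
              nsmul_eq_mul, add_mul, Finset.sum_mul]
            congr 1
            · ring
            · refine Finset.sum_congr rfl fun i _ => ?_
              field_simp
    refine (ENNReal.ofReal_le_ofReal hreal).trans (le_of_eq ?_)
    have hnn : ∀ i : Fin m, 0 ≤ P.refErr est n z c.1 + P.resErr est n a b (c.1, (c.2 i).1) :=
      fun i => add_nonneg (refErr_nonneg _ _) (resErr_nonneg ha hb _)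
    have hcoef : 0 ≤ M * s⁻¹ / m := by positivity
    rw [ENNReal.ofReal_add (by positivity)
      (Finset.sum_nonneg fun i _ => mul_nonneg hcoef (hnn i)),
      ENNReal.ofReal_sum_of_nonneg fun i _ => mul_nonneg hcoef (hnn i)]
    refine congrArg₂ _ rfl (Finset.sum_congr rfl fun i _ => ?_)
    rw [ENNReal.ofReal_mul hcoef,
      ENNReal.ofReal_add (refErr_nonneg _ _) (resErr_nonneg ha hb _)]
  have hmV : Measurable fun c : (Fin n → Vec d × Vec ℓ) × (Fin m → Vec d × Vec ℓ) => V c.1 :=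
    hV.comp measurable_fst
  have hmU : ∀ i : Fin m, Measurable fun c : (Fin n → Vec d × Vec ℓ) × (Fin m → Vec d × Vec ℓ) =>
      U (c.1, (c.2 i).1) := fun i =>
    hU.comp (measurable_fst.prodMk ((measurable_pi_apply i).comp measurable_snd).fst)
  calc _ ≤ ∫⁻ c, (ENNReal.ofReal (M * s) + ∑ i : Fin m, ENNReal.ofReal (M * s⁻¹ / m)
        * (V c.1 + U (c.1, (c.2 i).1))) ∂(P.batchLaw O n m z) := lintegral_mono_ae hpoint
    _ = ENNReal.ofReal (M * s) + ∑ i : Fin m, ENNReal.ofReal (M * s⁻¹ / m)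
        * (∫⁻ c, V c.1 ∂(P.batchLaw O n m z)
          + ∫⁻ c, U (c.1, (c.2 i).1) ∂(P.batchLaw O n m z)) := by
        have : IsProbabilityMeasure (P.batchLaw O n m z) := by
          unfold batchLaw
          infer_instance
        rw [lintegral_add_left measurable_const, lintegral_const, measure_univ, mul_one,
          lintegral_finsetSum _ fun i _ => ((hmV.fun_add (hmU i)).const_mul _)]
        refine congrArg₂ _ rfl (Finset.sum_congr rfl fun i _ => ?_)
        rw [lintegral_const_mul _ (hmV.fun_add (hmU i)), lintegral_add_left hmV]
    _ ≤ ENNReal.ofReal (M * s) + ∑ _i : Fin m, ENNReal.ofReal (M * s⁻¹ / m)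
        * ((3 + ℓ) * E + ENNReal.ofReal (a + b) * E) := by
        gcongr with i _
        exact hUint i
    _ = ENNReal.ofReal (M * s
        + m * (M * s⁻¹ / m * ((3 + ℓ) * (C * (n : ℝ) ^ (-r)) + (a + b) * (C * (n : ℝ) ^ (-r))))) := by
        have h3 : (3 + ℓ : ENNReal) = ENNReal.ofReal (3 + ℓ) := by
          rw [ENNReal.ofReal_add (by norm_num) (by positivity), ENNReal.ofReal_natCast]
          norm_num
        rw [Finset.sum_const, Finset.card_univ, Fintype.card_fin, nsmul_eq_mul, h3, hE,
          ← ENNReal.ofReal_mul (by positivity), ← ENNReal.ofReal_mul (by positivity),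
          ← ENNReal.ofReal_add (by positivity) (by positivity),
          ← ENNReal.ofReal_mul (by positivity), ← ENNReal.ofReal_natCast,
          ← ENNReal.ofReal_mul (by positivity), ← ENNReal.ofReal_add (by positivity) (by positivity)]
    _ ≤ _ := by
        refine ENNReal.ofReal_le_ofReal ?_
        have h5 : M * s + m * (M * s⁻¹ / m * ((3 + ℓ) * (C * (n : ℝ) ^ (-r))
            + (a + b) * (C * (n : ℝ) ^ (-r))))
            = M * s + M * (3 + ℓ + (a + b)) * C * (s⁻¹ * (n : ℝ) ^ (-r)) := by
          field_simp
        rw [h5, hss]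
        nlinarith

end Problem

end EstimationError

end ALS

end

/-! ### ### The convergence bounds -/

theorem theorem2 {d ℓ : ℕ} (P : ALS.Problem d ℓ) (hP : P.Regular)
    (O : ALS.SimOracle d) (hO : O.Valid P.feas)
    (est : ALS.Estimators d ℓ) (hinv : P.EstInvertible O est)
    (hbdd : P.EssBounded O est) (r : ℝ) (hrate : P.EstRates O est r) :
    (∃ K : ℝ, P.IsEstConst O est r K) ∧
    ∀ K : ℝ, P.IsEstConst O est r K →
    ∀ (ρ α : ℕ → ℝ) (n m : ℕ → ℕ) (tbar T : ℕ),
      (∀ t, 0 < α t) → (∀ t, 0 < n t) → (∀ t, 0 < m t) →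
      (∀ t, tbar ≤ t → P.τ < ρ t ∧ ρ t + P.τ ≤ α t ∧
        α t * (ρ (t + 1) - ρ t) < ρ (t + 1) * (ρ t - P.τ)) →
      tbar ≤ T →
    ∀ {Ω : Type*} [mΩ : MeasurableSpace Ω] (μ : Measure Ω) [IsProbabilityMeasure μ]
      (ℱ : Filtration ℕ mΩ) (z0 : ALS.Vec d)
      (S : (t : ℕ) → Ω → Fin (n t) → ALS.Vec d × ALS.Vec ℓ)
      (W : (t : ℕ) → Ω → Fin (m t) → ALS.Vec d × ALS.Vec ℓ)
      (z : ℕ → Ω → ALS.Vec d) (tstar : Ω → ℕ),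
      z0 ∈ P.feas →
      P.IsALSRun O est μ ℱ z0 T n m α S W z →
      Measurable tstar →
      (∀ t, μ.real (tstar ⁻¹' {t}) = P.polyakProb ρ α tbar T t) →
      IndepFun tstar (fun ω (t : Fin (T + 1)) => z t ω) μ →
      Integrable (fun ω => ‖z (tstar ω) ω
        - ALS.prox P.feas P.f (1 / ρ (tstar ω)) (z (tstar ω) ω)‖ ^ 2) μ ∧
      Integrable (fun ω => ρ (tstar ω) ^ 2) μ ∧
      ∫ ω, ‖z (tstar ω) ω - ALS.prox P.feas P.f (1 / ρ (tstar ω)) (z (tstar ω) ω)‖ ^ 2 ∂μ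
        ≤ P.budget r K ρ α n m tbar T / ∑ t ∈ Finset.Icc tbar T, P.weight ρ α t ∧
      (∫ ω, ρ (tstar ω) ^ 2 ∂μ) *
        ∫ ω, ‖z (tstar ω) ω - ALS.prox P.feas P.f (1 / ρ (tstar ω)) (z (tstar ω) ω)‖ ^ 2 ∂μ
        ≤ (∑ t ∈ Finset.Icc tbar T, ρ t ^ 2 * P.weight ρ α t) * P.budget r K ρ α n m tbar T
          / (∑ t ∈ Finset.Icc tbar T, P.weight ρ α t) ^ 2 := by
  refine ⟨hP.exists_isEstConst hO hbdd hrate, ?_⟩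
  intro K hK ρ α n m tbar T hα hn hm hpar hT Ω mΩ μ _ ℱ z0 S W z tstar hz0 hrun hts hprob hind
  have hne : P.feas.Nonempty := ⟨z0, hz0⟩
  have hρ : ∀ t, tbar ≤ t → P.τ < ρ t ∧ ρ t + P.τ ≤ α t := fun t ht =>
    ⟨(hpar t ht).1, (hpar t ht).2.1⟩
  -- Positivity of the weight is the third parameter condition divided by `α t`.
  have hw : ∀ t ∈ Finset.Icc tbar T, 0 < P.weight ρ α t := by
    intro t ht
    have h := (hpar t (Finset.mem_Icc.1 ht).1).2.2
    unfold ALS.Problem.weight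
    rw [sub_pos, lt_div_iff₀ (hα t)]
    linarith
  set wsum := ∑ t ∈ Finset.Icc tbar T, P.weight ρ α t
  have hwsum : 0 < wsum := Finset.sum_pos hw ⟨tbar, Finset.mem_Icc.2 ⟨le_rfl, hT⟩⟩
  have hp : ∀ t ∈ Finset.Icc tbar T, μ.real (tstar ⁻¹' {t}) = P.weight ρ α t / wsum := by
    intro t ht
    rw [hprob t, ALS.Problem.polyakProb, if_pos (Finset.mem_Icc.1 ht)]
  -- Each index outside the window has probability zero, and there are countably many.
  have hmem : ∀ᵐ ω ∂μ, tstar ω ∈ Finset.Icc tbar T := by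
    have hnull : ∀ t, t ∉ Finset.Icc tbar T → ∀ᵐ ω ∂μ, tstar ω ≠ t := by
      intro t ht
      have h := hprob t
      rw [ALS.Problem.polyakProb, if_neg (fun h => ht (Finset.mem_Icc.2 h)),
        measureReal_eq_zero_iff] at h
      exact measure_eq_zero_iff_ae_notMem.1 h
    have hall : ∀ᵐ ω ∂μ, ∀ t, t ∉ Finset.Icc tbar T → tstar ω ≠ t :=
      ae_all_iff.2 fun t => ae_all_iff.2 fun ht => hnull t ht
    filter_upwards [hall] with ω hω
    by_contra hcon
    exact hω _ hcon rfl
  have hz : ∀ t ∈ Finset.Icc tbar T, Measurable (z t) := fun t ht =>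
    hrun.measurable_iterate (by have := (Finset.mem_Icc.1 ht).2; omega)
  have hindz : ∀ t ∈ Finset.Icc tbar T, IndepFun tstar (z t) μ := by
    intro t ht
    have htT := (Finset.mem_Icc.1 ht).2
    exact hind.comp measurable_id (measurable_pi_apply (⟨t, by omega⟩ : Fin (T + 1)))
  have hψ : ∀ t ∈ Finset.Icc tbar T, Measurable fun y : ALS.Vec d =>
      ‖y - ALS.prox P.feas P.f (1 / ρ t) y‖ ^ 2 := fun t ht =>
    (measurable_id.sub (hP.measurable_prox hne (hρ t (Finset.mem_Icc.1 ht).1).1)).norm.pow_const 2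
  have hint : ∀ t ∈ Finset.Icc tbar T, Integrable (fun ω =>
      ‖z t ω - ALS.prox P.feas P.f (1 / ρ t) (z t ω)‖ ^ 2) μ := fun t ht =>
    hP.integrable_sq_dist (hz t ht)
      ((hP.measurable_prox hne (hρ t (Finset.mem_Icc.1 ht).1).1).comp (hz t ht))
      (hrun.mem_feas hP hm hz0 t (by have := (Finset.mem_Icc.1 ht).2; omega))
      (fun ω => (hP.prox_spec hne _).1)
  obtain ⟨hi1, he1⟩ := ALS.integral_random_index (I := Finset.Icc tbar T) hts hmem hz hindz
    (ψ := fun t y => ‖y - ALS.prox P.feas P.f (1 / ρ t) y‖ ^ 2) hψ hint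
  obtain ⟨hi2, he2⟩ := ALS.integral_random_index (I := Finset.Icc tbar T) hts hmem hz hindz
    (ψ := fun t _ => ρ t ^ 2) (fun t _ => measurable_const) fun t _ => integrable_const _
  -- The probabilities are the weights divided by `wsum`, so the mixture is the weighted sum of the
  -- descent estimate over `wsum`.
  have hbound : ∑ t ∈ Finset.Icc tbar T, μ.real (tstar ⁻¹' {t})
      * ∫ ω, ‖z t ω - ALS.prox P.feas P.f (1 / ρ t) (z t ω)‖ ^ 2 ∂μ
      ≤ P.budget r K ρ α n m tbar T / wsum := by
    rw [le_div_iff₀ hwsum, Finset.sum_mul]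
    refine (Finset.sum_congr rfl fun t ht => ?_).trans_le
      (hrun.sum_weight_mul_le hP hO hK hα hn hm hρ hT hz0)
    rw [hp t ht]
    field_simp
  have hsq : ∫ ω, ρ (tstar ω) ^ 2 ∂μ
      = (∑ t ∈ Finset.Icc tbar T, ρ t ^ 2 * P.weight ρ α t) / wsum := by
    rw [he2, Finset.sum_div]
    refine Finset.sum_congr rfl fun t ht => ?_
    rw [hp t ht, integral_const, probReal_univ, one_smul]
    ring
  refine ⟨hi1, hi2, he1.trans_le hbound, ?_⟩
  rw [hsq, he1]
  have hnum : 0 ≤ ∑ t ∈ Finset.Icc tbar T, ρ t ^ 2 * P.weight ρ α t :=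
    Finset.sum_nonneg fun t ht => mul_nonneg (sq_nonneg _) (hw t ht).le
  calc _ ≤ (∑ t ∈ Finset.Icc tbar T, ρ t ^ 2 * P.weight ρ α t) / wsum
        * (P.budget r K ρ α n m tbar T / wsum) :=
        mul_le_mul_of_nonneg_left hbound (div_nonneg hnum hwsum.le)
    _ = _ := by
        field_simp
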